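/- Let $n\ge 1$, let $N$ be an oriented smooth manifold of dimension $n+1$ with a locally flat projective structure, and write $\mathcal E(w)=(\wedge^{n+1}T^*N)^{-w/(n+2)}$ for the projective densities of weight $w$. Fix an arbitrary projective scale, i.e. a positive section $\tau$ of $\mathcal E(1)$, let $\nabla$ be the torsion-free connection in the projective class with $\nabla\tau=0$, and let $P_{ij}=\frac1n\mathrm{Ric}_{ij}$; local flatness means that the projective Weyl curvature $R_{ij}{}^k{}_l-\delta_i^kP_{jl}+\delta_j^kP_{il}$ vanishes. Let $\Omega\subset N$ be a relatively compact domain with smooth strictly convex boundary $M=\partial\Omega$, and let $\boldsymbol\rho=\tau^2\rho\in\mathcal E(2)$ be a defining density of $\Omega$ ($\Omega=\{\rho<0\}$, $d\rho\ne0$ on $M$, $\nabla_i\nabla_j\rho|_{TM}>0$). Put $$\widetilde g_{IJ}=D_ID_J\boldsymbol\rho=\begin{pmatrix}2\boldsymbol\rho&\nabla_j\boldsymbol\rho\\ \nabla_i\boldsymbol\rho&\nabla_i\nabla_j\boldsymbol\rho+2P_{ij}\boldsymbol\rho\end{pmatrix},\qquad \mathcal J[\boldsymbol\rho]=\det(D_ID_J\boldsymbol\rho).$$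 Assume that $\boldsymbol\rho$ is a Fefferman defining density: near $M$, $\mathcal J[\boldsymbol\rho]=-1+O(\boldsymbol\rho^\infty)$ if $n$ is odd, and $\mathcal J[\boldsymbol\rho]=-1+\mathcal O\boldsymbol\rho^{n/2+1}$ with a smooth $\mathcal O\in\mathcal E(-n-2)$ if $n$ is even. Regard $\widetilde g$ as a metric on the $\mathbb R_+$-bundle $\widetilde N=\mathcal E(-1)_+$ over $N$ (nondegenerate near $M$; with the fibre coordinate $t$ given by $\tau^{-1}$, $\widetilde g=2\rho\,dt^2+2t\,\nabla_i\rho\,dt\,dx^i+t^2(\nabla_i\nabla_j\rho+2\rho P_{ij})dx^idx^j$), regard sections of $\mathcal E(w)$ as functions on $\widetilde N$ homogeneous of degree $w$, and let $\widetilde\Delta=-\widetilde g^{IJ}\widetilde\nabla_I\widetilde\nabla_J$ with the Levi-Civita connection $\widetilde\nabla$ of $\widetilde g$. For $n$ even, $\boldsymbol\rho$ is called strict if in addition $\widetilde\Delta\mathcal O=0$ on $M$. Let $\mathcal E[w]=\mathcal E(w)|_M$, which is identified with $(\wedge^nT^*M)^{-w/n}$ by $\tau|_M\mapsto vol_h^{-1/n}$.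 Here $h$ is the affine metric of $M$ in the scale $\tau$: the Riemannian metric such that, for a transverse field $\xi$ with $d\rho(\xi)>0$, $\nabla_XY\equiv-h(X,Y)\xi$ modulo $TM$ for $X,Y$ tangent to $M$, and $(\xi\lrcorner\,\tau^{-(n+2)})|_{TM}=vol_h$. For $m\ge1$ the GJMS operator is $$P_m:\mathcal E[m-n/2]\to\mathcal E[-m-n/2],\qquad P_mf=\widetilde\Delta^m\widetilde f\,|_M,$$ where $\widetilde f\in\mathcal E(m-n/2)$ is any smooth extension of $f$. Call $P_m$ formally self-adjoint if it is well defined (independent of the extension) and $\int_M f_1P_mf_2=\int_M f_2P_mf_1$ for all smooth $f_1,f_2\in\mathcal E[m-n/2]$; the integrands are integrable sections of $\mathcal E[-n]=\wedge^nT^*M$, where $\tau^{-n}u$ corresponds to $u\,vol_h$. Then: (i) $P_m$ is formally self-adjoint for all $m\ge1$ if $n$ is odd, and for $1\le m\le n/2$ if $n$ is even. (ii) If $n$ is even and $\boldsymbol\rho$ is a strict Fefferman defining density, then $P_{n/2+2}$ is formally self-adjoint. -/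

import Mathlib

open scoped Manifold ContDiff Topology

noncomputable section

namespace ConformalCodazzi

/-! ### Coordinate calculus on `ℝᵈ` and the Laplacian of a pseudo-Riemannian metric -/

/-- The Euclidean space `ℝᵈ`. -/
abbrev Eu (d : ℕ) : Type := EuclideanSpace ℝ (Fin d)

/-- The partial derivative `∂_A u` at `z`. -/
def pd {d : ℕ} (A : Fin d) (u : Eu d → ℝ) (z : Eu d) : ℝ :=
  fderiv ℝ u z (EuclideanSpace.single A 1)

/-- The Christoffel symbols `Γ_{AB}^C` at `z` of the Levi-Civita connection of the
pseudo-Riemannian metric with components `G`. -/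
def leviCivita {d : ℕ} (G : Eu d → Matrix (Fin d) (Fin d) ℝ) (A B C : Fin d) (z : Eu d) : ℝ :=
  1 / 2 * ∑ D, (G z)⁻¹ C D *
    (pd A (fun y => G y B D) z + pd B (fun y => G y A D) z - pd D (fun y => G y A B) z)

/-- The Laplacian `-G^{AB} ∇_A ∇_B u` of the metric `G`, with `∇` its Levi-Civita connection. -/
def laplacian {d : ℕ} (G : Eu d → Matrix (Fin d) (Fin d) ℝ) (u : Eu d → ℝ) (z : Eu d) : ℝ :=
  -∑ A, ∑ B, (G z)⁻¹ A B * (pd A (pd B u) z - ∑ C, leviCivita G A B C z * pd C u z)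

section Manifold

/-! ### Connections and volume forms in the coordinates of a chart

`N` is a smooth manifold of dimension `n + 1`.  Components are taken in an arbitrary smooth
chart `φ`, at a point `x` of the target of `φ`. -/

variable {n : ℕ} {N : Type*} [TopologicalSpace N] [ChartedSpace (Eu (n + 1)) N]
  [IsManifold 𝓘(ℝ, Eu (n + 1)) ∞ N]

/-- The smooth charts of `N` (the maximal `C^∞` atlas). -/
def smoothCharts (n : ℕ) (N : Type*) [TopologicalSpace N] [ChartedSpace (Eu (n + 1)) N] :
    Set (OpenPartialHomeomorph N (Eu (n + 1))) :=
  IsManifold.maximalAtlas 𝓘(ℝ, Eu (n + 1)) ∞ N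

/-- The coordinate vector field `∂_i = (dφ)⁻¹ e_i` of the chart `φ`. -/
def coordField (φ : OpenPartialHomeomorph N (Eu (n + 1))) (i : Fin (n + 1)) (p : N) :
    TangentSpace 𝓘(ℝ, Eu (n + 1)) p :=
  (mfderiv 𝓘(ℝ, Eu (n + 1)) 𝓘(ℝ, Eu (n + 1)) φ p).inverse
    (EuclideanSpace.single i (1 : ℝ) : Eu (n + 1))

/-- Affine connections on `N`: Mathlib's covariant derivatives on the tangent bundle.
`∇ Y p X` is `∇_X Y` at `p`. -/
abbrev Connection (n : ℕ) (N : Type*) [TopologicalSpace N] [ChartedSpace (Eu (n + 1)) N]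
    [IsManifold 𝓘(ℝ, Eu (n + 1)) ∞ N] :=
  CovariantDerivative 𝓘(ℝ, Eu (n + 1)) (Eu (n + 1))
    (fun p : N => TangentSpace 𝓘(ℝ, Eu (n + 1)) p)

/-- Fields of `(n+1)`-forms on `N`. -/
abbrev VolumeForm (n : ℕ) (N : Type*) [TopologicalSpace N] [ChartedSpace (Eu (n + 1)) N] :=
  ∀ p : N, (TangentSpace 𝓘(ℝ, Eu (n + 1)) p) [⋀^Fin (n + 1)]→L[ℝ] ℝ

/-- The connection coefficients `Γ_{ij}^k`, given by `∇_{∂_i} ∂_j = Γ_{ij}^k ∂_k`. -/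
def gam (cov : Connection n N) (φ : OpenPartialHomeomorph N (Eu (n + 1)))
    (i j k : Fin (n + 1)) (x : Eu (n + 1)) : ℝ :=
  (EuclideanSpace.proj k : Eu (n + 1) →L[ℝ] ℝ)
    (mfderiv 𝓘(ℝ, Eu (n + 1)) 𝓘(ℝ, Eu (n + 1)) φ (φ.symm x)
      (cov (coordField φ j) (φ.symm x) (coordField φ i (φ.symm x))))

/-- The coefficient `η(∂_0, …, ∂_n)` of an `(n+1)`-form. -/
def volCoef (η : VolumeForm n N) (φ : OpenPartialHomeomorph N (Eu (n + 1)))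
    (x : Eu (n + 1)) : ℝ :=
  η (φ.symm x) (fun i => coordField φ i (φ.symm x))

/-- `η` is the volume form `τ^{-(n+2)}` of a projective scale `τ ∈ 𝓔(1)`, and `∇` is the
representative with `∇τ = 0`: the form `η` is smooth, nowhere zero, and parallel for `∇`.
The orientation of `N` is the one given by `η`.  In the scale `τ`, a density `τ^w f ∈ 𝓔(w)` is
represented by the function `f`. -/
structure IsProjectiveScale (cov : Connection n N) (η : VolumeForm n N) : Prop where
  ne_zero : ∀ p, η p ≠ 0
  smooth : ∀ φ ∈ smoothCharts n N, ContDiffOn ℝ ∞ (volCoef η φ) φ.target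
  parallel : ∀ φ ∈ smoothCharts n N, ∀ x ∈ φ.target, ∀ i,
    pd i (volCoef η φ) x = (∑ k, gam cov φ i k k x) * volCoef η φ x

/-- The curvature `R_{ij}{}^k{}_l`, with `(∇_i ∇_j - ∇_j ∇_i) X^k = R_{ij}{}^k{}_l X^l`. -/
def curv (cov : Connection n N) (φ : OpenPartialHomeomorph N (Eu (n + 1)))
    (i j k l : Fin (n + 1)) (x : Eu (n + 1)) : ℝ :=
  pd i (gam cov φ j l k) x - pd j (gam cov φ i l k) x +
    ∑ s, (gam cov φ i s k x * gam cov φ j l s x - gam cov φ j s k x * gam cov φ i l s x)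

/-- The projective Schouten tensor `P_{ij} = (1/n) Ric_{ij}`, where `Ric_{ij} = R_{ki}{}^k{}_j`. -/
def schouten (cov : Connection n N) (φ : OpenPartialHomeomorph N (Eu (n + 1)))
    (i j : Fin (n + 1)) (x : Eu (n + 1)) : ℝ :=
  1 / (n : ℝ) * ∑ k, curv cov φ k i k j x

/-- Local flatness: the projective Weyl curvature
`C_{ij}{}^k{}_l = R_{ij}{}^k{}_l - (δ_i^k P_{jl} - δ_j^k P_{il})` vanishes. -/
def IsProjectivelyFlat (cov : Connection n N) : Prop :=
  ∀ φ ∈ smoothCharts n N, ∀ x ∈ φ.target, ∀ i j k l : Fin (n + 1),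
    curv cov φ i j k l x -
      ((if i = k then schouten cov φ j l x else 0) -
        (if j = k then schouten cov φ i l x else 0)) = 0

/-- The Hessian `∇_i ∇_j f`. -/
def hess (cov : Connection n N) (φ : OpenPartialHomeomorph N (Eu (n + 1))) (f : N → ℝ)
    (i j : Fin (n + 1)) (x : Eu (n + 1)) : ℝ :=
  pd i (pd j (f ∘ φ.symm)) x - ∑ k, gam cov φ i j k x * pd k (f ∘ φ.symm) x

/-! ### The ambient metric and the Monge–Ampère operator -/

/-- The tractor `D_I D_J ρ` of a density `τ² ρ ∈ 𝓔(2)`, that is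
`((2ρ, ∇_j ρ), (∇_i ρ, ∇_i ∇_j ρ + 2 ρ P_{ij}))` in the scale `τ`. -/
def tractorHess (cov : Connection n N) (φ : OpenPartialHomeomorph N (Eu (n + 1))) (ρ : N → ℝ)
    (x : Eu (n + 1)) : Matrix (Fin (n + 2)) (Fin (n + 2)) ℝ :=
  Matrix.of fun I J =>
    Fin.cases
      (Fin.cases (2 * ρ (φ.symm x)) (fun j => pd j (ρ ∘ φ.symm) x) J)
      (fun i => Fin.cases (pd i (ρ ∘ φ.symm) x)
        (fun j => hess cov φ ρ i j x + 2 * ρ (φ.symm x) * schouten cov φ i j x) J) I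

/-- The Monge–Ampère operator `𝒥[ρ] = det (D_I D_J ρ)`.  The determinant of the components is
divided by the square of the coefficient of the volume form, as the determinant of a tractor is
taken with respect to the volume form `t^{n+1} dt ∧ τ^{-(n+2)}` of the ambient space. -/
def mongeAmpere (cov : Connection n N) (η : VolumeForm n N) (ρ : N → ℝ) (p : N) : ℝ :=
  (tractorHess cov (chartAt (Eu (n + 1)) p) ρ (chartAt (Eu (n + 1)) p p)).det /
    volCoef η (chartAt (Eu (n + 1)) p) (chartAt (Eu (n + 1)) p p) ^ 2

/-- The base coordinates `x` of a point `(t, x)` of the ambient space. -/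
def basePt (z : Eu (n + 2)) : Eu (n + 1) := WithLp.toLp 2 fun i => z i.succ

/-- The point `(t, x)` of the ambient space. -/
def ambPt {d : ℕ} (t : ℝ) (x : Eu d) : Eu (d + 1) := WithLp.toLp 2 (Fin.cons t x)

/-- The ambient metric `g̃_{IJ} = D_I D_J ρ` as a metric on the ambient space `Ñ = 𝓔(-1)₊`, in the
coordinates `(t, x)` where `x` are the coordinates of `φ` and `t > 0` is the fibre coordinate
given by `τ^{-1}`.  The tractor frame consists of the Euler field `t ∂_t` and of fields
homogeneous of degree `-1`, which gives
`g̃ = 2ρ dt² + 2t (∇_i ρ) dt dx^i + t² (∇_i ∇_j ρ + 2 ρ P_{ij}) dx^i dx^j`. -/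
def ambientMetric (cov : Connection n N) (φ : OpenPartialHomeomorph N (Eu (n + 1))) (ρ : N → ℝ)
    (z : Eu (n + 2)) : Matrix (Fin (n + 2)) (Fin (n + 2)) ℝ :=
  Matrix.of fun A B =>
    (if A = 0 then 1 else z 0) * (if B = 0 then 1 else z 0) *
      tractorHess cov φ ρ (basePt z) A B

/-- A density `τ^w f ∈ 𝓔(w)` as the function `t^w f(x)` on the ambient space, homogeneous of
degree `w`. -/
def homogFun (φ : OpenPartialHomeomorph N (Eu (n + 1))) (w : ℝ) (f : N → ℝ)
    (z : Eu (n + 2)) : ℝ :=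
  z 0 ^ w * f (φ.symm (basePt z))

/-- `Δ̃^m f̃` for a density `f̃ = τ^w f ∈ 𝓔(w)`, where `Δ̃` is the Laplacian of the ambient metric.
This is a density of weight `w - 2m`; its value at `p` in the scale `τ` is the value of the
homogeneous function at the point `t = 1` of the fibre over `p`. -/
def ambientLapPow (cov : Connection n N) (ρ : N → ℝ) (m : ℕ) (w : ℝ) (f : N → ℝ) (p : N) : ℝ :=
  (laplacian (ambientMetric cov (chartAt (Eu (n + 1)) p) ρ))^[m]
    (homogFun (chartAt (Eu (n + 1)) p) w f) (ambPt 1 (chartAt (Eu (n + 1)) p p))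

/-! ### Strictly convex domains and Fefferman defining densities -/

/-- `τ² ρ` is a (smooth) defining density of the domain `Ω` with smooth boundary. -/
structure IsDefining (Ω : Set N) (ρ : N → ℝ) : Prop where
  smooth : ContMDiff 𝓘(ℝ, Eu (n + 1)) 𝓘(ℝ) ∞ ρ
  neg : Ω = {p | ρ p < 0}
  regular : ∀ p ∈ frontier Ω, mfderiv 𝓘(ℝ, Eu (n + 1)) 𝓘(ℝ) ρ p ≠ 0

/-- Strict convexity of the boundary: `∇_i ∇_j ρ` is positive definite on `TM`, `M = ∂Ω`. -/
def IsStrictlyConvex (cov : Connection n N) (Ω : Set N) (ρ : N → ℝ) : Prop :=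
  ∀ φ ∈ smoothCharts n N, ∀ x ∈ φ.target, φ.symm x ∈ frontier Ω →
    ∀ v : Fin (n + 1) → ℝ, v ≠ 0 → ∑ i, v i * pd i (ρ ∘ φ.symm) x = 0 →
      0 < ∑ i, ∑ j, hess cov φ ρ i j x * v i * v j

/-- `𝒥[ρ] = -1 + 𝒪 ρ^k` near `∂Ω`, with a smooth density `𝒪`. -/
def MongeAmpereMod (cov : Connection n N) (η : VolumeForm n N) (Ω : Set N) (ρ : N → ℝ) (k : ℕ)
    (O : N → ℝ) : Prop :=
  ∃ U : Set N, IsOpen U ∧ frontier Ω ⊆ U ∧ ContMDiffOn 𝓘(ℝ, Eu (n + 1)) 𝓘(ℝ) ∞ O U ∧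
    ∀ p ∈ U, mongeAmpere cov η ρ p = -1 + O p * ρ p ^ k

/-- Fefferman defining densities: `𝒥[ρ] = -1 + O(ρ^∞)` if `n` is odd, and
`𝒥[ρ] = -1 + 𝒪 ρ^{n/2+1}` if `n` is even. -/
def IsFefferman (cov : Connection n N) (η : VolumeForm n N) (Ω : Set N) (ρ : N → ℝ) : Prop :=
  (Odd n → ∀ k : ℕ, ∃ O, MongeAmpereMod cov η Ω ρ k O) ∧
    (Even n → ∃ O, MongeAmpereMod cov η Ω ρ (n / 2 + 1) O)

/-- Strict Fefferman defining densities (`n` even): `𝒥[ρ] = -1 + 𝒪 ρ^{n/2+1}` with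
`𝒪 ∈ 𝓔(-n-2)` such that `Δ̃ 𝒪 = O(ρ)`. -/
def IsStrictFefferman (cov : Connection n N) (η : VolumeForm n N) (Ω : Set N) (ρ : N → ℝ) :
    Prop :=
  ∃ O, MongeAmpereMod cov η Ω ρ (n / 2 + 1) O ∧
    ∀ p ∈ frontier Ω, ambientLapPow cov ρ 1 (-(n : ℝ) - 2) O p = 0

/-! ### The affine metric and its volume measure -/

/-- Boundary charts: smooth charts in which `Ω` is the half space `x⁰ < 0` and `M = ∂Ω` is the
hyperplane `x⁰ = 0`, so that `∂_1, …, ∂_n` are tangent to `M` and `∂_0` points outwards. -/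
def boundaryCharts (Ω : Set N) : Set (OpenPartialHomeomorph N (Eu (n + 1))) :=
  {φ | φ ∈ smoothCharts n N ∧ ∀ x ∈ φ.target,
    (φ.symm x ∈ Ω ↔ x 0 < 0) ∧ (φ.symm x ∈ frontier Ω ↔ x 0 = 0)}

/-- In a boundary chart, the components `b_{αβ} = -Γ_{αβ}^0` of the second fundamental form with
respect to the outward transverse field `∂_0`: `∇_{∂_α} ∂_β = -b_{αβ} ∂_0` modulo `TM`. -/
def secondFund (cov : Connection n N) (φ : OpenPartialHomeomorph N (Eu (n + 1)))
    (x : Eu (n + 1)) : Matrix (Fin n) (Fin n) ℝ :=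
  Matrix.of fun α β => -gam cov φ α.succ β.succ 0 x

/-- The transverse component `ξ⁰` (with respect to `∂_0`) of the affine normal field `ξ` in a
boundary chart.  It is the solution of `(ξ ⌟ η)|_{TM} = vol_h`, `∇_X Y = -h(X, Y) ξ mod TM`; see
`affineMetric_spec`. -/
def affineNormalComp (cov : Connection n N) (η : VolumeForm n N)
    (φ : OpenPartialHomeomorph N (Eu (n + 1))) (x : Eu (n + 1)) : ℝ :=
  ((secondFund cov φ x).det / volCoef η φ x ^ 2) ^ (1 / ((n : ℝ) + 2))

/-- The affine metric `h` of `M`, in a boundary chart. -/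
def affineMetric (cov : Connection n N) (η : VolumeForm n N)
    (φ : OpenPartialHomeomorph N (Eu (n + 1))) (x : Eu (n + 1)) : Matrix (Fin n) (Fin n) ℝ :=
  (affineNormalComp cov η φ x)⁻¹ • secondFund cov φ x

/-- The defining properties of the affine metric: `h` is a Riemannian metric with
`∇_{∂_α} ∂_β = -h_{αβ} ξ` modulo `TM` for an outward field `ξ` with
`(ξ ⌟ η)|_{TM} = vol_h` (up to the orientation of the chart). -/
theorem affineMetric_spec (cov : Connection n N) (η : VolumeForm n N)
    (φ : OpenPartialHomeomorph N (Eu (n + 1))) (x : Eu (n + 1))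
    (hpos : (secondFund cov φ x).PosDef) (hη : volCoef η φ x ≠ 0) :
    (affineMetric cov η φ x).PosDef ∧ 0 < affineNormalComp cov η φ x ∧
      (∀ α β : Fin n, gam cov φ α.succ β.succ 0 x =
        -affineMetric cov η φ x α β * affineNormalComp cov η φ x) ∧
      |volCoef η φ x| * affineNormalComp cov η φ x = √(affineMetric cov η φ x).det := by
  have hdet := hpos.det_pos
  have hv : 0 < volCoef η φ x ^ 2 := by positivity
  have hq : 0 < (secondFund cov φ x).det / volCoef η φ x ^ 2 := div_pos hdet hv
  have hc : 0 < affineNormalComp cov η φ x := Real.rpow_pos_of_pos hq _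
  have hcpow : affineNormalComp cov η φ x ^ (n + 2) =
      (secondFund cov φ x).det / volCoef η φ x ^ 2 := by
    unfold affineNormalComp
    rw [← Real.rpow_natCast, ← Real.rpow_mul hq.le]
    have : (1 / ((n : ℝ) + 2)) * ((n + 2 : ℕ) : ℝ) = 1 := by
      push_cast
      field_simp
    rw [this, Real.rpow_one]
  refine ⟨hpos.smul (inv_pos.mpr hc), hc, ?_, ?_⟩
  · intro α β
    simp only [affineMetric, secondFund, Matrix.smul_apply, Matrix.of_apply, smul_eq_mul]
    field_simp
  · rw [eq_comm, Real.sqrt_eq_iff_mul_self_eq_of_pos (by positivity)]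
    rw [affineMetric, Matrix.det_smul, Fintype.card_fin]
    have h1 : (secondFund cov φ x).det =
        affineNormalComp cov η φ x ^ (n + 2) * volCoef η φ x ^ 2 := by
      rw [hcpow]
      field_simp
    rw [h1, ← sq_abs (volCoef η φ x), pow_add, inv_pow]
    field_simp

/-- The Riemannian volume measure of `(M, h)`, as a measure on `N` carried by `M`: the supremum
(that is, the gluing) of the measures `√(det h) dy` over all boundary charts. -/
def affineVolume [MeasurableSpace N] (cov : Connection n N) (η : VolumeForm n N) (Ω : Set N) :
    MeasureTheory.Measure N :=
  ⨆ φ ∈ boundaryCharts (n := n) Ω,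
    (((MeasureTheory.volume : MeasureTheory.Measure (Eu n)).restrict
        {y | ambPt 0 y ∈ φ.target}).withDensity
      (fun y => ENNReal.ofReal √(affineMetric cov η φ (ambPt 0 y)).det)).map
    (fun y => φ.symm (ambPt 0 y))

/-! ### The GJMS operators -/

/-- Smooth functions on the closed hypersurface `M = ∂Ω`; in the scale `τ` they represent the
smooth sections of the conformal density bundles `𝓔[w] = 𝓔(w)|_M`. -/
def BdrySmooth {Ω : Set N} (f : frontier Ω → ℝ) : Prop :=
  ∃ F : N → ℝ, ContMDiff 𝓘(ℝ, Eu (n + 1)) 𝓘(ℝ) ∞ F ∧ ∀ p : frontier Ω, F p = f p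

open Classical in
/-- The GJMS operator `P_m : 𝓔[m - n/2] → 𝓔[-m - n/2]`, `P_m f = Δ̃^m f̃ |_M` for an extension
`f̃ ∈ 𝓔(m - n/2)` of `f`. -/
def gjms (cov : Connection n N) (Ω : Set N) (ρ : N → ℝ) (m : ℕ) (f : frontier Ω → ℝ)
    (p : frontier Ω) : ℝ :=
  if h : BdrySmooth (n := n) f then
    ambientLapPow cov ρ m ((m : ℝ) - (n : ℝ) / 2) h.choose p
  else 0

/-- `P_m` does not depend on the extensions that are used, and it is formally self-adjoint:
`∫_M f₁ P_m f₂ = ∫_M f₂ P_m f₁` for all `f₁, f₂ ∈ 𝓔[m - n/2]`.  The integrands are sections of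
`𝓔[-n] = Λⁿ T*M`, and `τ^{-n} f` corresponds to `f vol_h`. -/
structure IsFormallySelfAdjoint [MeasurableSpace N] (cov : Connection n N) (η : VolumeForm n N)
    (Ω : Set N) (ρ : N → ℝ) (m : ℕ) : Prop where
  well_defined : ∀ F : N → ℝ, ContMDiff 𝓘(ℝ, Eu (n + 1)) 𝓘(ℝ) ∞ F → ∀ p : frontier Ω,
    gjms cov Ω ρ m (fun q => F q) p = ambientLapPow cov ρ m ((m : ℝ) - (n : ℝ) / 2) F p
  integrable : ∀ f₁ f₂ : frontier Ω → ℝ, BdrySmooth (n := n) f₁ → BdrySmooth (n := n) f₂ →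
    MeasureTheory.Integrable (fun p => f₁ p * gjms cov Ω ρ m f₂ p)
      ((affineVolume cov η Ω).comap Subtype.val)
  symmetric : ∀ f₁ f₂ : frontier Ω → ℝ, BdrySmooth (n := n) f₁ → BdrySmooth (n := n) f₂ →
    ∫ p, f₁ p * gjms cov Ω ρ m f₂ p ∂((affineVolume cov η Ω).comap Subtype.val) =
      ∫ p, f₂ p * gjms cov Ω ρ m f₁ p ∂((affineVolume cov η Ω).comap Subtype.val)

end Manifold

end ConformalCodazzi

end

/-!
The GJMS operators of a Fefferman defining density are formally self-adjoint because, by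
Green's identity for the ambient metric, the antisymmetrized obstruction to harmonic extension off
the null cone is a divergence.

Since `g̃` is the ambient Hessian of the function `r = t² ρ` of degree two, the gradient of `r` is
the Euler field. In coordinates with `ρ = x⁰` this is the whole structure that is needed
(`IsAdapted`): the Laplacian acts on functions of degree `w` by an operator `L_w` on the base
(`coneLap`, `laplacian_homog`), and the commutator of `Δ̃` with multiplication by `r` is
`-(2w + n + 2)` on degree `w` (`IsAdapted.coneLap_coord_mul`). For `w = m - n/2` an extension `f`
can be corrected successively to a function `u` with `u = f` on `M` and
`L_w u = c ρ^{m-1} Δ̃^m f`, `c ≠ 0` (`IsAdapted.exists_harmonic`).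

Apply Green's identity (`green_identity`) to two such functions `u`, `v`. The component of the
current `u ∇v - v ∇u` along `dρ` equals `-2 ρ Y`, where `Y` is the radial component, and the
radial derivative is given by homogeneity, so that the non-tangential part of the divergence is
`(2m - 2) Y - 2 ρ ∂₀Y`. Its derivative of order `m - 1` in the normal direction vanishes on `M`.
What remains is that `f Δ̃^m g - g Δ̃^m f`, with the volume density of `g̃`, is a tangential
divergence on `M` (`IsAdapted.obstruction_eq_divergence`) and has integral zero if `f` has compact
support in the chart (`IsAdapted.integral_lapPow_antisymm`). This holds for arbitrary extensions
`f` and `g`. If `g` vanishes on `M`, then `Δ̃^m g|_M` is therefore orthogonal to all test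
functions, and is zero (`IsAdapted.lapPow_eq_zero_of_boundary`): the operator is well defined.

To globalize, the tractor `D_I D_J ρ` is shown to transform as a tensor (`tractorHess_trans`), so
that `Δ̃^m` may be computed in charts with `ρ = x⁰` (`ambientLapPow_eq_lapPow`,
`exists_adaptedChart`). The equation `𝒥[ρ] = -1` on `M` says that the affine volume density is the
volume density of `g̃` in such charts (`sqrt_det_affineMetric_eq_density`), and a partition of
unity finishes the proof (`IsNormalized.isFormallySelfAdjoint`).
-/

noncomputable section

namespace ConformalCodazzi

/-! ### Partial derivatives -/

section PartialDerivatives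

variable {d d' : ℕ}

theorem pd_congr {A : Fin d} {u v : Eu d → ℝ} {z : Eu d} (h : u =ᶠ[𝓝 z] v) :
    pd A u z = pd A v z := by
  simp only [pd, h.fderiv_eq]

theorem pd_congr_of_eqOn {V : Set (Eu d)} (hV : IsOpen V) {A : Fin d} {u v : Eu d → ℝ}
    (h : Set.EqOn u v V) {z : Eu d} (hz : z ∈ V) : pd A u z = pd A v z :=
  pd_congr (h.eventuallyEq_of_mem (hV.mem_nhds hz))

theorem pd_contDiffOn {V : Set (Eu d)} (hV : IsOpen V) (A : Fin d) {u : Eu d → ℝ}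
    (hu : ContDiffOn ℝ ∞ u V) : ContDiffOn ℝ ∞ (pd A u) V :=
  (hu.fderiv_of_isOpen hV (by simp)).clm_apply contDiffOn_const

theorem differentiableAt_of_smooth {V : Set (Eu d)} (hV : IsOpen V) {u : Eu d → ℝ}
    (hu : ContDiffOn ℝ ∞ u V) {z : Eu d} (hz : z ∈ V) : DifferentiableAt ℝ u z :=
  (hu.contDiffAt (hV.mem_nhds hz)).differentiableAt (by simp)

@[simp] theorem pd_const (A : Fin d) (c : ℝ) (z : Eu d) : pd A (fun _ => c) z = 0 := by
  simp [pd]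

theorem pd_add {A : Fin d} {u v : Eu d → ℝ} {z : Eu d} (hu : DifferentiableAt ℝ u z)
    (hv : DifferentiableAt ℝ v z) : pd A (fun y => u y + v y) z = pd A u z + pd A v z := by
  simp only [pd]; rw [fderiv_fun_add hu hv]; rfl

theorem pd_sub {A : Fin d} {u v : Eu d → ℝ} {z : Eu d} (hu : DifferentiableAt ℝ u z)
    (hv : DifferentiableAt ℝ v z) : pd A (fun y => u y - v y) z = pd A u z - pd A v z := by
  simp only [pd]; rw [fderiv_fun_sub hu hv]; rfl

theorem pd_mul {A : Fin d} {u v : Eu d → ℝ} {z : Eu d} (hu : DifferentiableAt ℝ u z)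
    (hv : DifferentiableAt ℝ v z) :
    pd A (fun y => u y * v y) z = pd A u z * v z + u z * pd A v z := by
  simp only [pd]; rw [fderiv_fun_mul hu hv]; simp; ring

theorem pd_const_mul {A : Fin d} (c : ℝ) {v : Eu d → ℝ} {z : Eu d}
    (hv : DifferentiableAt ℝ v z) : pd A (fun y => c * v y) z = c * pd A v z := by
  rw [pd_mul (by fun_prop) hv]; simp

theorem pd_sum {ι : Type*} {s : Finset ι} {A : Fin d} {u : ι → Eu d → ℝ} {z : Eu d}
    (hu : ∀ i ∈ s, DifferentiableAt ℝ (u i) z) :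
    pd A (fun y => ∑ i ∈ s, u i y) z = ∑ i ∈ s, pd A (u i) z := by
  simp only [pd]; rw [fderiv_fun_sum hu]; simp

theorem pd_coord (A B : Fin d) (z : Eu d) :
    pd A (fun y : Eu d => y B) z = if B = A then 1 else 0 := by
  have : (fun y : Eu d => y B) = (EuclideanSpace.proj B : Eu d →L[ℝ] ℝ) := rfl
  simp only [pd]
  rw [this, ContinuousLinearMap.fderiv]
  simp

theorem pd_comm {V : Set (Eu d)} (hV : IsOpen V) {A B : Fin d} {u : Eu d → ℝ}
    (hu : ContDiffOn ℝ ∞ u V) {z : Eu d} (hz : z ∈ V) :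
    pd A (pd B u) z = pd B (pd A u) z := by
  have hd : DifferentiableAt ℝ (fderiv ℝ u) z :=
    ((hu.fderiv_of_isOpen hV (m := ∞) (by simp)).contDiffAt (hV.mem_nhds hz)).differentiableAt
      (by simp)
  have key : ∀ A B : Fin d, pd A (pd B u) z =
      fderiv ℝ (fderiv ℝ u) z (EuclideanSpace.single A 1) (EuclideanSpace.single B 1) := by
    intro A B
    have : pd B u = fun y => fderiv ℝ u y (EuclideanSpace.single B 1) := rfl
    rw [this]
    simp only [pd]
    rw [fderiv_clm_apply hd (by fun_prop)]
    simp
  rw [key, key]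
  have hs : IsSymmSndFDerivAt ℝ u z :=
    (hu.contDiffAt (hV.mem_nhds hz)).isSymmSndFDerivAt (by
      simpa using WithTop.coe_le_coe.2 (le_top : (2 : ℕ∞) ≤ ⊤))
  exact hs _ _

theorem euclidean_eq_sum_single (v : Eu d) :
    v = ∑ a, v a • (EuclideanSpace.single a (1 : ℝ) : Eu d) := by
  ext j
  simp [Pi.single_apply]

theorem fderiv_eq_sum_pd (u : Eu d → ℝ) (z v : Eu d) :
    fderiv ℝ u z v = ∑ a, v a * pd a u z := by
  conv_lhs => rw [euclidean_eq_sum_single v]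
  simp [pd]

theorem fderiv_apply_coord {Φ : Eu d → Eu d'} {z : Eu d} (hΦ : DifferentiableAt ℝ Φ z)
    (v : Eu d) (a : Fin d') : fderiv ℝ Φ z v a = fderiv ℝ (fun y => Φ y a) z v := by
  have : (fun y => Φ y a) = (EuclideanSpace.proj a : Eu d' →L[ℝ] ℝ) ∘ Φ := rfl
  rw [this, ((EuclideanSpace.proj a : Eu d' →L[ℝ] ℝ).hasFDerivAt.comp z hΦ.hasFDerivAt).fderiv]
  rfl

/-- The chain rule. -/
theorem pd_comp {Φ : Eu d → Eu d'} {u : Eu d' → ℝ} {z : Eu d} (i : Fin d)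
    (hu : DifferentiableAt ℝ u (Φ z)) (hΦ : DifferentiableAt ℝ Φ z) :
    pd i (fun y => u (Φ y)) z = ∑ a, pd i (fun y => Φ y a) z * pd a u (Φ z) := by
  have : (fun y => u (Φ y)) = u ∘ Φ := rfl
  rw [this]
  conv_lhs => simp only [pd]
  rw [fderiv_comp z hu hΦ]
  simp only [ContinuousLinearMap.comp_apply]
  rw [fderiv_eq_sum_pd]
  refine Finset.sum_congr rfl fun a _ => ?_
  rw [fderiv_apply_coord hΦ]; rfl

end PartialDerivatives

/-! ### Matrix-valued functions -/

section MatrixCalculus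

variable {d k : ℕ}

/-- The entrywise partial derivative of a matrix-valued function. -/
def pdM (C : Fin d) (G : Eu d → Matrix (Fin k) (Fin k) ℝ) (z : Eu d) :
    Matrix (Fin k) (Fin k) ℝ :=
  Matrix.of fun A B => pd C (fun y => G y A B) z

/-- Smoothness of a matrix-valued function, entry by entry. -/
def SmoothMat (V : Set (Eu d)) (G : Eu d → Matrix (Fin k) (Fin k) ℝ) : Prop :=
  ∀ A B, ContDiffOn ℝ ∞ (fun y => G y A B) V

theorem SmoothMat.det {V : Set (Eu d)} {G : Eu d → Matrix (Fin k) (Fin k) ℝ}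
    (hG : SmoothMat V G) : ContDiffOn ℝ ∞ (fun y => (G y).det) V := by
  simp only [Matrix.det_apply']
  refine ContDiffOn.sum fun σ _ => contDiffOn_const.mul (contDiffOn_prod fun i _ => hG _ _)

theorem SmoothMat.adjugate {V : Set (Eu d)} {G : Eu d → Matrix (Fin k) (Fin k) ℝ}
    (hG : SmoothMat V G) : SmoothMat V (fun y => (G y).adjugate) := by
  intro A B
  simp only [Matrix.adjugate_apply]
  refine SmoothMat.det (G := fun y => (G y).updateRow B (Pi.single A 1)) fun I J => ?_
  by_cases h : I = B
  · subst h; simp only [Matrix.updateRow_self]; exact contDiffOn_const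
  · simp only [Matrix.updateRow_ne h]; exact hG _ _

theorem SmoothMat.inv {V : Set (Eu d)} {G : Eu d → Matrix (Fin k) (Fin k) ℝ}
    (hG : SmoothMat V G) (hdet : ∀ y ∈ V, (G y).det ≠ 0) :
    SmoothMat V (fun y => (G y)⁻¹) := by
  intro A B
  simp only [Matrix.inv_def, Ring.inverse_eq_inv', Matrix.smul_apply, smul_eq_mul]
  exact (hG.det.inv hdet).mul (hG.adjugate A B)

theorem SmoothMat.differentiableAt {V : Set (Eu d)} (hV : IsOpen V)
    {G : Eu d → Matrix (Fin k) (Fin k) ℝ} (hG : SmoothMat V G) {z : Eu d} (hz : z ∈ V)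
    (A B : Fin k) : DifferentiableAt ℝ (fun y => G y A B) z :=
  differentiableAt_of_smooth hV (hG A B) hz

theorem pdM_mul {C : Fin d} {G H : Eu d → Matrix (Fin k) (Fin k) ℝ} {z : Eu d}
    (hG : ∀ A B, DifferentiableAt ℝ (fun y => G y A B) z)
    (hH : ∀ A B, DifferentiableAt ℝ (fun y => H y A B) z) :
    pdM C (fun y => G y * H y) z = pdM C G z * H z + G z * pdM C H z := by
  ext A B
  simp only [pdM, Matrix.mul_apply, Matrix.of_apply, Matrix.add_apply]
  rw [pd_sum (u := fun i y => G y A i * H y i B) fun i _ => (hG _ _).mul (hH _ _),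
    ← Finset.sum_add_distrib]
  exact Finset.sum_congr rfl fun i _ => pd_mul (hG _ _) (hH _ _)

theorem pdM_congr {C : Fin d} {G H : Eu d → Matrix (Fin k) (Fin k) ℝ} {z : Eu d}
    (h : G =ᶠ[𝓝 z] H) : pdM C G z = pdM C H z := by
  ext A B
  exact pd_congr (h.mono fun y hy => by simp only [hy])

theorem pdM_inv {V : Set (Eu d)} (hV : IsOpen V) {C : Fin d}
    {G : Eu d → Matrix (Fin k) (Fin k) ℝ} (hG : SmoothMat V G)
    (hdet : ∀ y ∈ V, (G y).det ≠ 0) {z : Eu d} (hz : z ∈ V) :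
    pdM C (fun y => (G y)⁻¹) z = -((G z)⁻¹ * pdM C G z * (G z)⁻¹) := by
  have h1 : pdM C (fun y => (G y)⁻¹ * G y) z = 0 := by
    rw [pdM_congr (H := fun _ => 1)]
    · ext A B; simp [pdM]
    · filter_upwards [hV.mem_nhds hz] with y hy
      exact Matrix.nonsing_inv_mul _ (isUnit_iff_ne_zero.mpr (hdet y hy))
  rw [pdM_mul ((hG.inv hdet).differentiableAt hV hz) (hG.differentiableAt hV hz)] at h1
  have h2 := congrArg (· * (G z)⁻¹) (eq_neg_of_add_eq_zero_left h1)
  simp only [Matrix.mul_assoc, Matrix.neg_mul] at h2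
  rw [Matrix.mul_nonsing_inv _ (isUnit_iff_ne_zero.mpr (hdet z hz)), Matrix.mul_one] at h2
  simpa only [Matrix.mul_assoc] using h2

/-- Jacobi's formula along a line, from the expansion of `det (1 + r A⁻¹ B)` in powers of `r`. -/
theorem hasDerivAt_det_line (A B : Matrix (Fin k) (Fin k) ℝ) (hA : A.det ≠ 0) :
    HasDerivAt (fun r : ℝ => (A + r • B).det) (A.det * (A⁻¹ * B).trace) 0 := by
  have h : ∀ r : ℝ, (A + r • B).det = A.det * (1 + (A⁻¹ * B).trace * r +
      (Matrix.det (1 + (Polynomial.X : Polynomial ℝ) •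
        (A⁻¹ * B).map Polynomial.C)).divX.divX.eval r * r ^ 2) := by
    intro r
    rw [← Matrix.det_one_add_smul, ← Matrix.det_mul, Matrix.mul_add, Matrix.mul_smul,
      ← Matrix.mul_assoc, Matrix.mul_nonsing_inv _ (isUnit_iff_ne_zero.mpr hA)]
    simp
  simp only [h]
  set p := (Matrix.det (1 + (Polynomial.X : Polynomial ℝ) •
        (A⁻¹ * B).map Polynomial.C)).divX.divX
  have h1 : HasDerivAt (fun r : ℝ => p.eval r * r ^ 2)
      (p.derivative.eval 0 * 0 ^ 2 + p.eval 0 * ((2 : ℕ) * (0 : ℝ) ^ 1)) 0 :=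
    (p.hasDerivAt 0).mul (hasDerivAt_pow 2 0)
  have h2 : HasDerivAt (fun r : ℝ => 1 + (A⁻¹ * B).trace * r) ((A⁻¹ * B).trace * 1) 0 :=
    ((hasDerivAt_id (0 : ℝ)).const_mul _).const_add _
  convert! (h2.add h1).const_mul A.det using 1
  simp

/-- Jacobi's formula for the derivative of a determinant. -/
theorem pd_det {C : Fin d} {G : Eu d → Matrix (Fin k) (Fin k) ℝ} {z : Eu d}
    (hG : ∀ A B, DifferentiableAt ℝ (fun y => G y A B) z) (hdet : (G z).det ≠ 0) :
    pd C (fun y => (G y).det) z = (G z).det * ((G z)⁻¹ * pdM C G z).trace := by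
  let F : (Fin k → Fin k → ℝ) → ℝ := fun M => (Matrix.of M).det
  let g : Eu d → (Fin k → Fin k → ℝ) := fun y A B => G y A B
  have hF : Differentiable ℝ F := by
    have : F = fun M => ∑ σ : Equiv.Perm (Fin k),
        (Equiv.Perm.sign σ : ℝ) * ∏ i, M (σ i) i := by
      funext M; simp [F, Matrix.det_apply']
    rw [this]; fun_prop
  have hg : HasFDerivAt g (ContinuousLinearMap.pi fun A => ContinuousLinearMap.pi fun B =>
      fderiv ℝ (fun y => G y A B) z) z :=
    hasFDerivAt_pi.2 fun A => hasFDerivAt_pi.2 fun B => (hG A B).hasFDerivAt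
  have hc : (fun y => (G y).det) = F ∘ g := rfl
  rw [pd, hc, ((hF _).hasFDerivAt.comp z hg).fderiv]
  let B : Fin k → Fin k → ℝ := fun i j => pdM C G z i j
  have hl : HasDerivAt (fun r : ℝ => g z + r • B)
      B 0 := by
    have := ((hasDerivAt_id (0 : ℝ)).smul_const B).const_add (g z)
    simpa using this
  have hF0 : HasFDerivAt F (fderiv ℝ F (g z))
      (g z + (0 : ℝ) • B) := by
    simpa using (hF (g z)).hasFDerivAt
  have h1 := hF0.comp_hasDerivAt (0 : ℝ) hl
  exact h1.unique (hasDerivAt_det_line (G z) (pdM C G z) hdet)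

end MatrixCalculus

/-! ### The Laplacian in divergence form -/

section Divergence

variable {d : ℕ}

/-- The contravariant gradient `G^{CD} ∂_D u`. -/
def gradient (G : Eu d → Matrix (Fin d) (Fin d) ℝ) (u : Eu d → ℝ) (C : Fin d) (z : Eu d) : ℝ :=
  ∑ D, (G z)⁻¹ C D * pd D u z

theorem laplacian_congr {G : Eu d → Matrix (Fin d) (Fin d) ℝ} {u v : Eu d → ℝ} {z : Eu d}
    (h : u =ᶠ[𝓝 z] v) : laplacian G u z = laplacian G v z := by
  have h1 : ∀ A, pd A u =ᶠ[𝓝 z] pd A v := fun A =>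
    h.eventuallyEq_nhds.mono fun y hy => pd_congr hy
  simp only [laplacian, pd_congr (h1 _), (h1 _).eq_of_nhds]

/-- The Laplacian as a divergence, `-|det G|^{-1/2} ∂_C (|det G|^{1/2} G^{CD} ∂_D u)`.  By Jacobi's
formula, `1/2 tr (G⁻¹ ∂_C G)` is the logarithmic derivative of `|det G|^{1/2}`. -/
theorem laplacian_eq_divergence {V : Set (Eu d)} (hV : IsOpen V)
    {G : Eu d → Matrix (Fin d) (Fin d) ℝ} (hG : SmoothMat V G)
    (hdet : ∀ y ∈ V, (G y).det ≠ 0) (hsymm : ∀ y ∈ V, (G y).IsSymm)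
    {u : Eu d → ℝ} (hu : ContDiffOn ℝ ∞ u V) {z : Eu d} (hz : z ∈ V) :
    laplacian G u z = -(∑ C, pd C (gradient G u C) z +
      1 / 2 * ∑ C, gradient G u C z * ((G z)⁻¹ * pdM C G z).trace) := by
  have hinv := hG.inv hdet
  have hdivX : ∀ C, pd C (gradient G u C) z =
      ∑ D, (pdM C (fun y => (G y)⁻¹) z C D * pd D u z + (G z)⁻¹ C D * pd C (pd D u) z) := by
    intro C
    unfold gradient
    rw [pd_sum (u := fun D z => (G z)⁻¹ C D * pd D u z)]
    · refine Finset.sum_congr rfl fun D _ => ?_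
      rw [pd_mul (hinv.differentiableAt hV hz _ _)
        (differentiableAt_of_smooth hV (pd_contDiffOn hV _ hu) hz)]
      rfl
    · intro D _
      exact (hinv.differentiableAt hV hz _ _).mul
        (differentiableAt_of_smooth hV (pd_contDiffOn hV _ hu) hz)
  have hgs : ∀ A B, (G z)⁻¹ A B = (G z)⁻¹ B A := fun A B => by
    conv_lhs => rw [← (hsymm z hz).eq, ← Matrix.transpose_nonsing_inv, Matrix.transpose_apply]
  set g := (G z)⁻¹ with hg
  set X := fun C => gradient G u C z with hX
  have hXdef : ∀ C, X C = ∑ D, g C D * pd D u z := fun C => rfl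
  -- the contribution of the derivatives of the inverse metric
  have hinvterm : ∑ C, ∑ D, pdM C (fun y => (G y)⁻¹) z C D * pd D u z =
      -∑ A, ∑ B, ∑ D, X D * (g A B * pd A (fun y => G y B D) z) := by
    rw [← Finset.sum_neg_distrib]
    refine Finset.sum_congr rfl fun C _ => ?_
    rw [pdM_inv hV hG hdet hz]
    simp only [Matrix.neg_apply, Matrix.mul_apply, hXdef, neg_mul, Finset.sum_neg_distrib,
      Finset.sum_mul, ← hg, neg_inj, pdM, Matrix.of_apply]
    rw [Finset.sum_comm' (t' := Finset.univ) (s' := fun _ => Finset.univ) (by simp)]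
    rw [Finset.sum_congr rfl fun D _ => Finset.sum_comm]
    rw [Finset.sum_comm]
    refine Finset.sum_congr rfl fun B _ => Finset.sum_congr rfl fun D _ =>
      Finset.sum_congr rfl fun E _ => ?_
    ring
  -- the contribution of the Christoffel symbols
  have hchr : ∑ A, ∑ B, g A B * ∑ C, leviCivita G A B C z * pd C u z =
      ∑ A, ∑ B, ∑ D, X D * (g A B * pd A (fun y => G y B D) z) -
        1 / 2 * ∑ D, X D * (g * pdM D G z).trace := by
    have h1 : ∀ A B, ∑ C, leviCivita G A B C z * pd C u z = 1 / 2 * ∑ D, X D *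
        (pd A (fun y => G y B D) z + pd B (fun y => G y A D) z - pd D (fun y => G y A B) z) := by
      intro A B
      simp only [leviCivita, hXdef, Finset.mul_sum, Finset.sum_mul]
      rw [Finset.sum_comm]
      refine Finset.sum_congr rfl fun D _ => Finset.sum_congr rfl fun C _ => ?_
      rw [← hg, hgs C D]; ring
    have h2 : ∑ A, ∑ B, ∑ D, X D * (g A B * pd B (fun y => G y A D) z) =
        ∑ A, ∑ B, ∑ D, X D * (g A B * pd A (fun y => G y B D) z) := by
      rw [Finset.sum_comm]
      refine Finset.sum_congr rfl fun B _ => Finset.sum_congr rfl fun A _ =>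
        Finset.sum_congr rfl fun D _ => ?_
      rw [hgs]
    have h3 : ∑ D, X D * (g * pdM D G z).trace =
        ∑ A, ∑ B, ∑ D, X D * (g A B * pd D (fun y => G y A B) z) := by
      have : ∀ D, (g * pdM D G z).trace = ∑ A, ∑ B, g A B * pd D (fun y => G y A B) z := by
        intro D
        simp only [Matrix.trace, Matrix.diag, Matrix.mul_apply, pdM, Matrix.of_apply]
        rw [Finset.sum_comm]
        refine Finset.sum_congr rfl fun A _ => Finset.sum_congr rfl fun B _ => ?_
        rw [hgs]
      simp only [this, Finset.mul_sum]
      rw [Finset.sum_comm]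
      refine Finset.sum_congr rfl fun A _ => ?_
      rw [Finset.sum_comm]
    simp only [h1]
    rw [h3]
    have h4 : ∑ A, ∑ B, g A B * (1 / 2 * ∑ D, X D *
        (pd A (fun y => G y B D) z + pd B (fun y => G y A D) z - pd D (fun y => G y A B) z)) =
        1 / 2 * (∑ A, ∑ B, ∑ D, X D * (g A B * pd A (fun y => G y B D) z) +
          ∑ A, ∑ B, ∑ D, X D * (g A B * pd B (fun y => G y A D) z) -
          ∑ A, ∑ B, ∑ D, X D * (g A B * pd D (fun y => G y A B) z)) := by
      simp only [← Finset.sum_add_distrib, ← Finset.sum_sub_distrib, Finset.mul_sum]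
      refine Finset.sum_congr rfl fun A _ => Finset.sum_congr rfl fun B _ =>
        Finset.sum_congr rfl fun D _ => ?_
      ring
    rw [h4, h2]
    ring
  unfold laplacian
  simp only [mul_sub, Finset.sum_sub_distrib]
  rw [← hg, hchr]
  simp only [hdivX, Finset.sum_add_distrib]
  rw [hinvterm]
  ring

end Divergence

/-! ### Homogeneous functions on the ambient space -/

section Homogeneous

variable {n : ℕ}

/-- The metric `G_{AB} = s_A s_B T_{AB}(x)`, `s = (1, t, …, t)`, on the ambient space. -/
def coneMetric (T : Eu (n + 1) → Matrix (Fin (n + 2)) (Fin (n + 2)) ℝ) (z : Eu (n + 2)) :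
    Matrix (Fin (n + 2)) (Fin (n + 2)) ℝ :=
  Matrix.of fun A B =>
    (if A = 0 then 1 else z 0) * (if B = 0 then 1 else z 0) * T (basePt z) A B

/-- The function `t^w b(x)` on the ambient space. -/
def homog (w : ℝ) (b : Eu (n + 1) → ℝ) (z : Eu (n + 2)) : ℝ := z 0 ^ w * b (basePt z)

/-- The components `(w b, ∂_i b)` at `t = 1` of the differential of `t^w b(x)`. -/
def jet (w : ℝ) (b : Eu (n + 1) → ℝ) (x : Eu (n + 1)) : Fin (n + 2) → ℝ :=
  Fin.cons (w * b x) fun i => pd i b x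

/-- The components at `t = 1` of the gradient of `t^w b(x)` for the metric `coneMetric T`. -/
def coneGrad (T : Eu (n + 1) → Matrix (Fin (n + 2)) (Fin (n + 2)) ℝ) (w : ℝ)
    (b : Eu (n + 1) → ℝ) (C : Fin (n + 2)) (x : Eu (n + 1)) : ℝ :=
  ∑ D, (T x)⁻¹ C D * jet w b x D

/-- The Laplacian of the metric `coneMetric T` on functions of degree `w`, as an operator on the
base: `Δ (t^w b) = t^{w-2} (coneLap T w b)`. -/
def coneLap (T : Eu (n + 1) → Matrix (Fin (n + 2)) (Fin (n + 2)) ℝ) (w : ℝ)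
    (b : Eu (n + 1) → ℝ) (x : Eu (n + 1)) : ℝ :=
  -((w + n) * coneGrad T w b 0 x + ∑ i : Fin (n + 1), pd i (coneGrad T w b i.succ) x +
    1 / 2 * ∑ i : Fin (n + 1), coneGrad T w b i.succ x * ((T x)⁻¹ * pdM i T x).trace)

/-- The part of the ambient space over `V`. -/
def coneOver (V : Set (Eu (n + 1))) : Set (Eu (n + 2)) := {z | 0 < z 0 ∧ basePt z ∈ V}

theorem contDiff_coord {d : ℕ} (A : Fin d) : ContDiff ℝ ∞ fun y : Eu d => y A :=
  (EuclideanSpace.proj A : Eu d →L[ℝ] ℝ).contDiff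

theorem contDiff_basePt : ContDiff ℝ ∞ (basePt : Eu (n + 2) → Eu (n + 1)) := by
  rw [contDiff_euclidean]
  intro i
  exact contDiff_coord i.succ

theorem isOpen_coneOver {V : Set (Eu (n + 1))} (hV : IsOpen V) : IsOpen (coneOver V) :=
  (isOpen_lt continuous_const (contDiff_coord (0 : Fin (n + 2))).continuous).inter
    (hV.preimage contDiff_basePt.continuous)

theorem homog_contDiffOn {V : Set (Eu (n + 1))} {b : Eu (n + 1) → ℝ} (hb : ContDiffOn ℝ ∞ b V)
    (w : ℝ) : ContDiffOn ℝ ∞ (homog w b) (coneOver V) := by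
  refine ContDiffOn.mul ?_ (hb.comp contDiff_basePt.contDiffOn fun z hz => hz.2)
  intro z hz
  exact ((contDiff_coord (0 : Fin (n + 2))).contDiffAt.rpow_const_of_ne
    hz.1.ne').contDiffWithinAt

theorem pd_basePt (A : Fin (n + 2)) {b : Eu (n + 1) → ℝ} {z : Eu (n + 2)}
    (hb : DifferentiableAt ℝ b (basePt z)) :
    pd A (fun y => b (basePt y)) z =
      (Fin.cases 0 (fun i => pd i b (basePt z)) A : ℝ) := by
  rw [pd_comp (Φ := basePt) A hb (contDiff_basePt.differentiable (by simp)).differentiableAt]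
  have : ∀ a : Fin (n + 1), pd A (fun y : Eu (n + 2) => basePt y a) z =
      if a.succ = A then 1 else 0 := fun a => pd_coord A a.succ z
  simp only [this]
  refine Fin.cases ?_ (fun i => ?_) A
  · simp [Fin.succ_ne_zero]
  · simp

theorem differentiableAt_rpow_coord (w : ℝ) {z : Eu (n + 2)} (hz : 0 < z 0) :
    DifferentiableAt ℝ (fun y : Eu (n + 2) => y 0 ^ w) z :=
  DifferentiableAt.rpow_const (by fun_prop) (Or.inl hz.ne')

theorem pd_rpow_coord (A : Fin (n + 2)) (w : ℝ) {z : Eu (n + 2)} (hz : 0 < z 0) :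
    pd A (fun y : Eu (n + 2) => y 0 ^ w) z = if A = 0 then w * z 0 ^ (w - 1) else 0 := by
  have h : HasFDerivAt (fun y : Eu (n + 2) => y 0)
      (EuclideanSpace.proj 0 : Eu (n + 2) →L[ℝ] ℝ) z :=
    (EuclideanSpace.proj 0 : Eu (n + 2) →L[ℝ] ℝ).hasFDerivAt
  rw [pd, (h.rpow_const (p := w) (Or.inl hz.ne')).fderiv]
  by_cases hA : A = 0
  · subst hA; simp
  · simp [hA, Ne.symm hA]

theorem pd_zero_homog (w : ℝ) {b : Eu (n + 1) → ℝ} {z : Eu (n + 2)} (hz : 0 < z 0)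
    (hb : DifferentiableAt ℝ b (basePt z)) :
    pd 0 (homog w b) z = w * z 0 ^ (w - 1) * b (basePt z) := by
  unfold homog
  rw [pd_mul (v := fun y => b (basePt y)) (differentiableAt_rpow_coord w hz)
    (hb.comp z (contDiff_basePt.differentiable (by simp)).differentiableAt), pd_basePt _ hb,
    pd_rpow_coord _ _ hz]
  simp

theorem pd_succ_homog (w : ℝ) {b : Eu (n + 1) → ℝ} {z : Eu (n + 2)} (hz : 0 < z 0)
    (hb : DifferentiableAt ℝ b (basePt z)) (i : Fin (n + 1)) :
    pd i.succ (homog w b) z = z 0 ^ w * pd i b (basePt z) := by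
  unfold homog
  rw [pd_mul (v := fun y => b (basePt y)) (differentiableAt_rpow_coord w hz)
    (hb.comp z (contDiff_basePt.differentiable (by simp)).differentiableAt), pd_basePt _ hb,
    pd_rpow_coord _ _ hz]
  simp [Fin.succ_ne_zero]

variable {T : Eu (n + 1) → Matrix (Fin (n + 2)) (Fin (n + 2)) ℝ}

theorem coneMetric_eq (z : Eu (n + 2)) : coneMetric T z =
    Matrix.diagonal (fun A : Fin (n + 2) => if A = 0 then 1 else z 0) * T (basePt z) *
      Matrix.diagonal (fun A : Fin (n + 2) => if A = 0 then 1 else z 0) := by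
  ext A B
  simp only [coneMetric, Matrix.of_apply, Matrix.diagonal_mul, Matrix.mul_diagonal]
  ring

theorem coneMetric_inv {z : Eu (n + 2)} (hz : 0 < z 0) (A B : Fin (n + 2)) :
    (coneMetric T z)⁻¹ A B = (if A = 0 then 1 else (z 0)⁻¹) * (if B = 0 then 1 else (z 0)⁻¹) *
      (T (basePt z))⁻¹ A B := by
  have hd : (Matrix.diagonal (fun A : Fin (n + 2) => if A = 0 then (1 : ℝ) else z 0))⁻¹ =
      Matrix.diagonal (fun A : Fin (n + 2) => if A = 0 then (1 : ℝ) else (z 0)⁻¹) := by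
    apply Matrix.inv_eq_left_inv
    rw [Matrix.diagonal_mul_diagonal, ← Matrix.diagonal_one]
    congr 1; funext A
    split_ifs <;> simp [hz.ne']
  rw [coneMetric_eq, Matrix.mul_inv_rev, Matrix.mul_inv_rev, hd]
  simp only [Matrix.diagonal_mul, Matrix.mul_diagonal, ]
  ring

theorem coneMetric_det_ne_zero {z : Eu (n + 2)} (hz : 0 < z 0) (hT : (T (basePt z)).det ≠ 0) :
    (coneMetric T z).det ≠ 0 := by
  rw [coneMetric_eq, Matrix.det_mul, Matrix.det_mul, Matrix.det_diagonal]
  have : ∏ A : Fin (n + 2), (if A = 0 then (1 : ℝ) else z 0) ≠ 0 :=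
    Finset.prod_ne_zero_iff.2 fun A _ => by split_ifs <;> simp [hz.ne']
  exact mul_ne_zero (mul_ne_zero this hT) this

theorem coneMetric_isSymm {z : Eu (n + 2)} (hT : (T (basePt z)).IsSymm) :
    (coneMetric T z).IsSymm := by
  ext A B
  simp only [Matrix.transpose_apply, coneMetric, Matrix.of_apply]
  rw [hT.apply]; ring

theorem coneMetric_smooth {V : Set (Eu (n + 1))} (hT : SmoothMat V T) :
    SmoothMat (coneOver V) (coneMetric T) := by
  intro A B
  simp only [coneMetric, Matrix.of_apply]
  refine ContDiffOn.mul (ContDiffOn.mul ?_ ?_)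
    ((hT A B).comp contDiff_basePt.contDiffOn fun z hz => hz.2)
  · split_ifs
    · exact contDiffOn_const
    · exact (contDiff_coord (0 : Fin (n + 2))).contDiffOn
  · split_ifs
    · exact contDiffOn_const
    · exact (contDiff_coord (0 : Fin (n + 2))).contDiffOn

theorem gradient_coneMetric {w : ℝ} {b : Eu (n + 1) → ℝ} {z : Eu (n + 2)} (hz : 0 < z 0)
    (hb : DifferentiableAt ℝ b (basePt z)) (C : Fin (n + 2)) :
    gradient (coneMetric T) (homog w b) C z =
      homog (if C = 0 then w - 1 else w - 2) (coneGrad T w b C) z := by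
  unfold gradient homog coneGrad
  rw [Finset.mul_sum]
  refine Finset.sum_congr rfl fun D _ => ?_
  rw [coneMetric_inv hz]
  have hD : pd D (homog w b) z =
      (if D = 0 then 1 else z 0) * z 0 ^ (w - 1) * jet w b (basePt z) D := by
    refine Fin.cases ?_ (fun i => ?_) D
    · rw [pd_zero_homog w hz hb]; simp [jet]; ring
    · rw [pd_succ_homog w hz hb]
      have : z 0 ^ w = z 0 * z 0 ^ (w - 1) := by
        rw [Real.rpow_sub_one hz.ne']; field_simp
      simp [jet, Fin.succ_ne_zero, this]
  have h2 : z 0 ^ (w - 2) = z 0 ^ (w - 1) * (z 0)⁻¹ := by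
    rw [show w - 2 = w - 1 - 1 by ring, Real.rpow_sub_one hz.ne' (w - 1), div_eq_mul_inv]
  change _ * pd D (homog w b) z = _
  rw [hD]
  have hz' := hz.ne'
  split_ifs <;> simp only [h2] <;> field_simp

theorem trace_pdM_zero_coneMetric {V : Set (Eu (n + 1))} (hV : IsOpen V) (hT : SmoothMat V T)
    (hdet : ∀ x ∈ V, (T x).det ≠ 0) {z : Eu (n + 2)} (hz : z ∈ coneOver V) :
    ((coneMetric T z)⁻¹ * pdM 0 (coneMetric T) z).trace = 2 * (n + 1) * (z 0)⁻¹ := by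
  have hpd : ∀ A B, pdM 0 (coneMetric T) z A B =
      ((if A = 0 then 0 else 1) + (if B = 0 then 0 else 1)) * (z 0)⁻¹ * coneMetric T z A B := by
    intro A B
    have hz1 := hz.1.ne'
    have hTd : DifferentiableAt ℝ (fun y => T (basePt y) A B) z :=
      (hT.differentiableAt hV hz.2 A B).comp z
        (contDiff_basePt.differentiable (by simp)).differentiableAt
    have hT0 : pd 0 (fun y => T (basePt y) A B) z = 0 :=
      pd_basePt (b := fun x => T x A B) 0 (hT.differentiableAt hV hz.2 A B)
    have hc : DifferentiableAt ℝ (fun y : Eu (n + 2) => y 0) z := by fun_prop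
    have hc0 : pd 0 (fun y : Eu (n + 2) => y 0) z = 1 := by rw [pd_coord]; simp
    simp only [pdM, Matrix.of_apply, coneMetric]
    by_cases hA : A = 0 <;> by_cases hB : B = 0 <;>
      simp only [hA, hB, if_true, if_false] at hTd hT0 ⊢
    · rw [pd_mul (by fun_prop) hTd, hT0]; simp
    · rw [pd_mul (by fun_prop) hTd, hT0, pd_mul (by fun_prop) hc, hc0]; simp; field_simp
    · rw [pd_mul (by fun_prop) hTd, hT0, pd_mul hc (by fun_prop), hc0]; simp; field_simp
    · rw [pd_mul (by fun_prop) hTd, hT0, pd_mul hc hc, hc0]; simp; field_simp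
  have hu : IsUnit (coneMetric T z).det :=
    isUnit_iff_ne_zero.2 (coneMetric_det_ne_zero hz.1 (hdet _ hz.2))
  set G := coneMetric T z
  let E : Matrix (Fin (n + 2)) (Fin (n + 2)) ℝ :=
    Matrix.diagonal fun A => if A = 0 then 0 else 1
  have hM : pdM 0 (coneMetric T) z = (z 0)⁻¹ • (E * G + G * E) := by
    ext A B
    rw [hpd]
    simp only [E, Matrix.smul_apply, Matrix.add_apply, Matrix.diagonal_mul, Matrix.mul_diagonal,
      smul_eq_mul]
    ring
  rw [hM, Matrix.mul_smul, Matrix.trace_smul, Matrix.mul_add, Matrix.trace_add,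
    Matrix.trace_mul_comm, Matrix.mul_assoc, Matrix.mul_nonsing_inv _ hu, ← Matrix.mul_assoc,
    Matrix.nonsing_inv_mul _ hu, Matrix.mul_one, Matrix.one_mul, Matrix.trace_diagonal]
  rw [Fin.sum_univ_succ]
  simp [Fin.succ_ne_zero]
  ring

theorem trace_pdM_succ_coneMetric {V : Set (Eu (n + 1))} (hV : IsOpen V) (hT : SmoothMat V T)
    {z : Eu (n + 2)} (hz : z ∈ coneOver V) (i : Fin (n + 1)) :
    ((coneMetric T z)⁻¹ * pdM i.succ (coneMetric T) z).trace =
      ((T (basePt z))⁻¹ * pdM i T (basePt z)).trace := by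
  have hpd : ∀ A B, pdM i.succ (coneMetric T) z A B =
      (if A = 0 then 1 else z 0) * (if B = 0 then 1 else z 0) * pdM i T (basePt z) A B := by
    intro A B
    have hz1 := hz.1.ne'
    have hTd : DifferentiableAt ℝ (fun y => T (basePt y) A B) z :=
      (hT.differentiableAt hV hz.2 A B).comp z
        (contDiff_basePt.differentiable (by simp)).differentiableAt
    have hT0 : pd i.succ (fun y => T (basePt y) A B) z = pd i (fun x => T x A B) (basePt z) :=
      pd_basePt (b := fun x => T x A B) i.succ (hT.differentiableAt hV hz.2 A B)
    have hc : DifferentiableAt ℝ (fun y : Eu (n + 2) => y 0) z := by fun_prop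
    have hc0 : pd i.succ (fun y : Eu (n + 2) => y 0) z = 0 := by
      rw [pd_coord]; simp [Ne.symm (Fin.succ_ne_zero i)]
    simp only [pdM, Matrix.of_apply, coneMetric]
    by_cases hA : A = 0 <;> by_cases hB : B = 0 <;>
      simp only [hA, hB, if_true, if_false] at hTd hT0 ⊢
    · rw [pd_mul (by fun_prop) hTd, hT0]; simp
    · rw [pd_mul (by fun_prop) hTd, hT0, pd_mul (by fun_prop) hc, hc0]; simp
    · rw [pd_mul (by fun_prop) hTd, hT0, pd_mul hc (by fun_prop), hc0]; simp
    · rw [pd_mul (by fun_prop) hTd, hT0, pd_mul hc hc, hc0]; simp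
  have hz1 := hz.1.ne'
  simp only [Matrix.trace, Matrix.diag, Matrix.mul_apply]
  refine Finset.sum_congr rfl fun A _ => Finset.sum_congr rfl fun B _ => ?_
  rw [hpd, coneMetric_inv hz.1]
  split_ifs <;> field_simp

theorem jet_contDiffOn {V : Set (Eu (n + 1))} (hV : IsOpen V) (w : ℝ) {b : Eu (n + 1) → ℝ}
    (hb : ContDiffOn ℝ ∞ b V) (D : Fin (n + 2)) : ContDiffOn ℝ ∞ (fun x => jet w b x D) V := by
  refine Fin.cases ?_ (fun i => ?_) D
  · exact contDiffOn_const.mul hb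
  · exact pd_contDiffOn hV i hb

/-- `T` is a smooth field of nondegenerate symmetric matrices on `V`. -/
structure IsMetricOn (V : Set (Eu (n + 1)))
    (T : Eu (n + 1) → Matrix (Fin (n + 2)) (Fin (n + 2)) ℝ) : Prop where
  isOpen : IsOpen V
  smooth : SmoothMat V T
  det_ne_zero : ∀ x ∈ V, (T x).det ≠ 0
  isSymm : ∀ x ∈ V, (T x).IsSymm

variable {V : Set (Eu (n + 1))}

theorem IsMetricOn.mono (hT : IsMetricOn V T) {W : Set (Eu (n + 1))} (hW : IsOpen W)
    (hWV : W ⊆ V) : IsMetricOn W T :=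
  ⟨hW, fun A B => (hT.smooth A B).mono hWV, fun x hx => hT.det_ne_zero x (hWV hx),
    fun x hx => hT.isSymm x (hWV hx)⟩

theorem coneGrad_contDiffOn (hT : IsMetricOn V T) (w : ℝ) {b : Eu (n + 1) → ℝ}
    (hb : ContDiffOn ℝ ∞ b V) (C : Fin (n + 2)) : ContDiffOn ℝ ∞ (coneGrad T w b C) V :=
  ContDiffOn.sum fun D _ =>
    ((hT.smooth.inv hT.det_ne_zero) C D).mul (jet_contDiffOn hT.isOpen w hb D)

theorem trace_contDiffOn (hT : IsMetricOn V T) (i : Fin (n + 1)) :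
    ContDiffOn ℝ ∞ (fun x => ((T x)⁻¹ * pdM i T x).trace) V := by
  simp only [Matrix.trace, Matrix.diag, Matrix.mul_apply]
  exact ContDiffOn.sum fun A _ => ContDiffOn.sum fun B _ =>
    ((hT.smooth.inv hT.det_ne_zero) A B).mul (pd_contDiffOn hT.isOpen i (hT.smooth B A))

theorem coneLap_contDiffOn (hT : IsMetricOn V T) (w : ℝ) {b : Eu (n + 1) → ℝ}
    (hb : ContDiffOn ℝ ∞ b V) : ContDiffOn ℝ ∞ (coneLap T w b) V := by
  have h := coneGrad_contDiffOn hT w hb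
  refine (((contDiffOn_const.mul (h 0)).add (ContDiffOn.sum fun i _ =>
    pd_contDiffOn hT.isOpen i (h i.succ))).add (contDiffOn_const.mul
      (ContDiffOn.sum fun i _ => (h i.succ).mul (trace_contDiffOn hT i)))).neg

/-- The Laplacian on functions of degree `w`.  The weight `w + n` in `coneLap` comes from the
radial part of the divergence: `∂_t t^{w-1}` gives `w - 1` and the volume density `t^{n+1}`
gives `n + 1`. -/
theorem laplacian_homog (hT : IsMetricOn V T) (w : ℝ) {b : Eu (n + 1) → ℝ}
    (hb : ContDiffOn ℝ ∞ b V) {z : Eu (n + 2)} (hz : z ∈ coneOver V) :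
    laplacian (coneMetric T) (homog w b) z = homog (w - 2) (coneLap T w b) z := by
  have hV := hT.isOpen
  have hO := isOpen_coneOver hV
  rw [laplacian_eq_divergence hO (coneMetric_smooth hT.smooth)
    (fun y hy => coneMetric_det_ne_zero hy.1 (hT.det_ne_zero _ hy.2))
    (fun y hy => coneMetric_isSymm (hT.isSymm _ hy.2)) (homog_contDiffOn hb w) hz]
  have hgrad : ∀ C, gradient (coneMetric T) (homog w b) C =ᶠ[𝓝 z]
      homog (if C = 0 then w - 1 else w - 2) (coneGrad T w b C) := by
    intro C
    filter_upwards [hO.mem_nhds hz] with y hy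
    exact gradient_coneMetric hy.1 (differentiableAt_of_smooth hV hb hy.2) C
  have hg : ∀ C, DifferentiableAt ℝ (coneGrad T w b C) (basePt z) := fun C =>
    differentiableAt_of_smooth hV (coneGrad_contDiffOn hT w hb C) hz.2
  simp only [fun C => pd_congr (A := C) (hgrad C), fun C => (hgrad C).eq_of_nhds]
  rw [Fin.sum_univ_succ, Fin.sum_univ_succ (n := n + 1)]
  simp only [if_true, Fin.succ_ne_zero, if_false, pd_zero_homog _ hz.1 (hg _),
    pd_succ_homog _ hz.1 (hg _), trace_pdM_zero_coneMetric hV hT.smooth hT.det_ne_zero hz,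
    trace_pdM_succ_coneMetric hV hT.smooth hz]
  have h2 : z 0 ^ (w - 1) = z 0 ^ (w - 2) * z 0 := by
    rw [show w - 2 = w - 1 - 1 by ring, Real.rpow_sub_one hz.1.ne' (w - 1)]
    have := hz.1.ne'
    field_simp
  have h3 : z 0 ^ (w - 1 - 1) = z 0 ^ (w - 2) := by congr 1; ring
  have hz1 := hz.1.ne'
  simp only [homog, coneLap, h2, h3, mul_add, mul_neg, ← Finset.mul_sum, mul_assoc]
  field_simp
  ring

end Homogeneous

/-! ### Powers of the Laplacian and changes of coordinates -/

section Powers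

variable {n : ℕ} {T : Eu (n + 1) → Matrix (Fin (n + 2)) (Fin (n + 2)) ℝ} {V : Set (Eu (n + 1))}

/-- The power `Δ^m` on functions of degree `w`, as an operator on the base. -/
def lapPow (T : Eu (n + 1) → Matrix (Fin (n + 2)) (Fin (n + 2)) ℝ) :
    ℕ → ℝ → (Eu (n + 1) → ℝ) → Eu (n + 1) → ℝ
  | 0, _, b => b
  | m + 1, w, b => coneLap T (w - 2 * m) (lapPow T m w b)

theorem lapPow_contDiffOn (hT : IsMetricOn V T) (m : ℕ) (w : ℝ) {b : Eu (n + 1) → ℝ}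
    (hb : ContDiffOn ℝ ∞ b V) : ContDiffOn ℝ ∞ (lapPow T m w b) V := by
  induction m with
  | zero => exact hb
  | succ m ih => exact coneLap_contDiffOn hT _ ih

theorem iterate_laplacian_homog (hT : IsMetricOn V T) (m : ℕ) (w : ℝ) {b : Eu (n + 1) → ℝ}
    (hb : ContDiffOn ℝ ∞ b V) : ∀ z ∈ coneOver V,
      (laplacian (coneMetric T))^[m] (homog w b) z = homog (w - 2 * m) (lapPow T m w b) z := by
  induction m with
  | zero => intro z _; simp [lapPow]
  | succ m ih =>
    intro z hz
    rw [Function.iterate_succ_apply', laplacian_congr (v := homog (w - 2 * m) (lapPow T m w b)),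
      laplacian_homog hT _ (lapPow_contDiffOn hT m w hb) hz]
    · simp only [homog, lapPow]
      congr 2
      push_cast; ring
    · filter_upwards [(isOpen_coneOver hT.isOpen).mem_nhds hz] with y hy using ih y hy

theorem jet_congr (hV : IsOpen V) {w : ℝ} {b b' : Eu (n + 1) → ℝ} (h : Set.EqOn b b' V)
    {x : Eu (n + 1)} (hx : x ∈ V) : jet w b x = jet w b' x := by
  funext D
  refine Fin.cases ?_ (fun i => ?_) D
  · simp [jet, h hx]
  · simp [jet, pd_congr_of_eqOn hV h hx]

theorem coneLap_congr (hV : IsOpen V) {w : ℝ} {b b' : Eu (n + 1) → ℝ} (h : Set.EqOn b b' V) :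
    Set.EqOn (coneLap T w b) (coneLap T w b') V := by
  have hg : ∀ C, Set.EqOn (coneGrad T w b C) (coneGrad T w b' C) V := fun C x hx => by
    simp only [coneGrad, jet_congr hV h hx]
  intro x hx
  simp only [coneLap, hg _ hx, pd_congr_of_eqOn hV (hg _) hx]

theorem lapPow_congr (hV : IsOpen V) {w : ℝ} {b b' : Eu (n + 1) → ℝ} (m : ℕ)
    (h : Set.EqOn b b' V) : Set.EqOn (lapPow T m w b) (lapPow T m w b') V := by
  induction m with
  | zero => exact h
  | succ m ih => exact coneLap_congr hV ih

theorem jet_add (hV : IsOpen V) {w : ℝ} {a b : Eu (n + 1) → ℝ} (ha : ContDiffOn ℝ ∞ a V)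
    (hb : ContDiffOn ℝ ∞ b V) {x : Eu (n + 1)} (hx : x ∈ V) (D : Fin (n + 2)) :
    jet w (fun y => a y + b y) x D = jet w a x D + jet w b x D := by
  refine Fin.cases ?_ (fun i => ?_) D
  · simp [jet, mul_add]
  · simp [jet, pd_add (differentiableAt_of_smooth hV ha hx) (differentiableAt_of_smooth hV hb hx)]

theorem coneGrad_add (hV : IsOpen V) {w : ℝ} {a b : Eu (n + 1) → ℝ}
    (ha : ContDiffOn ℝ ∞ a V) (hb : ContDiffOn ℝ ∞ b V) (C : Fin (n + 2)) :
    Set.EqOn (coneGrad T w (fun y => a y + b y) C)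
      (fun x => coneGrad T w a C x + coneGrad T w b C x) V := by
  intro x hx
  simp only [coneGrad, jet_add hV ha hb hx, mul_add, Finset.sum_add_distrib]

theorem coneLap_add (hT : IsMetricOn V T) {w : ℝ} {a b : Eu (n + 1) → ℝ}
    (ha : ContDiffOn ℝ ∞ a V) (hb : ContDiffOn ℝ ∞ b V) :
    Set.EqOn (coneLap T w (fun y => a y + b y)) (fun x => coneLap T w a x + coneLap T w b x) V := by
  intro x hx
  have hV := hT.isOpen
  have hg := coneGrad_add (T := T) (w := w) hV ha hb
  simp only [coneLap, hg _ hx, pd_congr_of_eqOn hV (hg _) hx]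
  simp only [pd_add (differentiableAt_of_smooth hV (coneGrad_contDiffOn hT w ha _) hx)
    (differentiableAt_of_smooth hV (coneGrad_contDiffOn hT w hb _) hx), add_mul,
    Finset.sum_add_distrib]
  ring

theorem coneLap_const_mul (hT : IsMetricOn V T) {w : ℝ} (c : ℝ) {b : Eu (n + 1) → ℝ}
    (hb : ContDiffOn ℝ ∞ b V) :
    Set.EqOn (coneLap T w (fun y => c * b y)) (fun x => c * coneLap T w b x) V := by
  have hV := hT.isOpen
  have hj : ∀ x ∈ V, ∀ D, jet w (fun y => c * b y) x D = c * jet w b x D := by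
    intro x hx D
    refine Fin.cases ?_ (fun i => ?_) D
    · simp [jet]; ring
    · simp [jet, pd_const_mul c (differentiableAt_of_smooth hV hb hx)]
  have hg : ∀ C, Set.EqOn (coneGrad T w (fun y => c * b y) C)
      (fun x => c * coneGrad T w b C x) V := by
    intro C x hx
    simp only [coneGrad, hj x hx, Finset.mul_sum]
    exact Finset.sum_congr rfl fun D _ => by ring
  intro x hx
  simp only [coneLap, hg _ hx, pd_congr_of_eqOn hV (hg _) hx]
  simp only [pd_const_mul c (differentiableAt_of_smooth hV (coneGrad_contDiffOn hT w hb _) hx),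
    mul_assoc, ← Finset.mul_sum]
  ring

theorem lapPow_add (hT : IsMetricOn V T) {w : ℝ} {a b : Eu (n + 1) → ℝ} (m : ℕ)
    (ha : ContDiffOn ℝ ∞ a V) (hb : ContDiffOn ℝ ∞ b V) :
    Set.EqOn (lapPow T m w (fun y => a y + b y))
      (fun x => lapPow T m w a x + lapPow T m w b x) V := by
  induction m with
  | zero => exact fun x _ => rfl
  | succ m ih =>
    exact (coneLap_congr hT.isOpen ih).trans
      (coneLap_add hT (lapPow_contDiffOn hT m w ha) (lapPow_contDiffOn hT m w hb))

theorem lapPow_eq_zero (hT : IsMetricOn V T) {w : ℝ} (m : ℕ) {b : Eu (n + 1) → ℝ}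
    (hb : ContDiffOn ℝ ∞ b V) (h0 : ∀ x ∈ V, b x = 0) : ∀ x ∈ V, lapPow T m w b x = 0 := by
  induction m with
  | zero => exact h0
  | succ m ih =>
    intro x hx
    have e : lapPow T (m + 1) w b x = coneLap T (w - 2 * m) (lapPow T m w b) x := rfl
    rw [e, coneLap_congr (b' := fun y => 0 * lapPow T m w b y) hT.isOpen
      (fun y hy => by simp [ih y hy]) hx, coneLap_const_mul hT 0 (lapPow_contDiffOn hT m w hb) hx]
    simp

end Powers

section CoordinateChange

variable {n : ℕ}

/-- The Jacobian matrix `K^a_i = ∂_i Φ^a`. -/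
def jac {d d' : ℕ} (Φ : Eu d → Eu d') (x : Eu d) : Matrix (Fin d') (Fin d) ℝ :=
  Matrix.of fun a i => pd i (fun y => Φ y a) x

/-- The block matrix `diag(1, K)`. -/
def hat {k : ℕ} (K : Matrix (Fin k) (Fin k) ℝ) : Matrix (Fin (k + 1)) (Fin (k + 1)) ℝ :=
  Matrix.of fun A B => Fin.cases (Fin.cases 1 (fun _ => 0) B) (fun a => Fin.cases 0 (K a) B) A

section Hat
variable {k : ℕ} (K : Matrix (Fin k) (Fin k) ℝ)
@[simp] theorem hat_zero_zero : hat K 0 0 = 1 := rfl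
@[simp] theorem hat_zero_succ (i : Fin k) : hat K 0 i.succ = 0 := rfl
@[simp] theorem hat_succ_zero (i : Fin k) : hat K i.succ 0 = 0 := rfl
@[simp] theorem hat_succ_succ (a i : Fin k) : hat K a.succ i.succ = K a i := rfl

theorem det_hat : (hat K).det = K.det := by
  rw [Matrix.det_succ_row_zero, Fin.sum_univ_succ]
  simp
  rfl

end Hat

theorem jac_contDiffOn {d d' : ℕ} {V : Set (Eu d)} (hV : IsOpen V) {Φ : Eu d → Eu d'}
    (hΦ : ContDiffOn ℝ ∞ Φ V) (a : Fin d') (i : Fin d) :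
    ContDiffOn ℝ ∞ (fun x => jac Φ x a i) V :=
  pd_contDiffOn hV i ((contDiff_coord a).comp_contDiffOn hΦ)

theorem jac_symm {d d' : ℕ} {V : Set (Eu d)} (hV : IsOpen V) {Φ : Eu d → Eu d'}
    (hΦ : ContDiffOn ℝ ∞ Φ V) {x : Eu d} (hx : x ∈ V) (a : Fin d') (i j : Fin d) :
    pd j (fun y => jac Φ y a i) x = pd i (fun y => jac Φ y a j) x :=
  pd_comm hV ((contDiff_coord a).comp_contDiffOn hΦ) hx

theorem pd_comp_jac {d d' : ℕ} {V : Set (Eu d)} (hV : IsOpen V) {V' : Set (Eu d')}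
    (hV' : IsOpen V') {Φ : Eu d → Eu d'}
    (hΦ : ContDiffOn ℝ ∞ Φ V) (hmap : Set.MapsTo Φ V V') {b : Eu d' → ℝ}
    (hb : ContDiffOn ℝ ∞ b V') {x : Eu d} (hx : x ∈ V) (i : Fin d) :
    pd i (fun y => b (Φ y)) x = ∑ a, jac Φ x a i * pd a b (Φ x) :=
  pd_comp i (differentiableAt_of_smooth hV' hb (hmap hx))
    ((hΦ.contDiffAt (hV.mem_nhds hx)).differentiableAt (by simp))

variable {T T' : Eu (n + 1) → Matrix (Fin (n + 2)) (Fin (n + 2)) ℝ} {V V' : Set (Eu (n + 1))}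

/-- The Laplacian does not depend on the coordinates of the base.  As `hat (jac Φ)` is the Jacobian
matrix of `(t, x) ↦ (t, Φ x)` at `t = 1`, the hypothesis says that the metrics correspond. -/
theorem coneLap_comp (hT : IsMetricOn V T) (hT' : IsMetricOn V' T')
    {Φ : Eu (n + 1) → Eu (n + 1)} (hΦ : ContDiffOn ℝ ∞ Φ V) (hmap : Set.MapsTo Φ V V')
    (htrans : ∀ x ∈ V, T x = (hat (jac Φ x)).transpose * T' (Φ x) * hat (jac Φ x)) (w : ℝ)
    {b : Eu (n + 1) → ℝ} (hb : ContDiffOn ℝ ∞ b V') :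
    Set.EqOn (coneLap T w (fun y => b (Φ y))) (fun x => coneLap T' w b (Φ x)) V := by
  have hV := hT.isOpen
  have hV' := hT'.isOpen
  have hbΦ : ContDiffOn ℝ ∞ (fun y => b (Φ y)) V := hb.comp hΦ hmap
  have hdet : ∀ x ∈ V, (T x).det = (jac Φ x).det ^ 2 * (T' (Φ x)).det := by
    intro x hx
    rw [htrans x hx, Matrix.det_mul, Matrix.det_mul, Matrix.det_transpose, det_hat]; ring
  have hK : ∀ x ∈ V, (jac Φ x).det ≠ 0 := by
    intro x hx h0
    exact hT.det_ne_zero x hx (by rw [hdet x hx, h0]; ring)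
  -- the gradient is transformed as a vector
  have hgrad : ∀ x ∈ V, ∀ A, ∑ B, hat (jac Φ x) A B * coneGrad T w (fun y => b (Φ y)) B x =
      coneGrad T' w b A (Φ x) := by
    intro x hx A
    have hj : jet w (fun y => b (Φ y)) x =
        (hat (jac Φ x)).transpose.mulVec (jet w b (Φ x)) := by
      funext D
      simp only [Matrix.mulVec, dotProduct, Matrix.transpose_apply]
      rw [Fin.sum_univ_succ]
      refine Fin.cases ?_ (fun i => ?_) D
      · simp [jet]
      · simp [jet, pd_comp_jac hV hV' hΦ hmap hb hx]
    have hu : IsUnit (hat (jac Φ x)).det := by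
      rw [det_hat]; exact isUnit_iff_ne_zero.2 (hK x hx)
    have hvec : (fun B => coneGrad T w (fun y => b (Φ y)) B x) =
        (T x)⁻¹.mulVec (jet w (fun y => b (Φ y)) x) := rfl
    have : (hat (jac Φ x)).mulVec (fun B => coneGrad T w (fun y => b (Φ y)) B x) =
        (T' (Φ x))⁻¹.mulVec (jet w b (Φ x)) := by
      rw [hvec, hj, htrans x hx, Matrix.mul_inv_rev, Matrix.mul_inv_rev, Matrix.mulVec_mulVec,
        Matrix.mulVec_mulVec, ← Matrix.mul_assoc, ← Matrix.mul_assoc, Matrix.mul_nonsing_inv _ hu,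
        Matrix.one_mul, Matrix.mul_assoc,
        Matrix.nonsing_inv_mul _ (by rwa [Matrix.det_transpose]), Matrix.mul_one]
    exact congrFun this A
  have hgrad0 : ∀ x ∈ V, coneGrad T w (fun y => b (Φ y)) 0 x = coneGrad T' w b 0 (Φ x) := by
    intro x hx
    have := hgrad x hx 0
    rw [Fin.sum_univ_succ] at this
    simpa using this
  have hgradS : ∀ x ∈ V, ∀ a : Fin (n + 1),
      ∑ i, jac Φ x a i * coneGrad T w (fun y => b (Φ y)) i.succ x =
        coneGrad T' w b a.succ (Φ x) := by
    intro x hx a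
    have := hgrad x hx a.succ
    rw [Fin.sum_univ_succ] at this
    simpa using this
  intro x hx
  set ζ : Fin (n + 2) → Eu (n + 1) → ℝ := coneGrad T w (fun y => b (Φ y)) with hζ
  have hζs : ∀ C, ContDiffOn ℝ ∞ (ζ C) V := coneGrad_contDiffOn hT w hbΦ
  have hζd : ∀ C, DifferentiableAt ℝ (ζ C) x := fun C => differentiableAt_of_smooth hV (hζs C) hx
  have hζ's : ∀ C, ContDiffOn ℝ ∞ (coneGrad T' w b C) V' := coneGrad_contDiffOn hT' w hb
  have hKs : SmoothMat V (jac Φ) := jac_contDiffOn hV hΦ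
  have hKd := hKs.differentiableAt hV hx
  have hu : IsUnit (jac Φ x).det := isUnit_iff_ne_zero.2 (hK x hx)
  -- the traces are logarithmic derivatives of determinants
  have htr : ∀ i, ((T x)⁻¹ * pdM i T x).trace =
      2 * ((jac Φ x)⁻¹ * pdM i (jac Φ) x).trace +
        ∑ c, jac Φ x c i * ((T' (Φ x))⁻¹ * pdM c T' (Φ x)).trace := by
    intro i
    have hd0 := hT.det_ne_zero x hx
    have hd1 := hT'.det_ne_zero _ (hmap hx)
    have e1 : pd i (fun y => (T y).det) x =
        pd i (fun y => (jac Φ y).det * (jac Φ y).det * (T' (Φ y)).det) x :=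
      pd_congr_of_eqOn hV (fun y hy => by simp only [hdet y hy]; ring) hx
    have hdd : DifferentiableAt ℝ (fun y => (jac Φ y).det) x :=
      differentiableAt_of_smooth hV hKs.det hx
    rw [pd_mul (u := fun y => (jac Φ y).det * (jac Φ y).det) (hdd.mul hdd)
      (differentiableAt_of_smooth (u := fun y => (T' (Φ y)).det) hV
      ((hT'.smooth.det).comp hΦ hmap) hx), pd_mul hdd hdd,
      pd_comp_jac (b := fun y => (T' y).det) hV hV' hΦ hmap hT'.smooth.det hx,
      pd_det (hT.smooth.differentiableAt hV hx) hd0, pd_det hKd (hK x hx)] at e1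
    simp only [fun c => pd_det (C := c) (hT'.smooth.differentiableAt hV' (hmap hx)) hd1] at e1
    have e2 : ∑ c, jac Φ x c i * ((T' (Φ x)).det * ((T' (Φ x))⁻¹ * pdM c T' (Φ x)).trace) =
        (T' (Φ x)).det * ∑ c, jac Φ x c i * ((T' (Φ x))⁻¹ * pdM c T' (Φ x)).trace := by
      rw [Finset.mul_sum]; exact Finset.sum_congr rfl fun c _ => by ring
    rw [e2, hdet x hx] at e1
    have hk := hK x hx
    have hne : (jac Φ x).det ^ 2 * (T' (Φ x)).det ≠ 0 := mul_ne_zero (pow_ne_zero _ hk) hd1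
    apply mul_left_cancel₀ hne
    rw [e1]; ring
  -- the divergence of the gradient
  have hdiv : ∑ i : Fin (n + 1), ζ i.succ x * ((jac Φ x)⁻¹ * pdM i (jac Φ) x).trace +
      ∑ i : Fin (n + 1), pd i (ζ i.succ) x =
        ∑ a : Fin (n + 1), pd a (coneGrad T' w b a.succ) (Φ x) := by
    have h1 : ∀ a j : Fin (n + 1), ∑ i : Fin (n + 1), (pdM i (jac Φ) x a j * ζ i.succ x +
        jac Φ x a i * pd j (ζ i.succ) x) =
          ∑ c, jac Φ x c j * pd c (coneGrad T' w b a.succ) (Φ x) := by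
      intro a j
      have := pd_congr_of_eqOn (A := j) hV (fun y hy => hgradS y hy a) hx
      rw [pd_comp_jac hV hV' hΦ hmap (hζ's a.succ) hx,
        pd_sum (u := fun i y => jac Φ y a i * ζ i.succ y)
          fun i _ => (hKd a i).mul (hζd i.succ)] at this
      rw [← this]
      refine Finset.sum_congr rfl fun i _ => ?_
      rw [pd_mul (hKd a i) (hζd i.succ), jac_symm hV hΦ hx]
      rfl
    have h2 : ∑ a, ∑ j, (jac Φ x)⁻¹ j a * ∑ i : Fin (n + 1), (pdM i (jac Φ) x a j * ζ i.succ x +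
        jac Φ x a i * pd j (ζ i.succ) x) = ∑ a, ∑ j, (jac Φ x)⁻¹ j a *
          ∑ c, jac Φ x c j * pd c (coneGrad T' w b a.succ) (Φ x) := by
      simp only [h1]
    have hKi : ∀ i j, ∑ a, (jac Φ x)⁻¹ j a * jac Φ x a i = if j = i then 1 else 0 := by
      intro i j
      rw [← Matrix.mul_apply, Matrix.nonsing_inv_mul _ hu, Matrix.one_apply]
    have hKi' : ∀ a c, ∑ j, jac Φ x c j * (jac Φ x)⁻¹ j a = if c = a then 1 else 0 := by
      intro i j
      rw [← Matrix.mul_apply, Matrix.mul_nonsing_inv _ hu, Matrix.one_apply]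
    have h3 : ∑ a, ∑ j, (jac Φ x)⁻¹ j a *
          ∑ c, jac Φ x c j * pd c (coneGrad T' w b a.succ) (Φ x) =
        ∑ a : Fin (n + 1), pd a (coneGrad T' w b a.succ) (Φ x) := by
      refine Finset.sum_congr rfl fun a _ => ?_
      calc _ = ∑ c, (∑ j, jac Φ x c j * (jac Φ x)⁻¹ j a) *
            pd c (coneGrad T' w b a.succ) (Φ x) := by
            simp only [Finset.mul_sum, Finset.sum_mul]
            rw [Finset.sum_comm]
            exact Finset.sum_congr rfl fun c _ => Finset.sum_congr rfl fun j _ => by ring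
        _ = _ := by simp only [hKi']; simp
    have h4 : ∑ a, ∑ j, (jac Φ x)⁻¹ j a * ∑ i : Fin (n + 1), (pdM i (jac Φ) x a j * ζ i.succ x +
        jac Φ x a i * pd j (ζ i.succ) x) =
        ∑ i : Fin (n + 1), ζ i.succ x * ((jac Φ x)⁻¹ * pdM i (jac Φ) x).trace +
      ∑ i : Fin (n + 1), pd i (ζ i.succ) x := by
      simp only [Finset.sum_add_distrib, mul_add]
      congr 1
      · simp only [Matrix.trace, Matrix.diag, Matrix.mul_apply, Finset.mul_sum]
        rw [Finset.sum_comm' (t' := Finset.univ) (s' := fun _ => Finset.univ) (by simp)]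
        rw [Finset.sum_congr rfl fun j _ => Finset.sum_comm]
        rw [Finset.sum_comm]
        exact Finset.sum_congr rfl fun c _ => Finset.sum_congr rfl fun j _ =>
          Finset.sum_congr rfl fun a _ => by ring
      · calc _ = ∑ j : Fin (n + 1), ∑ i : Fin (n + 1), (∑ a, (jac Φ x)⁻¹ j a * jac Φ x a i) *
              pd j (ζ i.succ) x := by
              rw [Finset.sum_comm]
              refine Finset.sum_congr rfl fun j _ => ?_
              simp only [Finset.mul_sum, Finset.sum_mul]
              rw [Finset.sum_comm]
              exact Finset.sum_congr rfl fun c _ => Finset.sum_congr rfl fun j _ => by ring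
          _ = _ := by simp only [hKi]; simp
    rw [← h4, h2, h3]
  have hlast : ∑ i : Fin (n + 1), ζ i.succ x *
      ∑ c, jac Φ x c i * ((T' (Φ x))⁻¹ * pdM c T' (Φ x)).trace =
      ∑ a : Fin (n + 1), coneGrad T' w b a.succ (Φ x) *
        ((T' (Φ x))⁻¹ * pdM a T' (Φ x)).trace := by
    simp only [← hgradS x hx, Finset.mul_sum, Finset.sum_mul]
    rw [Finset.sum_comm]
    exact Finset.sum_congr rfl fun c _ => Finset.sum_congr rfl fun j _ => by ring
  simp only [coneLap]
  rw [← hζ]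
  simp only [htr, mul_add, Finset.sum_add_distrib]
  rw [hlast, ← hdiv, hgrad0 x hx]
  have : ∑ i : Fin (n + 1), ζ i.succ x * (2 * ((jac Φ x)⁻¹ * pdM i (jac Φ) x).trace) =
      2 * ∑ i : Fin (n + 1), ζ i.succ x * ((jac Φ x)⁻¹ * pdM i (jac Φ) x).trace := by
    rw [Finset.mul_sum]; exact Finset.sum_congr rfl fun c _ => by ring
  rw [this]; ring

theorem lapPow_comp (hT : IsMetricOn V T) (hT' : IsMetricOn V' T')
    {Φ : Eu (n + 1) → Eu (n + 1)} (hΦ : ContDiffOn ℝ ∞ Φ V) (hmap : Set.MapsTo Φ V V')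
    (htrans : ∀ x ∈ V, T x = (hat (jac Φ x)).transpose * T' (Φ x) * hat (jac Φ x)) (w : ℝ)
    (m : ℕ) {b : Eu (n + 1) → ℝ} (hb : ContDiffOn ℝ ∞ b V') :
    Set.EqOn (lapPow T m w (fun y => b (Φ y))) (fun x => lapPow T' m w b (Φ x)) V := by
  induction m with
  | zero => exact fun x _ => rfl
  | succ m ih =>
    exact (coneLap_congr hT.isOpen ih).trans
      (coneLap_comp hT hT' hΦ hmap htrans _ (lapPow_contDiffOn hT' m w hb))

end CoordinateChange

/-! ### The defining function as a coordinate -/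

section Adapted

variable {n : ℕ} {T : Eu (n + 1) → Matrix (Fin (n + 2)) (Fin (n + 2)) ℝ} {V : Set (Eu (n + 1))}

/-- `T` is a metric whose first row is the differential of `t² x⁰` at `t = 1`.  Equivalently, the
gradient of `t² x⁰` is the Euler field `t ∂_t`. -/
structure IsAdapted (V : Set (Eu (n + 1)))
    (T : Eu (n + 1) → Matrix (Fin (n + 2)) (Fin (n + 2)) ℝ) : Prop extends IsMetricOn V T where
  row_zero : ∀ x ∈ V, ∀ A, T x 0 A = jet 2 (fun y => y 0) x A

theorem coord_contDiffOn : ContDiffOn ℝ ∞ (fun y : Eu (n + 1) => y 0) V :=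
  (contDiff_coord 0).contDiffOn

/-- The Euler field is the gradient of `t² x⁰`. -/
theorem IsAdapted.coneGrad_coord (hT : IsAdapted V T) {x : Eu (n + 1)} (hx : x ∈ V)
    (C : Fin (n + 2)) : coneGrad T 2 (fun y => y 0) C x = if C = 0 then 1 else 0 := by
  have h : ((T x)⁻¹ * T x) C 0 = if C = 0 then 1 else 0 := by
    rw [Matrix.nonsing_inv_mul _ (isUnit_iff_ne_zero.2 (hT.det_ne_zero x hx)), Matrix.one_apply]
  rw [← h, Matrix.mul_apply]
  refine Finset.sum_congr rfl fun D _ => ?_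
  rw [← hT.row_zero x hx D, (hT.isSymm x hx).apply]

/-- The derivative of a homogeneous function along the Euler field. -/
theorem IsAdapted.coneGrad_pairing (hT : IsAdapted V T) {x : Eu (n + 1)} (hx : x ∈ V) (w : ℝ)
    (b : Eu (n + 1) → ℝ) :
    2 * x 0 * coneGrad T w b 0 x + coneGrad T w b (Fin.succ 0) x = w * b x := by
  have h : ∑ C, T x 0 C * coneGrad T w b C x = w * b x := by
    have : (T x).mulVec ((T x)⁻¹.mulVec (jet w b x)) = jet w b x := by
      rw [Matrix.mulVec_mulVec,
        Matrix.mul_nonsing_inv _ (isUnit_iff_ne_zero.2 (hT.det_ne_zero x hx)), Matrix.one_mulVec]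
    exact congrFun this 0
  rw [← h, Fin.sum_univ_succ, Fin.sum_univ_succ]
  simp only [hT.row_zero x hx]
  simp [jet, pd_coord, (Fin.succ_ne_zero _).symm]

theorem IsAdapted.coneGrad_coord_mul (hT : IsAdapted V T) (w : ℝ) {b : Eu (n + 1) → ℝ}
    (hb : ContDiffOn ℝ ∞ b V) (C : Fin (n + 2)) :
    Set.EqOn (coneGrad T (w + 2) (fun y => y 0 * b y) C)
      (fun x => x 0 * coneGrad T w b C x + if C = 0 then b x else 0) V := by
  intro x hx
  have hj : ∀ D, jet (w + 2) (fun y => y 0 * b y) x D =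
      x 0 * jet w b x D + b x * jet 2 (fun y => y 0) x D := by
    intro D
    refine Fin.cases ?_ (fun i => ?_) D
    · simp [jet]; ring
    · have := pd_mul (A := i) (differentiableAt_of_smooth hT.isOpen coord_contDiffOn hx)
        (differentiableAt_of_smooth hT.isOpen hb hx)
      simp only [jet, Fin.cons_succ, this]; ring
  have h := hT.coneGrad_coord hx C
  simp only [coneGrad] at h
  simp only [coneGrad, hj, mul_add, Finset.sum_add_distrib, Finset.mul_sum]
  congr 1
  · exact Finset.sum_congr rfl fun D _ => by ring
  · rw [← mul_one (if C = 0 then b x else 0)]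
    have h' : ∑ D, (T x)⁻¹ C D * (b x * jet 2 (fun y => y 0) x D) =
        b x * ∑ D, (T x)⁻¹ C D * jet 2 (fun y => y 0) x D := by
      rw [Finset.mul_sum]; exact Finset.sum_congr rfl fun D _ => by ring
    rw [h', h]; split_ifs <;> simp

/-- The commutator of the Laplacian with multiplication by `t² x⁰`. -/
theorem IsAdapted.coneLap_coord_mul (hT : IsAdapted V T) (w : ℝ) {b : Eu (n + 1) → ℝ}
    (hb : ContDiffOn ℝ ∞ b V) :
    Set.EqOn (coneLap T (w + 2) (fun y => y 0 * b y))
      (fun x => x 0 * coneLap T w b x - (2 * w + n + 2) * b x) V := by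
  intro x hx
  have hV := hT.isOpen
  have hg := hT.coneGrad_coord_mul w hb
  have hg' : ∀ i : Fin (n + 1), Set.EqOn (coneGrad T (w + 2) (fun y => y 0 * b y) i.succ)
      (fun x => x 0 * coneGrad T w b i.succ x) V := fun i y hy => by
    rw [hg _ hy]; simp [Fin.succ_ne_zero]
  have hp : ∀ i : Fin (n + 1), pd i (coneGrad T (w + 2) (fun y => y 0 * b y) i.succ) x =
      (if i = 0 then coneGrad T w b i.succ x else 0) + x 0 * pd i (coneGrad T w b i.succ) x := by
    intro i
    rw [pd_congr_of_eqOn hV (hg' i) hx, pd_mul (differentiableAt_of_smooth hV coord_contDiffOn hx)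
      (differentiableAt_of_smooth hV (coneGrad_contDiffOn hT.toIsMetricOn w hb _) hx), pd_coord]
    by_cases h : i = 0
    · subst h; simp
    · simp [h, Ne.symm h]
  simp only [coneLap, hp, hg' _ hx, hg 0 hx, Finset.sum_add_distrib, mul_assoc (x 0),
    ← Finset.mul_sum]
  have := hT.coneGrad_pairing hx w b
  simp only [Finset.sum_ite_eq', Finset.mem_univ, if_true]
  linear_combination (-1 : ℝ) * this

/-- The commutator of the Laplacian with multiplication by `(t² x⁰)^{k+1}`. -/
theorem IsAdapted.coneLap_coord_pow_mul (hT : IsAdapted V T) (w : ℝ) {b : Eu (n + 1) → ℝ}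
    (hb : ContDiffOn ℝ ∞ b V) (k : ℕ) :
    Set.EqOn (coneLap T (w + 2 * (k + 1)) (fun y => y 0 ^ (k + 1) * b y))
      (fun x => x 0 ^ (k + 1) * coneLap T w b x -
        (k + 1) * (2 * w + n + 2 * k + 2) * (x 0 ^ k * b x)) V := by
  induction k with
  | zero =>
    intro x hx
    simpa using hT.coneLap_coord_mul w hb hx
  | succ k ih =>
    intro x hx
    have hbk : ContDiffOn ℝ ∞ (fun y : Eu (n + 1) => y 0 ^ (k + 1) * b y) V :=
      (coord_contDiffOn.pow _).mul hb
    have h := hT.coneLap_coord_mul (w + 2 * (k + 1)) hbk hx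
    have e1 : (fun y : Eu (n + 1) => y 0 ^ (k + 1 + 1) * b y) =
        fun y => y 0 * (y 0 ^ (k + 1) * b y) := by funext y; ring
    have e2 : w + 2 * (((k + 1 : ℕ) : ℝ) + 1) = w + 2 * (k + 1) + 2 := by push_cast; ring
    simp only [e1, e2, h, ih hx]
    push_cast; ring

/-- Formal harmonic extension.  A function `f` of degree `w = m - n/2` can be changed off the
boundary so that `Δ u` vanishes to order `k < m` in `x⁰`, with a nonzero multiple of `Δ^{k+1} f` as
its leading coefficient; for `k = m - 1` this is the obstruction to harmonic extension.  The
construction is local, which is the last clause. -/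
theorem IsAdapted.exists_harmonic (hT : IsAdapted V T) {m : ℕ} (k : ℕ) (hk : k + 1 ≤ m) :
    ∃ c : ℝ, c ≠ 0 ∧ ∀ f : Eu (n + 1) → ℝ, ContDiffOn ℝ ∞ f V →
      ∃ u : Eu (n + 1) → ℝ, ContDiffOn ℝ ∞ u V ∧ (∀ x ∈ V, x 0 = 0 → u x = f x) ∧
        (∀ x ∈ V, coneLap T ((m : ℝ) - n / 2) u x =
          c * (x 0 ^ k * lapPow T (k + 1) ((m : ℝ) - n / 2) f x)) ∧
        ∀ W ⊆ V, IsOpen W → (∀ x ∈ W, f x = 0) → ∀ x ∈ W, u x = 0 := by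
  set w : ℝ := (m : ℝ) - n / 2 with hw
  induction k with
  | zero =>
    refine ⟨1, one_ne_zero, fun f hf => ⟨f, hf, fun _ _ _ => rfl, fun x _ => ?_,
      fun _ _ _ h => h⟩⟩
    simp [lapPow]
  | succ k ih =>
    obtain ⟨c, hc, H⟩ := ih (by omega)
    have hmk : ((k : ℝ) + 1) < m := by exact_mod_cast (by omega : k + 1 < m)
    have hfac : ((k : ℝ) + 1) * (2 * (m - 1 - k)) ≠ 0 := by
      have : (m : ℝ) - 1 - k ≠ 0 := by linarith
      positivity
    refine ⟨c / (((k : ℝ) + 1) * (2 * (m - 1 - k))), div_ne_zero hc hfac, fun f hf => ?_⟩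
    -- the correction `a x₀^{k+1} Δ^{k+1} f` removes the leading term, as
    -- `Δ (x₀^{k+1} b) = x₀^{k+1} Δ b - (k + 1) (2 (m - 1 - k)) x₀^k b` for `b = Δ^{k+1} f`
    set a : ℝ := c / (((k : ℝ) + 1) * (2 * (m - 1 - k))) with ha
    obtain ⟨u, hu, hu0, hLu, huW⟩ := H f hf
    have hQ := lapPow_contDiffOn hT.toIsMetricOn (k + 1) w hf
    have hxQ : ContDiffOn ℝ ∞ (fun y : Eu (n + 1) => y 0 ^ (k + 1) * lapPow T (k + 1) w f y) V :=
      (coord_contDiffOn.pow _).mul hQ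
    refine ⟨fun y => u y + a * (y 0 ^ (k + 1) * lapPow T (k + 1) w f y),
      hu.add (contDiffOn_const.mul hxQ), ?_, ?_, ?_⟩
    · intro x hx h0
      simp [hu0 x hx h0, h0]
    · intro x hx
      rw [coneLap_add hT.toIsMetricOn hu (contDiffOn_const.mul hxQ) hx]
      beta_reduce
      rw [hLu x hx, coneLap_const_mul hT.toIsMetricOn a hxQ hx]
      beta_reduce
      have h := hT.coneLap_coord_pow_mul (w - 2 * ((k + 1 : ℕ) : ℝ)) hQ k hx
      rw [show w - 2 * ((k + 1 : ℕ) : ℝ) + 2 * (k + 1) = w by push_cast; ring] at h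
      rw [h]
      beta_reduce
      have e1 : coneLap T (w - 2 * ((k + 1 : ℕ) : ℝ)) (lapPow T (k + 1) w f) x =
          lapPow T (k + 1 + 1) w f x := rfl
      rw [e1]
      have e2 : a * ((k + 1) * (2 * (w - 2 * ((k + 1 : ℕ) : ℝ)) + n + 2 * k + 2)) = c := by
        rw [ha, hw]
        rw [div_mul_eq_mul_div, div_eq_iff hfac]
        push_cast; ring
      linear_combination (-(x 0 ^ k * lapPow T (k + 1) w f x)) * e2
    · intro W hWV hW hf0 x hx
      have h0 : lapPow T (k + 1) w f x = 0 :=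
        lapPow_eq_zero (hT.toIsMetricOn.mono hW hWV) (k + 1) (hf.mono hWV) hf0 x hx
      simp [huW W hWV hW hf0 x hx, h0]

end Adapted

/-! ### Green's identity -/

section Green

variable {n : ℕ} {T : Eu (n + 1) → Matrix (Fin (n + 2)) (Fin (n + 2)) ℝ} {V : Set (Eu (n + 1))}

/-- The volume density `√|det T|`, written by means of `Real.log y = log |y|`. -/
def density (T : Eu (n + 1) → Matrix (Fin (n + 2)) (Fin (n + 2)) ℝ) (x : Eu (n + 1)) : ℝ :=
  Real.exp (1 / 2 * Real.log (T x).det)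

theorem density_pos (x : Eu (n + 1)) : 0 < density T x := Real.exp_pos _

theorem density_contDiffOn (hT : IsMetricOn V T) : ContDiffOn ℝ ∞ (density T) V :=
  (contDiffOn_const.mul (hT.smooth.det.log hT.det_ne_zero)).exp

/-- Jacobi's formula for the volume density. -/
theorem pd_density (hT : IsMetricOn V T) {x : Eu (n + 1)} (hx : x ∈ V) (i : Fin (n + 1)) :
    pd i (density T) x = 1 / 2 * density T x * ((T x)⁻¹ * pdM i T x).trace := by
  have hd := differentiableAt_of_smooth hT.isOpen hT.smooth.det hx
  have h1 := pd_det (C := i) (hT.smooth.differentiableAt hT.isOpen hx) (hT.det_ne_zero x hx)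
  have h2 := ((hd.hasFDerivAt.log (hT.det_ne_zero x hx)).const_mul (1 / 2 : ℝ)).exp
  have h3 : pd i (density T) x = Real.exp (1 / 2 * Real.log (T x).det) *
      (1 / 2 * ((T x).det⁻¹ * pd i (fun y => (T y).det) x)) := by
    unfold density
    rw [pd, h2.fderiv]; rfl
  rw [h3, h1, density]
  have := hT.det_ne_zero x hx
  field_simp

theorem density_mul_coneLap (hT : IsMetricOn V T) (w : ℝ) {b : Eu (n + 1) → ℝ}
    (hb : ContDiffOn ℝ ∞ b V) {x : Eu (n + 1)} (hx : x ∈ V) :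
    density T x * coneLap T w b x = -((w + n) * (density T x * coneGrad T w b 0 x) +
      ∑ i : Fin (n + 1), pd i (fun y => density T y * coneGrad T w b i.succ y) x) := by
  have hV := hT.isOpen
  have : ∀ i : Fin (n + 1), pd i (fun y => density T y * coneGrad T w b i.succ y) x =
      density T x * (1 / 2 * (coneGrad T w b i.succ x * ((T x)⁻¹ * pdM i T x).trace)) +
        density T x * pd i (coneGrad T w b i.succ) x := by
    intro i
    rw [pd_mul (differentiableAt_of_smooth hV (density_contDiffOn hT) hx)
      (differentiableAt_of_smooth hV (coneGrad_contDiffOn hT w hb _) hx), pd_density hT hx]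
    ring
  simp only [this, Finset.sum_add_distrib, ← Finset.mul_sum, coneLap]
  ring

/-- The components `D (a ∇^C b - b ∇^C a)` of the Wronskian current of two functions of degree
`w`, with the volume density `D`. -/
def current (T : Eu (n + 1) → Matrix (Fin (n + 2)) (Fin (n + 2)) ℝ) (w : ℝ)
    (a b : Eu (n + 1) → ℝ) (C : Fin (n + 2)) (x : Eu (n + 1)) : ℝ :=
  a x * (density T x * coneGrad T w b C x) - b x * (density T x * coneGrad T w a C x)

theorem current_contDiffOn (hT : IsMetricOn V T) (w : ℝ) {a b : Eu (n + 1) → ℝ}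
    (ha : ContDiffOn ℝ ∞ a V) (hb : ContDiffOn ℝ ∞ b V) (C : Fin (n + 2)) :
    ContDiffOn ℝ ∞ (current T w a b C) V :=
  (ha.mul ((density_contDiffOn hT).mul (coneGrad_contDiffOn hT w hb C))).sub
    (hb.mul ((density_contDiffOn hT).mul (coneGrad_contDiffOn hT w ha C)))

/-- Green's identity on the ambient space, for functions of degree `w`.  The derivative of the
radial component in the direction of `t` is given by its degree of homogeneity. -/
theorem green_identity (hT : IsMetricOn V T) (w : ℝ) {a b : Eu (n + 1) → ℝ}
    (ha : ContDiffOn ℝ ∞ a V) (hb : ContDiffOn ℝ ∞ b V) {x : Eu (n + 1)} (hx : x ∈ V) :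
    density T x * (a x * coneLap T w b x - b x * coneLap T w a x) =
      -((2 * w + n) * current T w a b 0 x +
        ∑ i : Fin (n + 1), pd i (current T w a b i.succ) x) := by
  have hV := hT.isOpen
  have hDg : ∀ {f : Eu (n + 1) → ℝ}, ContDiffOn ℝ ∞ f V → ∀ C,
      DifferentiableAt ℝ (fun y => density T y * coneGrad T w f C y) x := fun hf C =>
    differentiableAt_of_smooth hV
      ((density_contDiffOn hT).mul (coneGrad_contDiffOn hT w hf C)) hx
  have had := differentiableAt_of_smooth hV ha hx
  have hbd := differentiableAt_of_smooth hV hb hx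
  have hpd : ∀ i : Fin (n + 1), pd i (current T w a b i.succ) x =
      (density T x * (pd i a x * coneGrad T w b i.succ x) -
        density T x * (pd i b x * coneGrad T w a i.succ x)) +
      (a x * pd i (fun y => density T y * coneGrad T w b i.succ y) x -
        b x * pd i (fun y => density T y * coneGrad T w a i.succ y) x) := by
    intro i
    unfold current
    rw [pd_sub (u := fun y => a y * (density T y * coneGrad T w b i.succ y))
      (v := fun y => b y * (density T y * coneGrad T w a i.succ y))
      (had.mul (hDg hb _)) (hbd.mul (hDg ha _)), pd_mul had (hDg hb _),
      pd_mul hbd (hDg ha _)]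
    ring
  -- symmetry of the inverse metric
  have hsymm : ∑ C, jet w a x C * coneGrad T w b C x = ∑ C, jet w b x C * coneGrad T w a C x := by
    simp only [coneGrad, Finset.mul_sum]
    rw [Finset.sum_comm]
    refine Finset.sum_congr rfl fun C _ => Finset.sum_congr rfl fun D _ => ?_
    have : (T x)⁻¹ D C = (T x)⁻¹ C D := by
      conv_rhs => rw [← (hT.isSymm x hx).eq, ← Matrix.transpose_nonsing_inv, Matrix.transpose_apply]
    rw [this]; ring
  simp only [Fin.sum_univ_succ (n := n + 1)] at hsymm
  simp only [jet, Fin.cons_zero, Fin.cons_succ] at hsymm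
  have h1 := density_mul_coneLap hT w hb hx
  have h2 := density_mul_coneLap hT w ha hx
  simp only [hpd, Finset.sum_add_distrib, Finset.sum_sub_distrib, ← Finset.mul_sum]
  simp only [current]
  linear_combination a x * h1 - b x * h2 + density T x * hsymm

end Green

/-! ### Normal derivatives -/

section NormalDerivatives

variable {d : ℕ} {V : Set (Eu (d + 1))}

theorem iterate_pd_contDiffOn (hV : IsOpen V) (k : ℕ) {g : Eu (d + 1) → ℝ}
    (hg : ContDiffOn ℝ ∞ g V) : ContDiffOn ℝ ∞ ((pd 0)^[k] g) V := by
  induction k with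
  | zero => exact hg
  | succ k ih => rw [Function.iterate_succ_apply']; exact pd_contDiffOn hV 0 ih

theorem iterate_pd_congr (hV : IsOpen V) (k : ℕ) {g h : Eu (d + 1) → ℝ} (hgh : Set.EqOn g h V) :
    Set.EqOn ((pd 0)^[k] g) ((pd 0)^[k] h) V := by
  induction k with
  | zero => exact hgh
  | succ k ih =>
    intro x hx
    simp only [Function.iterate_succ_apply']
    exact pd_congr_of_eqOn hV ih hx

theorem iterate_pd_add (hV : IsOpen V) (k : ℕ) {g h : Eu (d + 1) → ℝ}
    (hg : ContDiffOn ℝ ∞ g V) (hh : ContDiffOn ℝ ∞ h V) :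
    Set.EqOn ((pd 0)^[k] fun y => g y + h y) (fun x => (pd 0)^[k] g x + (pd 0)^[k] h x) V := by
  induction k with
  | zero => exact fun _ _ => rfl
  | succ k ih =>
    intro x hx
    simp only [Function.iterate_succ_apply']
    rw [pd_congr_of_eqOn hV ih hx, pd_add
      (differentiableAt_of_smooth hV (iterate_pd_contDiffOn hV k hg) hx)
      (differentiableAt_of_smooth hV (iterate_pd_contDiffOn hV k hh) hx)]

theorem iterate_pd_const_mul (hV : IsOpen V) (k : ℕ) (c : ℝ) {g : Eu (d + 1) → ℝ}
    (hg : ContDiffOn ℝ ∞ g V) :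
    Set.EqOn ((pd 0)^[k] fun y => c * g y) (fun x => c * (pd 0)^[k] g x) V := by
  induction k with
  | zero => exact fun _ _ => rfl
  | succ k ih =>
    intro x hx
    simp only [Function.iterate_succ_apply']
    rw [pd_congr_of_eqOn hV ih hx, pd_const_mul c
      (differentiableAt_of_smooth hV (iterate_pd_contDiffOn hV k hg) hx)]

theorem iterate_pd_sum (hV : IsOpen V) (k : ℕ) {ι : Type*} (s : Finset ι)
    {g : ι → Eu (d + 1) → ℝ} (hg : ∀ i ∈ s, ContDiffOn ℝ ∞ (g i) V) :
    Set.EqOn ((pd 0)^[k] fun y => ∑ i ∈ s, g i y) (fun x => ∑ i ∈ s, (pd 0)^[k] (g i) x) V := by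
  induction k with
  | zero => exact fun _ _ => rfl
  | succ k ih =>
    intro x hx
    simp only [Function.iterate_succ_apply']
    rw [pd_congr_of_eqOn hV ih hx, pd_sum fun i hi =>
      differentiableAt_of_smooth hV (iterate_pd_contDiffOn hV k (hg i hi)) hx]

theorem iterate_pd_comm (hV : IsOpen V) (k : ℕ) (A : Fin (d + 1)) {g : Eu (d + 1) → ℝ}
    (hg : ContDiffOn ℝ ∞ g V) :
    Set.EqOn ((pd 0)^[k] (pd A g)) (pd A ((pd 0)^[k] g)) V := by
  induction k with
  | zero => exact fun _ _ => rfl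
  | succ k ih =>
    intro x hx
    simp only [Function.iterate_succ_apply']
    rw [pd_congr_of_eqOn hV ih hx]
    exact pd_comm hV (iterate_pd_contDiffOn hV k hg) hx

/-- The Leibniz rule for `∂_0^{k+1} (x⁰ g)`. -/
theorem iterate_pd_coord_mul (hV : IsOpen V) (k : ℕ) {g : Eu (d + 1) → ℝ}
    (hg : ContDiffOn ℝ ∞ g V) :
    Set.EqOn ((pd 0)^[k + 1] fun y => y 0 * g y)
      (fun x => x 0 * (pd 0)^[k + 1] g x + (k + 1) * (pd 0)^[k] g x) V := by
  induction k with
  | zero =>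
    intro x hx
    simp only [zero_add, Function.iterate_one, Function.iterate_zero, id]
    rw [pd_mul (differentiableAt_of_smooth hV ((contDiff_coord 0).contDiffOn) hx)
      (differentiableAt_of_smooth hV hg hx), pd_coord]
    simp; ring
  | succ k ih =>
    intro x hx
    have h1 := fun j => differentiableAt_of_smooth hV (iterate_pd_contDiffOn hV j hg) hx
    have hc := differentiableAt_of_smooth hV
      ((contDiff_coord (0 : Fin (d + 1))).contDiffOn (s := V)) hx
    rw [Function.iterate_succ_apply' _ (k + 1), pd_congr_of_eqOn hV ih hx,
      pd_add (u := fun x => x 0 * (pd 0)^[k + 1] g x) (v := fun x => (k + 1) * (pd 0)^[k] g x)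
        (hc.mul (h1 _)) ((h1 _).const_mul _), pd_mul hc (h1 _), pd_const_mul _ (h1 _),
      pd_coord]
    simp only [← Function.iterate_succ_apply' (pd 0)]
    simp only [if_true]
    push_cast; ring

theorem iterate_pd_coord_pow_mul (hV : IsOpen V) (k : ℕ) {g : Eu (d + 1) → ℝ}
    (hg : ContDiffOn ℝ ∞ g V) {x : Eu (d + 1)} (hx : x ∈ V) (h0 : x 0 = 0) :
    (pd 0)^[k] (fun y => y 0 ^ k * g y) x = k.factorial * g x := by
  induction k with
  | zero => simp
  | succ k ih =>
    have e : (fun y : Eu (d + 1) => y 0 ^ (k + 1) * g y) = fun y => y 0 * (y 0 ^ k * g y) := by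
      funext y; ring
    rw [e, iterate_pd_coord_mul hV k ((((contDiff_coord 0).contDiffOn).pow k).mul hg) hx]
    beta_reduce
    rw [h0, ih, Nat.factorial_succ]
    push_cast; ring

end NormalDerivatives

section Obstruction

variable {n : ℕ} {T : Eu (n + 1) → Matrix (Fin (n + 2)) (Fin (n + 2)) ℝ} {V : Set (Eu (n + 1))}

/-- For functions of degree `m - n/2` that are harmonic modulo `(x⁰)^{m-1}`, the antisymmetric
part of the obstructions is a tangential divergence on the boundary: in Green's identity the
radial component `Y` of the current enters as `(2m-2) Y - 2 x⁰ ∂_0 Y`, which has no term of order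
`m - 1` in `x⁰`. -/
theorem IsAdapted.obstruction_eq_divergence (hT : IsAdapted V T) (k : ℕ)
    {u v g h : Eu (n + 1) → ℝ} (hu : ContDiffOn ℝ ∞ u V) (hv : ContDiffOn ℝ ∞ v V)
    (hg : ContDiffOn ℝ ∞ g V) (hh : ContDiffOn ℝ ∞ h V) {w : ℝ}
    (hw : 2 * w + n = 2 * (k + 1))
    (hLu : ∀ x ∈ V, coneLap T w u x = x 0 ^ k * g x)
    (hLv : ∀ x ∈ V, coneLap T w v x = x 0 ^ k * h x) {x : Eu (n + 1)} (hx : x ∈ V)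
    (h0 : x 0 = 0) :
    k.factorial * (density T x * (u x * h x - v x * g x)) =
      -∑ α : Fin n, pd α.succ ((pd 0)^[k] (current T w u v α.succ.succ)) x := by
  have hV := hT.isOpen
  have hM := hT.toIsMetricOn
  have hc := current_contDiffOn hM w hu hv
  set Y := current T w u v 0 with hY
  have hxc : ContDiffOn ℝ ∞ (fun y : Eu (n + 1) => y 0) V := coord_contDiffOn
  -- the current is tangent to the level sets of `t² x⁰`
  have hZ0 : Set.EqOn (current T w u v (Fin.succ 0)) (fun y => (-2) * (y 0 * Y y)) V := by
    intro y hy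
    have e1 := hT.coneGrad_pairing hy w u
    have e2 := hT.coneGrad_pairing hy w v
    simp only [hY, current]
    linear_combination u y * density T y * e2 - v y * density T y * e1
  have hκ : ContDiffOn ℝ ∞ (fun y => density T y * (u y * h y - v y * g y)) V :=
    (density_contDiffOn hM).mul ((hu.mul hh).sub (hv.mul hg))
  have hpdZ : ∀ α : Fin n, ContDiffOn ℝ ∞ (pd α.succ (current T w u v α.succ.succ)) V :=
    fun α => pd_contDiffOn hV _ (hc _)
  have hYx : ContDiffOn ℝ ∞ (fun y => y 0 * pd 0 Y y) V := hxc.mul (pd_contDiffOn hV 0 (hc 0))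
  have hident : Set.EqOn (fun y => y 0 ^ k * (density T y * (u y * h y - v y * g y)))
      (fun y => ((-2) * k * Y y + 2 * (y 0 * pd 0 Y y)) +
        (-1) * ∑ α : Fin n, pd α.succ (current T w u v α.succ.succ) y) V := by
    intro y hy
    have hgr := green_identity hM w hu hv hy
    rw [hLu y hy, hLv y hy, Fin.sum_univ_succ, hw, pd_congr_of_eqOn hV hZ0 hy,
      pd_const_mul (v := fun y => y 0 * Y y) _ ((differentiableAt_of_smooth hV hxc hy).mul
        (differentiableAt_of_smooth hV (hc 0) hy)),
      pd_mul (differentiableAt_of_smooth hV hxc hy) (differentiableAt_of_smooth hV (hc 0) hy),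
      pd_coord] at hgr
    simp only [if_true] at hgr
    rw [← hY] at hgr
    simp only
    linear_combination hgr
  rw [← iterate_pd_coord_pow_mul hV k hκ hx h0, iterate_pd_congr hV k hident hx,
    iterate_pd_add hV k ((contDiffOn_const.mul (hc 0)).add (contDiffOn_const.mul hYx))
      (contDiffOn_const.mul (ContDiffOn.sum fun α _ => hpdZ α)) hx]
  beta_reduce
  rw [iterate_pd_add (g := fun y => -2 * k * Y y) (h := fun y => 2 * (y 0 * pd 0 Y y)) hV k
      (contDiffOn_const.mul (hc 0)) (contDiffOn_const.mul hYx) hx]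
  beta_reduce
  rw [iterate_pd_const_mul hV k _ (hc 0) hx, iterate_pd_const_mul hV k _ hYx hx,
    iterate_pd_const_mul hV k _ (ContDiffOn.sum fun α _ => hpdZ α) hx]
  beta_reduce
  rw [iterate_pd_sum hV k _ (fun α _ => hpdZ α) hx]
  have hcancel : (pd 0)^[k] (fun y => y 0 * pd 0 Y y) x = k * (pd 0)^[k] Y x := by
    cases k with
    | zero => simp [h0]
    | succ k =>
      rw [iterate_pd_coord_mul hV k (pd_contDiffOn hV 0 (hc 0)) hx]
      beta_reduce
      rw [h0]
      simp only [← Function.iterate_succ_apply (pd 0)]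
      push_cast; ring
  have hsum : ∑ α : Fin n, (pd 0)^[k] (pd α.succ (current T w u v α.succ.succ)) x =
      ∑ α : Fin n, pd α.succ ((pd 0)^[k] (current T w u v α.succ.succ)) x :=
    Finset.sum_congr rfl fun α _ => iterate_pd_comm hV k α.succ (hc α.succ.succ) hx
  beta_reduce
  rw [hcancel, hsum]
  ring

end Obstruction

/-! ### Integration over the boundary hyperplane -/

section Integration

open MeasureTheory

theorem integrableOn_of_compact_support {d : ℕ} {S K : Set (Eu d)} (hS : IsOpen S)
    (hK : IsCompact K) (hKS : K ⊆ S) {g : Eu d → ℝ} (hg : ContinuousOn g S)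
    (h0 : ∀ y ∈ S \ K, g y = 0) : IntegrableOn g S :=
  ((hg.mono hKS).integrableOn_compact hK).of_forall_sdiff_eq_zero hS.measurableSet h0

/-- The integral of a derivative of a function with compact support in `S` vanishes. -/
theorem setIntegral_pd_eq_zero {d : ℕ} {S K : Set (Eu d)} (hS : IsOpen S)
    (hK : IsCompact K) (hKS : K ⊆ S) {g : Eu d → ℝ} (hg : ContDiffOn ℝ ∞ g S)
    (h0 : ∀ y ∈ S \ K, g y = 0) (α : Fin d) : ∫ y in S, pd α g y = 0 := by
  classical
  set G : Eu d → ℝ := S.indicator g with hG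
  have hGS : Set.EqOn G g S := fun y hy => Set.indicator_of_mem hy g
  have hGK : ∀ y ∈ Kᶜ, G y = 0 := by
    intro y hy
    by_cases hyS : y ∈ S
    · rw [hGS hyS, h0 y ⟨hyS, hy⟩]
    · exact Set.indicator_of_notMem hyS g
  have hGsm : ContDiff ℝ ∞ G := by
    rw [contDiff_iff_contDiffAt]
    intro y
    by_cases hy : y ∈ S
    · exact (hg.contDiffAt (hS.mem_nhds hy)).congr_of_eventuallyEq
        (hGS.eventuallyEq_of_mem (hS.mem_nhds hy))
    · refine (contDiffAt_const (c := (0 : ℝ))).congr_of_eventuallyEq ?_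
      filter_upwards [hK.isClosed.isOpen_compl.mem_nhds fun h => hy (hKS h)] with z hz
        using hGK z hz
  have hGc : HasCompactSupport G := HasCompactSupport.intro hK fun y hy => hGK y hy
  have hpdc : Continuous (pd α G) :=
    (hGsm.continuous_fderiv (by simp)).clm_apply continuous_const
  have hpdcs : HasCompactSupport (pd α G) := by
    refine HasCompactSupport.intro hK fun y hy => ?_
    rw [pd_congr_of_eqOn (v := fun _ => 0) hK.isClosed.isOpen_compl (fun z hz => hGK z hz) hy]
    simp
  have hint : ∫ y, pd α G y = 0 := by
    have h := integral_mul_fderiv_eq_neg_fderiv_mul_of_integrable (𝕜 := ℝ) (μ := volume)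
      (f := fun _ : Eu d => (1 : ℝ)) (g := G) (v := EuclideanSpace.single α 1)
      (by simp) (by simpa [Function.comp_def, pd] using! hpdc.integrable_of_hasCompactSupport hpdcs)
      (by simpa using hGsm.continuous.integrable_of_hasCompactSupport hGc)
      (fun _ _ => by fun_prop) (fun _ _ => (hGsm.differentiable (by simp)).differentiableAt)
    simpa using! h
  rw [← hint, ← integral_indicator hS.measurableSet]
  congr 1
  funext y
  by_cases hy : y ∈ S
  · rw [Set.indicator_of_mem hy, pd_congr_of_eqOn hS hGS hy]
  · rw [Set.indicator_of_notMem hy,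
      pd_congr_of_eqOn (v := fun _ => 0) hK.isClosed.isOpen_compl (fun z hz => hGK z hz)
        (fun h => hy (hKS h))]
    simp

theorem contDiff_ambPt {d : ℕ} (t : ℝ) : ContDiff ℝ ∞ (ambPt t : Eu d → Eu (d + 1)) := by
  rw [contDiff_euclidean]
  intro i
  refine Fin.cases ?_ (fun j => ?_) i
  · exact contDiff_const
  · exact contDiff_coord j

@[simp] theorem ambPt_zero {d : ℕ} (t : ℝ) (y : Eu d) : ambPt t y 0 = t := rfl

theorem pd_ambPt {d : ℕ} (t : ℝ) (α : Fin d) {g : Eu (d + 1) → ℝ} {y : Eu d}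
    (hg : DifferentiableAt ℝ g (ambPt t y)) :
    pd α (fun y => g (ambPt t y)) y = pd α.succ g (ambPt t y) := by
  rw [pd_comp (Φ := ambPt t) α hg ((contDiff_ambPt t).differentiable (by simp)).differentiableAt,
    Fin.sum_univ_succ]
  have : ∀ i : Fin d, pd α (fun y : Eu d => ambPt t y i.succ) y = if i = α then 1 else 0 :=
    fun i => pd_coord α i y
  have h0 : pd α (fun y : Eu d => ambPt t y 0) y = 0 := pd_const α t y
  rw [h0]
  simp only [this]
  simp

theorem isClosedEmbedding_ambPt {d : ℕ} (t : ℝ) :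
    Topology.IsClosedEmbedding (ambPt t : Eu d → Eu (d + 1)) := by
  have hl : Function.LeftInverse
      (fun x : Eu (d + 1) => (WithLp.toLp 2 fun i : Fin d => x i.succ : Eu d)) (ambPt t) :=
    fun y => rfl
  have hc : ContDiff ℝ ∞ (fun x : Eu (d + 1) => (WithLp.toLp 2 fun i : Fin d => x i.succ : Eu d)) :=
    contDiff_euclidean.2 fun i => contDiff_coord i.succ
  exact hl.isClosedEmbedding hc.continuous (contDiff_ambPt t).continuous

/-- The slice `x⁰ = 0` of a set. -/
def slice {d : ℕ} (V : Set (Eu (d + 1))) : Set (Eu d) := {y | ambPt 0 y ∈ V}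

theorem isOpen_slice {d : ℕ} {V : Set (Eu (d + 1))} (hV : IsOpen V) : IsOpen (slice V) :=
  hV.preimage (contDiff_ambPt 0).continuous

theorem isCompact_slice {d : ℕ} {K : Set (Eu (d + 1))} (hK : IsCompact K) :
    IsCompact (slice K) := (isClosedEmbedding_ambPt 0).isCompact_preimage hK

theorem contDiffOn_slice {d : ℕ} {V : Set (Eu (d + 1))} {g : Eu (d + 1) → ℝ}
    (hg : ContDiffOn ℝ ∞ g V) : ContDiffOn ℝ ∞ (fun y => g (ambPt 0 y)) (slice V) :=
  hg.comp (contDiff_ambPt 0).contDiffOn fun _ hy => hy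

variable {n : ℕ} {T : Eu (n + 1) → Matrix (Fin (n + 2)) (Fin (n + 2)) ℝ} {V : Set (Eu (n + 1))}

theorem current_eq_zero (hV : IsOpen V) (w : ℝ) {a b : Eu (n + 1) → ℝ}
    (ha : ∀ x ∈ V, a x = 0) (C : Fin (n + 2)) : ∀ x ∈ V, current T w a b C x = 0 := by
  intro x hx
  have hj : ∀ D, jet w a x D = 0 := by
    intro D
    rw [jet_congr (b' := fun _ => 0) hV ha hx]
    refine Fin.cases ?_ (fun i => ?_) D <;> simp [jet]
  simp [current, coneGrad, hj, ha x hx]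

/-- Formal self-adjointness of `Δ^m` on the boundary hyperplane, in one coordinate chart: for the
formal harmonic extensions of `f` and `g`, the integrand is a divergence. -/
theorem IsAdapted.integral_lapPow_antisymm (hT : IsAdapted V T) {m : ℕ} (hm : 1 ≤ m)
    {K : Set (Eu (n + 1))} (hK : IsCompact K) (hKV : K ⊆ V) {f g : Eu (n + 1) → ℝ}
    (hf : ContDiffOn ℝ ∞ f V) (hg : ContDiffOn ℝ ∞ g V) (hfK : ∀ x ∈ V \ K, f x = 0) :
    ∫ y in slice V, density T (ambPt 0 y) *
      (f (ambPt 0 y) * lapPow T m ((m : ℝ) - n / 2) g (ambPt 0 y) -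
        g (ambPt 0 y) * lapPow T m ((m : ℝ) - n / 2) f (ambPt 0 y)) = 0 := by
  obtain ⟨k, rfl⟩ : ∃ k, m = k + 1 := ⟨m - 1, by omega⟩
  set w : ℝ := ((k + 1 : ℕ) : ℝ) - n / 2 with hw
  have hV := hT.isOpen
  have hM := hT.toIsMetricOn
  obtain ⟨c, hc, H⟩ := hT.exists_harmonic (m := k + 1) k le_rfl
  obtain ⟨u, hu, hu0, hLu, huW⟩ := H f hf
  obtain ⟨v, hv, hv0, hLv, -⟩ := H g hg
  have hQf := lapPow_contDiffOn hM (k + 1) w hf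
  have hQg := lapPow_contDiffOn hM (k + 1) w hg
  have hdiv : ∀ y ∈ slice V, density T (ambPt 0 y) *
      (f (ambPt 0 y) * lapPow T (k + 1) w g (ambPt 0 y) -
        g (ambPt 0 y) * lapPow T (k + 1) w f (ambPt 0 y)) =
      (-(c * k.factorial)⁻¹) * ∑ α : Fin n,
        pd α (fun y => (pd 0)^[k] (current T w u v α.succ.succ) (ambPt 0 y)) y := by
    intro y hy
    have h := hT.obstruction_eq_divergence k hu hv (contDiffOn_const.mul hQf)
      (contDiffOn_const.mul hQg) (w := w) (by rw [hw]; push_cast; ring)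
      (g := fun x => c * lapPow T (k + 1) w f x) (h := fun x => c * lapPow T (k + 1) w g x)
      (fun x hx => by rw [hLu x hx]; ring) (fun x hx => by rw [hLv x hx]; ring) hy
      (ambPt_zero 0 y)
    rw [hu0 _ hy (ambPt_zero 0 y), hv0 _ hy (ambPt_zero 0 y)] at h
    simp only [fun α => pd_ambPt 0 α (differentiableAt_of_smooth hV
      (iterate_pd_contDiffOn hV k (current_contDiffOn hM w hu hv α.succ.succ)) hy)]
    have hk : (k.factorial : ℝ) ≠ 0 := by positivity
    rw [neg_mul, ← mul_neg, ← h]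
    field_simp
  have hW : IsOpen (V \ K) := hV.sdiff hK.isClosed
  have hu0K : ∀ x ∈ V \ K, u x = 0 := huW _ Set.sdiff_subset hW hfK
  have hcsm : ∀ α : Fin n, ContDiffOn ℝ ∞
      (fun y => (pd 0)^[k] (current T w u v α.succ.succ) (ambPt 0 y)) (slice V) := fun α =>
    contDiffOn_slice (iterate_pd_contDiffOn hV k (current_contDiffOn hM w hu hv _))
  have hc0 : ∀ α : Fin n, ∀ y ∈ slice V \ slice K,
      (pd 0)^[k] (current T w u v α.succ.succ) (ambPt 0 y) = 0 := by
    intro α y hy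
    have e := iterate_pd_congr hW k (h := fun _ => 0)
      (current_eq_zero (T := T) hW w (b := v) hu0K α.succ.succ) ⟨hy.1, hy.2⟩
    rw [e]
    have := iterate_pd_const_mul isOpen_univ k 0 (contDiffOn_const (c := (0 : ℝ)))
      (Set.mem_univ (ambPt 0 y))
    simpa using this
  have hS := isOpen_slice hV
  have hKS : slice K ⊆ slice V := fun y hy => hKV hy
  rw [setIntegral_congr_fun hS.measurableSet hdiv, integral_const_mul, integral_finsetSum]
  · simp only [fun α => setIntegral_pd_eq_zero hS (isCompact_slice hK) hKS (hcsm α) (hc0 α) α]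
    simp
  · intro α _
    refine integrableOn_of_compact_support hS (isCompact_slice hK) hKS
      (pd_contDiffOn hS α (hcsm α)).continuousOn fun y hy => ?_
    rw [pd_congr_of_eqOn (v := fun _ => 0) (hS.sdiff (isCompact_slice hK).isClosed)
      (fun z hz => hc0 α z hz) hy]
    simp

theorem IsAdapted.integrableOn_density (hT : IsAdapted V T)
    {K : Set (Eu (n + 1))} (hK : IsCompact K) (hKV : K ⊆ V) {f : Eu (n + 1) → ℝ}
    (hf : ContDiffOn ℝ ∞ f V) (hfK : ∀ x ∈ V \ K, f x = 0) :
    IntegrableOn (fun y => density T (ambPt 0 y) * f (ambPt 0 y)) (slice V) :=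
  integrableOn_of_compact_support (isOpen_slice hT.isOpen) (isCompact_slice hK)
    (fun _ hy => hKV hy)
    (contDiffOn_slice ((density_contDiffOn hT.toIsMetricOn).mul hf)).continuousOn
    fun y hy => by rw [hfK _ hy, mul_zero]

/-- The boundary values of `Δ^m` on functions of degree `m - n/2` depend only on the boundary
values.  If `g = 0` on the boundary, self-adjointness shows that `Δ^m g` is orthogonal to
every test function, in particular to its own product with a cutoff function. -/
theorem IsAdapted.lapPow_eq_zero_of_boundary (hT : IsAdapted V T) {m : ℕ} (hm : 1 ≤ m)
    {g : Eu (n + 1) → ℝ} (hg : ContDiffOn ℝ ∞ g V) (hg0 : ∀ x ∈ V, x 0 = 0 → g x = 0)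
    {x : Eu (n + 1)} (hx : x ∈ V) (hx0 : x 0 = 0) :
    lapPow T m ((m : ℝ) - n / 2) g x = 0 := by
  set w : ℝ := (m : ℝ) - n / 2 with hw
  have hV := hT.isOpen
  have hQ := lapPow_contDiffOn hT.toIsMetricOn m w hg
  obtain ⟨y₀, rfl⟩ : ∃ y₀ : Eu n, x = ambPt 0 y₀ := by
    refine ⟨WithLp.toLp 2 fun i => x i.succ, ?_⟩
    ext i
    refine Fin.cases ?_ (fun j => ?_) i
    · simpa using hx0
    · rfl
  obtain ⟨χ, hχs, hχc, hχsm, hχr, hχ1⟩ := exists_contDiff_tsupport_subset (n := ⊤) (hV.mem_nhds hx)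
  set K := tsupport χ with hKdef
  have hχK : ∀ z ∉ K, χ z = 0 := fun z hz => image_eq_zero_of_notMem_tsupport hz
  have hf : ContDiffOn ℝ ∞ (fun z => χ z * lapPow T m w g z) V := hχsm.contDiffOn.mul hQ
  have hint := hT.integral_lapPow_antisymm hm hχc hχs hf hg
    fun z hz => by simp [hχK z hz.2]
  set F : Eu n → ℝ := fun y => density T (ambPt 0 y) *
    (χ (ambPt 0 y) * lapPow T m w g (ambPt 0 y) * lapPow T m w g (ambPt 0 y)) with hF
  have hFint : ∫ y in slice V, F y = 0 := by
    rw [← hint]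
    refine setIntegral_congr_fun (isOpen_slice hV).measurableSet fun y hy => ?_
    simp only [hF, hg0 _ hy (ambPt_zero 0 y)]
    ring
  have hFpos : ∀ y, 0 ≤ F y := fun y => by
    have h1 := (density_pos (T := T) (ambPt 0 y)).le
    have h2 : 0 ≤ χ (ambPt 0 y) := (hχr (Set.mem_range_self _)).1
    rw [hF]
    simp only [mul_assoc]
    exact mul_nonneg h1 (mul_nonneg h2 (mul_self_nonneg _))
  have hFi : IntegrableOn F (slice V) :=
    hT.integrableOn_density hχc hχs (hf.mul hQ) fun z hz => by simp [hχK z hz.2]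
  have hae := (setIntegral_eq_zero_iff_of_nonneg_ae (Filter.Eventually.of_forall hFpos) hFi).1 hFint
  have hcont : ContinuousOn F (slice V) :=
    (contDiffOn_slice ((density_contDiffOn hT.toIsMetricOn).mul (hf.mul hQ))).continuousOn
  have heq := Measure.eqOn_open_of_ae_eq hae (isOpen_slice hV) hcont continuousOn_const
  have h := heq (show y₀ ∈ slice V from hx)
  simp only [hF, hχ1, one_mul, Pi.zero_apply, mul_eq_zero, (density_pos _).ne', false_or,
    or_self] at h
  exact h

end Integration

/-! ### Coordinate frames and connection coefficients -/

section Frames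

variable {n : ℕ} {N : Type*} [TopologicalSpace N] {φ ψ : OpenPartialHomeomorph N (Eu (n + 1))}

/-- The domain, in the coordinates of `φ`, of the transition map to `ψ`. -/
def overlap (φ ψ : OpenPartialHomeomorph N (Eu (n + 1))) : Set (Eu (n + 1)) :=
  φ.target ∩ φ.symm ⁻¹' ψ.source

/-- The transition map between the charts `φ` and `ψ`. -/
def trans (φ ψ : OpenPartialHomeomorph N (Eu (n + 1))) (x : Eu (n + 1)) : Eu (n + 1) :=
  ψ (φ.symm x)

theorem isOpen_overlap : IsOpen (overlap φ ψ) :=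
  φ.isOpen_inter_preimage_symm ψ.open_source

theorem trans_mapsTo : Set.MapsTo (trans φ ψ) (overlap φ ψ) (overlap ψ φ) := by
  intro x hx
  refine ⟨ψ.map_source hx.2, ?_⟩
  simp only [Set.mem_preimage, trans, ψ.left_inv hx.2]
  exact φ.map_target hx.1

theorem symm_trans {x : Eu (n + 1)} (hx : x ∈ overlap φ ψ) :
    ψ.symm (trans φ ψ x) = φ.symm x := ψ.left_inv hx.2

theorem mem_overlap {p : N} (hφp : p ∈ φ.source) (hψp : p ∈ ψ.source) : φ p ∈ overlap φ ψ :=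
  ⟨φ.map_source hφp, by simpa [φ.left_inv hφp] using hψp⟩

variable [ChartedSpace (Eu (n + 1)) N]

theorem contMDiffAt_chart (hφ : φ ∈ smoothCharts n N) {p : N} (hp : p ∈ φ.source) :
    ContMDiffAt 𝓘(ℝ, Eu (n + 1)) 𝓘(ℝ, Eu (n + 1)) ∞ φ p :=
  (contMDiffOn_of_mem_maximalAtlas hφ).contMDiffAt (φ.open_source.mem_nhds hp)

theorem contMDiffAt_chart_symm (hφ : φ ∈ smoothCharts n N) {x : Eu (n + 1)} (hx : x ∈ φ.target) :
    ContMDiffAt 𝓘(ℝ, Eu (n + 1)) 𝓘(ℝ, Eu (n + 1)) ∞ φ.symm x :=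
  (contMDiffOn_symm_of_mem_maximalAtlas hφ).contMDiffAt (φ.open_target.mem_nhds hx)

theorem chart_mdifferentiable (hφ : φ ∈ smoothCharts n N) :
    φ.MDifferentiable 𝓘(ℝ, Eu (n + 1)) 𝓘(ℝ, Eu (n + 1)) :=
  ⟨(contMDiffOn_of_mem_maximalAtlas hφ).mdifferentiableOn (by simp),
    (contMDiffOn_symm_of_mem_maximalAtlas hφ).mdifferentiableOn (by simp)⟩

theorem trans_contDiffOn (hφ : φ ∈ smoothCharts n N) (hψ : ψ ∈ smoothCharts n N) :
    ContDiffOn ℝ ∞ (trans φ ψ) (overlap φ ψ) := by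
  rw [← contMDiffOn_iff_contDiffOn]
  exact (contMDiffOn_of_mem_maximalAtlas hψ).comp
    ((contMDiffOn_symm_of_mem_maximalAtlas hφ).mono Set.inter_subset_left) fun x hx => hx.2

theorem chart_mfderiv_isInvertible (hφ : φ ∈ smoothCharts n N) {p : N} (hp : p ∈ φ.source) :
    (mfderiv 𝓘(ℝ, Eu (n + 1)) 𝓘(ℝ, Eu (n + 1)) φ p).IsInvertible :=
  ⟨(chart_mdifferentiable hφ).mfderiv hp, rfl⟩

theorem mfderiv_injective (hφ : φ ∈ smoothCharts n N) {p : N} (hp : p ∈ φ.source) :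
    Function.Injective (mfderiv 𝓘(ℝ, Eu (n + 1)) 𝓘(ℝ, Eu (n + 1)) φ p) :=
  (chart_mdifferentiable hφ).mfderiv_injective hp

theorem mfderiv_eq_trans (hφ : φ ∈ smoothCharts n N) (hψ : ψ ∈ smoothCharts n N)
    {p : N} (hφp : p ∈ φ.source) (hψp : p ∈ ψ.source) (v : TangentSpace 𝓘(ℝ, Eu (n + 1)) p) :
    mfderiv 𝓘(ℝ, Eu (n + 1)) 𝓘(ℝ, Eu (n + 1)) ψ p v =
      fderiv ℝ (trans φ ψ) (φ p) (mfderiv 𝓘(ℝ, Eu (n + 1)) 𝓘(ℝ, Eu (n + 1)) φ p v) := by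
  have hd : DifferentiableAt ℝ (trans φ ψ) (φ p) :=
    ((trans_contDiffOn hφ hψ).contDiffAt (isOpen_overlap.mem_nhds
      (mem_overlap hφp hψp))).differentiableAt (by simp)
  have h : ψ =ᶠ[𝓝 p] trans φ ψ ∘ φ := by
    filter_upwards [φ.open_source.mem_nhds hφp] with q hq
    simp [trans, φ.left_inv hq]
  rw [h.mfderiv_eq, mfderiv_comp p hd.mdifferentiableAt
    ((chart_mdifferentiable hφ).mdifferentiableAt hφp), mfderiv_eq_fderiv]
  rfl

theorem mfderiv_coordField (hφ : φ ∈ smoothCharts n N) {p : N} (hp : p ∈ φ.source)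
    (i : Fin (n + 1)) : mfderiv 𝓘(ℝ, Eu (n + 1)) 𝓘(ℝ, Eu (n + 1)) φ p (coordField φ i p) =
      (EuclideanSpace.single i (1 : ℝ) : Eu (n + 1)) :=
  (chart_mfderiv_isInvertible hφ hp).self_apply_inverse _

theorem fderiv_apply_eq_jac {Φ : Eu (n + 1) → Eu (n + 1)} {x : Eu (n + 1)}
    (hΦ : DifferentiableAt ℝ Φ x) (v : Eu (n + 1)) (a : Fin (n + 1)) :
    fderiv ℝ Φ x v a = ∑ k, jac Φ x a k * v k := by
  rw [fderiv_apply_coord hΦ, fderiv_eq_sum_pd]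
  exact Finset.sum_congr rfl fun k _ => mul_comm _ _

/-- The coordinate fields of two charts are related by the Jacobian matrix. -/
theorem coordField_eq_sum (hφ : φ ∈ smoothCharts n N) (hψ : ψ ∈ smoothCharts n N)
    {p : N} (hφp : p ∈ φ.source) (hψp : p ∈ ψ.source) (j : Fin (n + 1)) :
    coordField φ j p = ∑ c, jac (trans φ ψ) (φ p) c j • coordField ψ c p := by
  apply mfderiv_injective hψ hψp
  have hd : DifferentiableAt ℝ (trans φ ψ) (φ p) :=
    ((trans_contDiffOn hφ hψ).contDiffAt (isOpen_overlap.mem_nhds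
      (mem_overlap hφp hψp))).differentiableAt (by simp)
  rw [mfderiv_eq_trans hφ hψ hφp hψp, mfderiv_coordField hφ hφp, map_sum]
  simp only [map_smul, mfderiv_coordField hψ hψp]
  refine PiLp.ext fun a => (fderiv_apply_eq_jac hd _ a).trans ?_
  refine Eq.trans ?_ (congrArg (fun v : Eu (n + 1) => v a) (rfl : (∑ c,
    jac (trans φ ψ) (φ p) c j • (EuclideanSpace.single c (1 : ℝ) : Eu (n + 1))) = _))
  simp [Pi.single_apply]

variable [IsManifold 𝓘(ℝ, Eu (n + 1)) ∞ N]

theorem chartAt_mem_smoothCharts (p : N) : chartAt (Eu (n + 1)) p ∈ smoothCharts n N :=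
  IsManifold.chart_mem_maximalAtlas p

theorem coordField_contMDiffAt (hφ : φ ∈ smoothCharts n N) (i : Fin (n + 1)) {p : N}
    (hp : p ∈ φ.source) :
    ContMDiffAt 𝓘(ℝ, Eu (n + 1)) 𝓘(ℝ, Eu (n + 1)).tangent ∞
      (fun q => (⟨q, coordField φ i q⟩ : TangentBundle 𝓘(ℝ, Eu (n + 1)) N)) p := by
  have hV : ContMDiffAt 𝓘(ℝ, Eu (n + 1)) 𝓘(ℝ, Eu (n + 1)).tangent ∞
      (fun y : Eu (n + 1) => (⟨y, (EuclideanSpace.single i (1 : ℝ) : Eu (n + 1))⟩ :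
        TangentBundle 𝓘(ℝ, Eu (n + 1)) (Eu (n + 1)))) (φ p) :=
    contMDiffAt_vectorSpace_iff_contDiffAt.2 contDiffAt_const
  exact hV.mpullback_vectorField_preimage (contMDiffAt_chart hφ hp)
    (chart_mfderiv_isInvertible hφ hp) (by simp)

theorem coordField_mdifferentiableAt (hφ : φ ∈ smoothCharts n N) (i : Fin (n + 1)) {p : N}
    (hp : p ∈ φ.source) :
    MDifferentiableAt 𝓘(ℝ, Eu (n + 1)) 𝓘(ℝ, Eu (n + 1)).tangent
      (fun q => (⟨q, coordField φ i q⟩ : TangentBundle 𝓘(ℝ, Eu (n + 1)) N)) p :=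
  (coordField_contMDiffAt hφ i hp).mdifferentiableAt (by simp)

/-- The connection coefficient `Γ_{ij}^k` as a function on the manifold. -/
def gamAt (cov : Connection n N) (φ : OpenPartialHomeomorph N (Eu (n + 1)))
    (i j k : Fin (n + 1)) (p : N) : ℝ :=
  (EuclideanSpace.proj k : Eu (n + 1) →L[ℝ] ℝ)
    (mfderiv 𝓘(ℝ, Eu (n + 1)) 𝓘(ℝ, Eu (n + 1)) φ p (cov (coordField φ j) p (coordField φ i p)))

theorem gam_eq (cov : Connection n N) (i j k : Fin (n + 1)) (x : Eu (n + 1)) :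
    gam cov φ i j k x = gamAt cov φ i j k (φ.symm x) := rfl

variable (cov : Connection n N)

theorem cov_sum {ι : Type*} (s : Finset ι)
    {σ : ι → ∀ p : N, TangentSpace 𝓘(ℝ, Eu (n + 1)) p} {p : N}
    (hσ : ∀ i ∈ s, MDifferentiableAt 𝓘(ℝ, Eu (n + 1)) 𝓘(ℝ, Eu (n + 1)).tangent
      (fun q => (⟨q, σ i q⟩ : TangentBundle 𝓘(ℝ, Eu (n + 1)) N)) p) :
    cov (∑ i ∈ s, σ i) p = ∑ i ∈ s, cov (σ i) p ∧
      MDifferentiableAt 𝓘(ℝ, Eu (n + 1)) 𝓘(ℝ, Eu (n + 1)).tangent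
        (fun q => (⟨q, (∑ i ∈ s, σ i) q⟩ : TangentBundle 𝓘(ℝ, Eu (n + 1)) N)) p := by
  classical
  induction s using Finset.induction_on with
  | empty =>
    simp only [Finset.sum_empty]
    refine ⟨by simp, Bundle.mdifferentiableAt_zeroSection ..⟩
  | insert a s ha ih =>
    obtain ⟨h1, h2⟩ := ih fun i hi => hσ i (Finset.mem_insert_of_mem hi)
    have h3 := hσ a (Finset.mem_insert_self a s)
    simp only [Finset.sum_insert ha]
    refine ⟨?_, mdifferentiableAt_add_section h3 h2⟩
    rw [cov.isCovariantDerivativeOnUniv.add h3 h2, h1]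

/-- The transformation law of the connection coefficients. -/
theorem gam_trans (hφ : φ ∈ smoothCharts n N) (hψ : ψ ∈ smoothCharts n N)
    {x : Eu (n + 1)} (hx : x ∈ overlap φ ψ) (a i j : Fin (n + 1)) :
    ∑ k, jac (trans φ ψ) x a k * gam cov φ i j k x =
      pd i (fun y => jac (trans φ ψ) y a j) x +
        ∑ b, ∑ c, jac (trans φ ψ) x b i * jac (trans φ ψ) x c j *
          gam cov ψ b c a (trans φ ψ x) := by
  obtain ⟨p, hp⟩ : ∃ p, φ.symm x = p := ⟨_, rfl⟩
  have hφp : p ∈ φ.source := hp ▸ φ.map_target hx.1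
  have hψp : p ∈ ψ.source := hp ▸ hx.2
  have hxp : φ p = x := by rw [← hp, φ.right_inv hx.1]
  have hO := isOpen_overlap (φ := φ) (ψ := ψ)
  have hΦ := trans_contDiffOn hφ hψ
  have hd : DifferentiableAt ℝ (trans φ ψ) (φ p) := by
    rw [hxp]; exact (hΦ.contDiffAt (hO.mem_nhds hx)).differentiableAt (by simp)
  simp only [gam_eq, symm_trans hx, hp]
  set J : Fin (n + 1) → Fin (n + 1) → N → ℝ := fun c j q => jac (trans φ ψ) (φ q) c j with hJ
  have hJd : ∀ c j, MDifferentiableAt 𝓘(ℝ, Eu (n + 1)) 𝓘(ℝ) (J c j) p := by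
    intro c j
    have h1 : DifferentiableAt ℝ (fun y => jac (trans φ ψ) y c j) (φ p) := by
      rw [hxp]; exact differentiableAt_of_smooth hO (jac_contDiffOn hO hΦ c j) hx
    exact h1.mdifferentiableAt.comp p ((chart_mdifferentiable hφ).mdifferentiableAt hφp)
  have hcd := fun c => coordField_mdifferentiableAt hψ c hψp
  have hterm : ∀ c, MDifferentiableAt 𝓘(ℝ, Eu (n + 1)) 𝓘(ℝ, Eu (n + 1)).tangent
      (fun q => (⟨q, (J c j • coordField ψ c) q⟩ : TangentBundle 𝓘(ℝ, Eu (n + 1)) N)) p := fun c =>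
    (hJd c j).smul_section (hcd c)
  obtain ⟨hsum, hsumd⟩ := cov_sum cov Finset.univ (σ := fun c => J c j • coordField ψ c)
    (p := p) fun c _ => hterm c
  have hcongr : cov (coordField φ j) p = ∑ c, cov (J c j • coordField ψ c) p := by
    rw [← hsum]
    refine cov.isCovariantDerivativeOnUniv.congr_of_eventuallyEq
      (coordField_mdifferentiableAt hφ j hφp) hsumd Filter.univ_mem ?_
    filter_upwards [φ.open_source.mem_nhds hφp, ψ.open_source.mem_nhds hψp] with q hq1 hq2
    rw [coordField_eq_sum hφ hψ hq1 hq2 j]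
    simp [hJ]
  have hdJ : ∀ c, mvfderiv 𝓘(ℝ, Eu (n + 1)) (J c j) p (coordField φ i p) =
      pd i (fun y => jac (trans φ ψ) y c j) x := by
    intro c
    have h1 : DifferentiableAt ℝ (fun y => jac (trans φ ψ) y c j) (φ p) := by
      rw [hxp]; exact differentiableAt_of_smooth hO (jac_contDiffOn hO hΦ c j) hx
    have h2 : mfderiv 𝓘(ℝ, Eu (n + 1)) 𝓘(ℝ) (J c j) p =
        (mfderiv 𝓘(ℝ, Eu (n + 1)) 𝓘(ℝ) (fun y => jac (trans φ ψ) y c j) (φ p)).comp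
          (mfderiv 𝓘(ℝ, Eu (n + 1)) 𝓘(ℝ, Eu (n + 1)) φ p) :=
      mfderiv_comp p h1.mdifferentiableAt ((chart_mdifferentiable hφ).mdifferentiableAt hφp)
    have h3 : mfderiv 𝓘(ℝ, Eu (n + 1)) 𝓘(ℝ) (J c j) p (coordField φ i p) =
        fderiv ℝ (fun y => jac (trans φ ψ) y c j) (φ p)
          (mfderiv 𝓘(ℝ, Eu (n + 1)) 𝓘(ℝ, Eu (n + 1)) φ p (coordField φ i p)) := by
      rw [h2, mfderiv_eq_fderiv]; rfl
    rw [mfderiv_coordField hφ hφp, hxp] at h3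
    exact h3
  have hcov : cov (coordField φ j) p (coordField φ i p) =
      ∑ c, ((∑ b, (J c j p * J b i p) • cov (coordField ψ c) p (coordField ψ b p)) +
        pd i (fun y => jac (trans φ ψ) y c j) x • coordField ψ c p) := by
    rw [hcongr, sum_apply]
    refine Finset.sum_congr rfl fun c _ => ?_
    rw [cov.isCovariantDerivativeOnUniv.leibniz (hcd c) (hJd c j)]
    rw [add_apply, ContinuousLinearMap.smulRight_apply, hdJ c]
    congr 1
    rw [smul_apply, coordField_eq_sum hφ hψ hφp hψp i, map_sum,
      Finset.smul_sum]
    refine Finset.sum_congr rfl fun b _ => ?_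
    rw [map_smul, smul_smul]
  have hL : ∑ k, jac (trans φ ψ) x a k * gamAt cov φ i j k p =
      (EuclideanSpace.proj a : Eu (n + 1) →L[ℝ] ℝ)
        (mfderiv 𝓘(ℝ, Eu (n + 1)) 𝓘(ℝ, Eu (n + 1)) ψ p
          (cov (coordField φ j) p (coordField φ i p))) := by
    rw [mfderiv_eq_trans hφ hψ hφp hψp]
    refine Eq.trans ?_ (fderiv_apply_eq_jac hd _ a).symm
    rw [hxp]; rfl
  let Λ : TangentSpace 𝓘(ℝ, Eu (n + 1)) p →L[ℝ] ℝ :=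
    (EuclideanSpace.proj a : Eu (n + 1) →L[ℝ] ℝ).comp
      (mfderiv 𝓘(ℝ, Eu (n + 1)) 𝓘(ℝ, Eu (n + 1)) ψ p)
  have hΛ : ∀ c, Λ (coordField ψ c p) = if a = c then 1 else 0 := by
    intro c
    refine (congrArg (EuclideanSpace.proj a : Eu (n + 1) →L[ℝ] ℝ)
      (mfderiv_coordField hψ hψp c)).trans ?_
    simp
  rw [hL]
  change Λ (cov (coordField φ j) p (coordField φ i p)) = _
  rw [hcov]
  simp only [map_sum, map_add, map_smul, hΛ, smul_eq_mul, mul_ite, mul_one, mul_zero,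
    Finset.sum_add_distrib, Finset.sum_ite_eq, Finset.mem_univ, if_true]
  rw [add_comm, Finset.sum_comm]
  congr 1
  refine Finset.sum_congr rfl fun b _ => Finset.sum_congr rfl fun c _ => ?_
  simp only [hJ, hxp]
  rw [mul_comm (jac (trans φ ψ) x c j)]
  rfl

/-- A torsion-free connection has symmetric coefficients, as coordinate fields commute. -/
theorem gam_symm (htor : cov.torsion = 0) (hφ : φ ∈ smoothCharts n N) {x : Eu (n + 1)}
    (hx : x ∈ φ.target) (i j k : Fin (n + 1)) : gam cov φ i j k x = gam cov φ j i k x := by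
  have hp := φ.map_target hx
  simp only [gam_eq, gamAt]
  have h := cov.torsion_eq_zero_iff.1 htor (coordField_mdifferentiableAt hφ i hp)
    (coordField_mdifferentiableAt hφ j hp)
  have hc : ∀ i : Fin (n + 1), MDifferentiableAt 𝓘(ℝ, Eu (n + 1)) 𝓘(ℝ, Eu (n + 1)).tangent
      (fun y : Eu (n + 1) => (⟨y, (EuclideanSpace.single i (1 : ℝ) : Eu (n + 1))⟩ :
        TangentBundle 𝓘(ℝ, Eu (n + 1)) (Eu (n + 1)))) (φ (φ.symm x)) := fun i =>
    (show ContMDiffAt 𝓘(ℝ, Eu (n + 1)) 𝓘(ℝ, Eu (n + 1)).tangent ∞ _ _ from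
      contMDiffAt_vectorSpace_iff_contDiffAt.2 contDiffAt_const).mdifferentiableAt (by simp)
  have hb : VectorField.mlieBracket 𝓘(ℝ, Eu (n + 1)) (coordField φ i) (coordField φ j)
      (φ.symm x) = 0 := by
    have hle : minSmoothness ℝ 2 ≤ (∞ : ℕ∞ω) := by
      simpa using WithTop.coe_le_coe.2 (le_top : (2 : ℕ∞) ≤ ⊤)
    have : IsManifold 𝓘(ℝ, Eu (n + 1)) (minSmoothness ℝ 2) N := IsManifold.of_le hle
    have := VectorField.mpullback_mlieBracket (hc i) (hc j) (contMDiffAt_chart hφ hp) hle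
    refine this.symm.trans ?_
    have hz : VectorField.mlieBracket 𝓘(ℝ, Eu (n + 1))
        (fun y : Eu (n + 1) => (EuclideanSpace.single i (1 : ℝ) : TangentSpace 𝓘(ℝ, Eu (n + 1)) y))
        (fun y : Eu (n + 1) =>
          (EuclideanSpace.single j (1 : ℝ) : TangentSpace 𝓘(ℝ, Eu (n + 1)) y)) = 0 := by
      have key : ∀ V W : ∀ y : Eu (n + 1), TangentSpace 𝓘(ℝ, Eu (n + 1)) y,
          VectorField.mlieBracket 𝓘(ℝ, Eu (n + 1)) V W =
            VectorField.lieBracketWithin ℝ V W Set.univ :=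
        fun V W => by
          rw [← VectorField.mlieBracketWithin_univ,
            VectorField.mlieBracketWithin_eq_lieBracketWithin]
      refine (key _ _).trans (funext fun y => ?_)
      simp only [VectorField.lieBracketWithin, fderivWithin_fun_const, Pi.zero_apply,
        zero_apply, sub_self]
      rfl
    exact (congrArg (fun W =>
      VectorField.mpullback 𝓘(ℝ, Eu (n + 1)) 𝓘(ℝ, Eu (n + 1)) φ W (φ.symm x)) hz).trans
      (map_zero (mfderiv 𝓘(ℝ, Eu (n + 1)) 𝓘(ℝ, Eu (n + 1)) φ (φ.symm x)).inverse)
  rw [hb, sub_eq_zero] at h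
  rw [h]

/-- The connection coefficients are smooth.  Smoothness of the connection is a statement on global
fields, so that the coordinate field is cut off by a bump function first. -/
theorem gam_contDiffOn [T2Space N] (hcov : CovariantDerivative.ContMDiffCovariantDerivative cov ∞)
    (hφ : φ ∈ smoothCharts n N) (i j k : Fin (n + 1)) :
    ContDiffOn ℝ ∞ (gam cov φ i j k) φ.target := by
  intro x hx
  have hp := φ.map_target hx
  set p := φ.symm x with hpx
  -- a global field that agrees with the coordinate field near `p`
  obtain ⟨f, -, hf⟩ := (SmoothBumpFunction.nhds_basis_tsupport (I := 𝓘(ℝ, Eu (n + 1))) p).mem_iff.1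
    (φ.open_source.mem_nhds hp)
  have hσ : ContMDiff 𝓘(ℝ, Eu (n + 1)) 𝓘(ℝ, Eu (n + 1)).tangent ∞
      (fun q => (⟨q, ((f : N → ℝ) • coordField φ j) q⟩ : TangentBundle 𝓘(ℝ, Eu (n + 1)) N)) :=
    ContMDiffOn.smul_section_of_tsupport f.contMDiff.contMDiffOn φ.open_source hf
      fun q hq => (coordField_contMDiffAt hφ j hq).contMDiffWithinAt
  have h1 := hcov.contMDiff.contMDiff (σ := (f : N → ℝ) • coordField φ j)
    (by simpa using hσ.contMDiffOn)
  have h2 := (h1.contMDiffAt Filter.univ_mem (x := p)).clm_bundle_apply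
    (coordField_contMDiffAt hφ i hp)
  have h3 := (contMDiffOn_of_mem_maximalAtlas hφ).contMDiffOn_tangentMapWithin (m := ∞)
    (by simp) φ.open_source.uniqueMDiffOn
  have h4 := (contMDiff_snd_tangentBundle_modelSpace (Eu (n + 1))
    𝓘(ℝ, Eu (n + 1)) (n := ∞)).contMDiffAt.comp p
    ((h3.contMDiffAt
      ((φ.open_source.preimage (FiberBundle.continuous_proj _ _)).mem_nhds hp)).comp p h2)
  have h5 := ((EuclideanSpace.proj k : Eu (n + 1) →L[ℝ] ℝ).contMDiff.contMDiffAt.comp p h4).comp x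
    (contMDiffAt_chart_symm hφ hx)
  refine (h5.contDiffAt.congr_of_eventuallyEq ?_).contDiffWithinAt
  have hcont : ContinuousAt φ.symm x := φ.continuousAt_symm hx
  have hone : ∀ᶠ q in 𝓝 p, ∀ᶠ q' in 𝓝 q, f q' = 1 := f.eventuallyEq_one.eventuallyEq_nhds
  filter_upwards [φ.open_target.mem_nhds hx, hcont.eventually hone] with y hy hy1
  have hq := φ.map_target hy
  have hc : cov ((f : N → ℝ) • coordField φ j) (φ.symm y) = cov (coordField φ j) (φ.symm y) := by
    refine cov.isCovariantDerivativeOnUniv.congr_of_eventuallyEq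
      (hσ.contMDiffAt.mdifferentiableAt (by simp)) (coordField_mdifferentiableAt hφ j hq)
      Filter.univ_mem ?_
    filter_upwards [hy1] with q' hq'
    simp [hq']
  refine congrArg (EuclideanSpace.proj k : Eu (n + 1) →L[ℝ] ℝ) ?_
  have hm : mfderivWithin 𝓘(ℝ, Eu (n + 1)) 𝓘(ℝ, Eu (n + 1)) φ φ.source (φ.symm y) =
      mfderiv 𝓘(ℝ, Eu (n + 1)) 𝓘(ℝ, Eu (n + 1)) φ (φ.symm y) :=
    mfderivWithin_of_isOpen φ.open_source hq
  refine (congrArg (fun L : TangentSpace 𝓘(ℝ, Eu (n + 1)) (φ.symm y) →L[ℝ]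
      TangentSpace 𝓘(ℝ, Eu (n + 1)) (φ.symm y) =>
    mfderiv 𝓘(ℝ, Eu (n + 1)) 𝓘(ℝ, Eu (n + 1)) φ (φ.symm y)
      (L (coordField φ i (φ.symm y)))) hc).symm.trans ?_
  exact (congrArg (fun L : TangentSpace 𝓘(ℝ, Eu (n + 1)) (φ.symm y) →L[ℝ] Eu (n + 1) =>
    L (cov ((f : N → ℝ) • coordField φ j) (φ.symm y) (coordField φ i (φ.symm y)))) hm).symm

end Frames

/-! ### Tensoriality of the Schouten tensor, the Hessian and the ambient metric -/

section Tensors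

variable {n : ℕ} {N : Type*} [TopologicalSpace N] {φ ψ : OpenPartialHomeomorph N (Eu (n + 1))}
  [ChartedSpace (Eu (n + 1)) N]

theorem comp_symm_contDiffOn (hφ : φ ∈ smoothCharts n N) {f : N → ℝ}
    (hf : ContMDiff 𝓘(ℝ, Eu (n + 1)) 𝓘(ℝ) ∞ f) : ContDiffOn ℝ ∞ (f ∘ φ.symm) φ.target := by
  rw [← contMDiffOn_iff_contDiffOn]
  exact hf.comp_contMDiffOn (contMDiffOn_symm_of_mem_maximalAtlas hφ)

theorem jac_trans_mul (hφ : φ ∈ smoothCharts n N) (hψ : ψ ∈ smoothCharts n N)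
    {x : Eu (n + 1)} (hx : x ∈ overlap φ ψ) :
    jac (trans ψ φ) (trans φ ψ x) * jac (trans φ ψ) x = 1 := by
  have hO := isOpen_overlap (φ := φ) (ψ := ψ)
  have hO' := isOpen_overlap (φ := ψ) (ψ := φ)
  ext a i
  have h := pd_comp_jac hO hO' (trans_contDiffOn hφ hψ) trans_mapsTo
    ((contDiff_coord a).comp_contDiffOn (trans_contDiffOn hψ hφ)) hx i
  rw [pd_congr_of_eqOn (v := fun y => y a) hO (fun y hy => ?_) hx, pd_coord] at h
  · rw [Matrix.mul_apply, Matrix.one_apply, h]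
    exact Finset.sum_congr rfl fun b _ => mul_comm _ _
  · simp only [Function.comp_apply]
    rw [trans, symm_trans hy, φ.right_inv hy.1]

theorem det_jac_trans_ne_zero (hφ : φ ∈ smoothCharts n N) (hψ : ψ ∈ smoothCharts n N)
    {x : Eu (n + 1)} (hx : x ∈ overlap φ ψ) : (jac (trans φ ψ) x).det ≠ 0 := by
  intro h
  have := congrArg Matrix.det (jac_trans_mul hφ hψ hx)
  rw [Matrix.det_mul, h] at this
  simp at this

theorem pd_comp_symm_trans (hφ : φ ∈ smoothCharts n N) (hψ : ψ ∈ smoothCharts n N)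
    {f : N → ℝ} (hf : ContMDiff 𝓘(ℝ, Eu (n + 1)) 𝓘(ℝ) ∞ f)
    {x : Eu (n + 1)} (hx : x ∈ overlap φ ψ) (i : Fin (n + 1)) :
    pd i (f ∘ φ.symm) x =
      ∑ a, jac (trans φ ψ) x a i * pd a (f ∘ ψ.symm) (trans φ ψ x) := by
  have hO := isOpen_overlap (φ := φ) (ψ := ψ)
  rw [← pd_comp_jac hO isOpen_overlap (trans_contDiffOn hφ hψ) trans_mapsTo
    ((comp_symm_contDiffOn hψ hf).mono Set.inter_subset_left) hx i]
  refine pd_congr_of_eqOn hO (fun y hy => ?_) hx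
  simp only [Function.comp_apply, symm_trans hy]

/-- The coordinate frame of a chart, as a basis of the tangent space. -/
def coordBasis (hφ : φ ∈ smoothCharts n N) {p : N} (hp : p ∈ φ.source) :
    Module.Basis (Fin (n + 1)) ℝ (TangentSpace 𝓘(ℝ, Eu (n + 1)) p) :=
  (EuclideanSpace.basisFun (Fin (n + 1)) ℝ).toBasis.map
    ((chart_mdifferentiable hφ).mfderiv hp).symm.toLinearEquiv

theorem coordBasis_apply (hφ : φ ∈ smoothCharts n N) {p : N} (hp : p ∈ φ.source)
    (i : Fin (n + 1)) : coordBasis hφ hp i = coordField φ i p := by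
  apply mfderiv_injective hφ hp
  rw [mfderiv_coordField hφ hp]
  refine (((chart_mdifferentiable hφ).mfderiv hp).apply_symm_apply _).trans ?_
  exact (by simp : (EuclideanSpace.basisFun (Fin (n + 1)) ℝ).toBasis i =
    EuclideanSpace.single i (1 : ℝ))

variable {η : VolumeForm n N}

theorem volCoef_trans (hφ : φ ∈ smoothCharts n N) (hψ : ψ ∈ smoothCharts n N)
    {x : Eu (n + 1)} (hx : x ∈ overlap φ ψ) :
    volCoef η φ x = (jac (trans φ ψ) x).det * volCoef η ψ (trans φ ψ x) := by
  obtain ⟨p, hp⟩ : ∃ p, φ.symm x = p := ⟨_, rfl⟩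
  have hφp : p ∈ φ.source := hp ▸ φ.map_target hx.1
  have hψp : p ∈ ψ.source := hp ▸ hx.2
  have hxp : φ p = x := by rw [← hp, φ.right_inv hx.1]
  have h := (η p).toAlternatingMap.eq_smul_basis_det (coordBasis hψ hψp)
  have h2 := congrArg (fun f : (TangentSpace 𝓘(ℝ, Eu (n + 1)) p) [⋀^Fin (n + 1)]→ₗ[ℝ] ℝ =>
    f fun i => coordField φ i p) h
  have hdet : (coordBasis hψ hψp).det (fun i => coordField φ i p) =
      (jac (trans φ ψ) x).det := by
    rw [Module.Basis.det_apply]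
    congr 1
    ext c j
    rw [Module.Basis.toMatrix_apply, coordField_eq_sum hφ hψ hφp hψp, map_sum]
    simp only [map_smul, ← coordBasis_apply hψ hψp, hxp]
    simp [Finsupp.single_apply]
  have h3 : ∀ (χ : OpenPartialHomeomorph N (Eu (n + 1))) (y : Eu (n + 1)), χ.symm y = p →
      volCoef η χ y = η p fun i => coordField χ i p := by
    rintro χ y rfl
    rfl
  rw [h3 φ x hp, h3 ψ _ ((symm_trans hx).trans hp)]
  refine h2.trans ?_
  rw [AlternatingMap.smul_apply, hdet, smul_eq_mul, mul_comm]
  exact congrArg (fun v => (jac (trans φ ψ) x).det * η p v)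
    (funext fun i => coordBasis_apply hψ hψp i)

variable [IsManifold 𝓘(ℝ, Eu (n + 1)) ∞ N] {cov : Connection n N}

theorem IsProjectiveScale.volCoef_ne_zero (hη : IsProjectiveScale cov η)
    (hφ : φ ∈ smoothCharts n N) {x : Eu (n + 1)} (hx : x ∈ φ.target) : volCoef η φ x ≠ 0 := by
  intro h
  apply hη.ne_zero (φ.symm x)
  have h2 : (η (φ.symm x)).toAlternatingMap = 0 := by
    rw [← AlternatingMap.map_basis_eq_zero_iff (coordBasis hφ (φ.map_target hx))]
    exact (congrArg (η (φ.symm x)).toAlternatingMap (funext fun i =>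
      coordBasis_apply hφ (φ.map_target hx) i)).trans h
  exact ContinuousAlternatingMap.toAlternatingMap_injective h2

/-! #### The curvature as a matrix-valued two-form -/

/-- The connection matrix `(Γ_i)^k_j = Γ_{ij}^k`. -/
def gamM (cov : Connection n N) (φ : OpenPartialHomeomorph N (Eu (n + 1))) (i : Fin (n + 1))
    (x : Eu (n + 1)) : Matrix (Fin (n + 1)) (Fin (n + 1)) ℝ :=
  Matrix.of fun k j => gam cov φ i j k x

/-- The curvature `∂_i A_j - ∂_j A_i + [A_i, A_j]` of a matrix-valued one-form. -/
def curvForm {d k : ℕ} (A : Fin d → Eu d → Matrix (Fin k) (Fin k) ℝ) (i j : Fin d) (x : Eu d) :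
    Matrix (Fin k) (Fin k) ℝ :=
  pdM i (A j) x - pdM j (A i) x + (A i x * A j x - A j x * A i x)

theorem curv_eq_curvForm (i j k l : Fin (n + 1)) (x : Eu (n + 1)) :
    curv cov φ i j k l x = curvForm (gamM cov φ) i j x k l := by
  simp [curv, curvForm, gamM, pdM, Matrix.mul_apply, Finset.sum_sub_distrib]

/-- The curvature of gauge equivalent connection forms is conjugate. -/
theorem curvForm_gauge {d k : ℕ} {V : Set (Eu d)} (hV : IsOpen V)
    {K : Eu d → Matrix (Fin k) (Fin k) ℝ} {A B : Fin d → Eu d → Matrix (Fin k) (Fin k) ℝ}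
    (hK : SmoothMat V K) (hA : ∀ i, SmoothMat V (A i)) (hB : ∀ i, SmoothMat V (B i))
    (h : ∀ i, ∀ x ∈ V, K x * A i x = pdM i K x + B i x * K x) (i j : Fin d) {x : Eu d}
    (hx : x ∈ V) : K x * curvForm A i j x = curvForm B i j x * K x := by
  have hpK : ∀ i, SmoothMat V (pdM i K) := fun i a b => pd_contDiffOn hV i (hK a b)
  have hder : ∀ i j, pdM i K x * A j x + K x * pdM i (A j) x =
      pdM i (pdM j K) x + (pdM i (B j) x * K x + B j x * pdM i K x) := by
    intro i j
    rw [← pdM_mul (hK.differentiableAt hV hx) ((hA j).differentiableAt hV hx),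
      ← pdM_mul ((hB j).differentiableAt hV hx) (hK.differentiableAt hV hx),
      pdM_congr (H := fun y => pdM j K y + B j y * K y)
        (by filter_upwards [hV.mem_nhds hx] with y hy using h j y hy)]
    ext a b
    have hBK : DifferentiableAt ℝ (fun y => (B j y * K y) a b) x := by
      simp only [Matrix.mul_apply]
      exact DifferentiableAt.fun_sum fun c _ =>
        ((hB j).differentiableAt hV hx a c).mul (hK.differentiableAt hV hx c b)
    exact pd_add ((hpK j).differentiableAt hV hx a b) hBK
  have hsym : pdM i (pdM j K) x = pdM j (pdM i K) x := by
    ext a b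
    exact pd_comm hV (hK a b) hx
  have e1 := hder i j
  have e2 := hder j i
  rw [← hsym] at e2
  have hi := h i x hx
  have hj := h j x hx
  have e3 : K x * (A i x * A j x) = pdM i K x * A j x + B i x * (pdM j K x + B j x * K x) := by
    rw [← hj, ← Matrix.mul_assoc, hi]; noncomm_ring
  have e4 : K x * (A j x * A i x) = pdM j K x * A i x + B j x * (pdM i K x + B i x * K x) := by
    rw [← hi, ← Matrix.mul_assoc, hj]; noncomm_ring
  have e5 := eq_sub_of_add_eq' e1
  have e6 := eq_sub_of_add_eq' e2
  simp only [curvForm, mul_add, mul_sub, e5, e6, e3, e4]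
  noncomm_ring

/-- The curvature of the pull-back of a matrix-valued one-form is the pull-back of the
curvature. -/
theorem curvForm_pullback {d d' k : ℕ} {V : Set (Eu d)} (hV : IsOpen V) {V' : Set (Eu d')}
    (hV' : IsOpen V') {Φ : Eu d → Eu d'} (hΦ : ContDiffOn ℝ ∞ Φ V) (hmap : Set.MapsTo Φ V V')
    {A : Fin d' → Eu d' → Matrix (Fin k) (Fin k) ℝ} (hA : ∀ i, SmoothMat V' (A i)) (i j : Fin d)
    {x : Eu d} (hx : x ∈ V) :
    curvForm (fun i y => ∑ b, jac Φ y b i • A b (Φ y)) i j x =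
      ∑ b, ∑ c, (jac Φ x b i * jac Φ x c j) • curvForm A b c (Φ x) := by
  have hpd : ∀ i j, pdM i (fun y => ∑ b, jac Φ y b j • A b (Φ y)) x =
      ∑ c, pd i (fun y => jac Φ y c j) x • A c (Φ x) +
        ∑ b, ∑ c, (jac Φ x b i * jac Φ x c j) • pdM b (A c) (Φ x) := by
    intro i j
    ext p q
    have hAd : ∀ c, DifferentiableAt ℝ (fun y => A c (Φ y) p q) x := fun c =>
      differentiableAt_of_smooth hV ((hA c p q).comp hΦ hmap) hx
    have hJd : ∀ c, DifferentiableAt ℝ (fun y => jac Φ y c j) x := fun c =>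
      differentiableAt_of_smooth hV (jac_contDiffOn hV hΦ c j) hx
    simp only [pdM, Matrix.of_apply, Matrix.sum_apply, Matrix.smul_apply, smul_eq_mul,
      Matrix.add_apply]
    rw [pd_sum (u := fun c y => jac Φ y c j * A c (Φ y) p q) fun c _ => (hJd c).mul (hAd c)]
    rw [Finset.sum_comm, ← Finset.sum_add_distrib]
    refine Finset.sum_congr rfl fun c _ => ?_
    rw [pd_mul (hJd c) (hAd c), pd_comp_jac hV hV' hΦ hmap (b := fun z => A c z p q)
      (hA c p q) hx i,
      Finset.mul_sum]
    congr 1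
    exact Finset.sum_congr rfl fun b _ => by ring
  have hmul : ∀ i j, (∑ b, jac Φ x b i • A b (Φ x)) * (∑ c, jac Φ x c j • A c (Φ x)) =
      ∑ b, ∑ c, (jac Φ x b i * jac Φ x c j) • (A b (Φ x) * A c (Φ x)) := by
    intro i j
    rw [Finset.sum_mul]
    refine Finset.sum_congr rfl fun b _ => ?_
    rw [Finset.mul_sum]
    refine Finset.sum_congr rfl fun c _ => ?_
    rw [Matrix.smul_mul, Matrix.mul_smul, smul_smul]
  have hswap : ∀ F : Fin d' → Fin d' → Matrix (Fin k) (Fin k) ℝ,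
      ∑ b, ∑ c, (jac Φ x b j * jac Φ x c i) • F b c =
        ∑ b, ∑ c, (jac Φ x b i * jac Φ x c j) • F c b := by
    intro F
    rw [Finset.sum_comm]
    exact Finset.sum_congr rfl fun b _ => Finset.sum_congr rfl fun c _ => by rw [mul_comm]
  simp only [curvForm, hpd, hmul, jac_symm hV hΦ hx _ i j]
  rw [hswap, hswap]
  simp only [smul_add, smul_sub, Finset.sum_add_distrib, Finset.sum_sub_distrib]
  abel

section Smooth

variable [T2Space N] (hcov : CovariantDerivative.ContMDiffCovariantDerivative cov ∞)

include hcov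

theorem gamM_smooth (hφ : φ ∈ smoothCharts n N) (i : Fin (n + 1)) :
    SmoothMat φ.target (gamM cov φ i) := fun k j => gam_contDiffOn cov hcov hφ i j k

theorem curv_contDiffOn (hφ : φ ∈ smoothCharts n N) (i j k l : Fin (n + 1)) :
    ContDiffOn ℝ ∞ (curv cov φ i j k l) φ.target := by
  have h := fun i j k => gam_contDiffOn cov hcov hφ i j k
  exact ((pd_contDiffOn φ.open_target i (h j l k)).sub
    (pd_contDiffOn φ.open_target j (h i l k))).add
    (ContDiffOn.sum fun s _ => ((h i s k).mul (h j l s)).sub ((h j s k).mul (h i l s)))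

theorem schouten_contDiffOn (hφ : φ ∈ smoothCharts n N) (i j : Fin (n + 1)) :
    ContDiffOn ℝ ∞ (schouten cov φ i j) φ.target :=
  contDiffOn_const.mul (ContDiffOn.sum fun k _ => curv_contDiffOn hcov hφ k i k j)

theorem hess_contDiffOn (hφ : φ ∈ smoothCharts n N) {f : N → ℝ}
    (hf : ContMDiff 𝓘(ℝ, Eu (n + 1)) 𝓘(ℝ) ∞ f) (i j : Fin (n + 1)) :
    ContDiffOn ℝ ∞ (hess cov φ f i j) φ.target := by
  have h := comp_symm_contDiffOn hφ hf
  have hV := φ.open_target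
  exact (pd_contDiffOn hV i (pd_contDiffOn hV j h)).sub
    (ContDiffOn.sum fun k _ => (gam_contDiffOn cov hcov hφ i j k).mul (pd_contDiffOn hV k h))

theorem tractorHess_smooth (hφ : φ ∈ smoothCharts n N) {ρ : N → ℝ}
    (hρ : ContMDiff 𝓘(ℝ, Eu (n + 1)) 𝓘(ℝ) ∞ ρ) : SmoothMat φ.target (tractorHess cov φ ρ) := by
  have h := comp_symm_contDiffOn hφ hρ
  have hV := φ.open_target
  have h2 : ContDiffOn ℝ ∞ (fun x => 2 * ρ (φ.symm x)) φ.target := contDiffOn_const.mul h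
  intro I J
  refine Fin.cases ?_ (fun i => ?_) I <;> refine Fin.cases ?_ (fun j => ?_) J
  · exact h2
  · exact pd_contDiffOn hV j h
  · exact pd_contDiffOn hV i h
  · exact (hess_contDiffOn hcov hφ hρ i j).add (h2.mul (schouten_contDiffOn hcov hφ i j))

theorem curv_trans (hφ : φ ∈ smoothCharts n N) (hψ : ψ ∈ smoothCharts n N)
    {x : Eu (n + 1)} (hx : x ∈ overlap φ ψ) (i j : Fin (n + 1)) :
    jac (trans φ ψ) x * curvForm (gamM cov φ) i j x =
      (∑ b, ∑ c, (jac (trans φ ψ) x b i * jac (trans φ ψ) x c j) •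
        curvForm (gamM cov ψ) b c (trans φ ψ x)) * jac (trans φ ψ) x := by
  have hO := isOpen_overlap (φ := φ) (ψ := ψ)
  have hΦ := trans_contDiffOn hφ hψ
  have hAψ : ∀ b, SmoothMat (overlap ψ φ) (gamM cov ψ b) := fun b k l =>
    (gamM_smooth hcov hψ b k l).mono Set.inter_subset_left
  rw [← curvForm_pullback hO isOpen_overlap hΦ trans_mapsTo hAψ i j hx]
  refine curvForm_gauge hO (fun a b => jac_contDiffOn hO hΦ a b)
    (fun i a b => (gamM_smooth hcov hφ i a b).mono Set.inter_subset_left) (fun i p q => ?_)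
    (fun i y hy => ?_) i j hx
  · simp only [Matrix.sum_apply, Matrix.smul_apply, smul_eq_mul]
    exact ContDiffOn.sum fun b _ => (jac_contDiffOn hO hΦ b i).mul
      ((hAψ b p q).comp hΦ trans_mapsTo)
  · ext a j
    have h := gam_trans cov hφ hψ hy a i j
    simp only [Matrix.mul_apply, Matrix.add_apply, Matrix.sum_apply, Matrix.smul_apply, gamM,
      Matrix.of_apply, smul_eq_mul, pdM]
    rw [h]
    congr 1
    simp only [Finset.sum_mul]
    rw [Finset.sum_comm]
    exact Finset.sum_congr rfl fun b _ => Finset.sum_congr rfl fun c _ => by ring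

theorem schouten_trans (hφ : φ ∈ smoothCharts n N) (hψ : ψ ∈ smoothCharts n N)
    {x : Eu (n + 1)} (hx : x ∈ overlap φ ψ) (i j : Fin (n + 1)) :
    schouten cov φ i j x = ∑ c, ∑ d, jac (trans φ ψ) x c i * jac (trans φ ψ) x d j *
      schouten cov ψ c d (trans φ ψ x) := by
  set K := jac (trans φ ψ) x with hK
  have hu : IsUnit K.det := isUnit_iff_ne_zero.2 (det_jac_trans_ne_zero hφ hψ hx)
  set F : Fin (n + 1) → Fin (n + 1) → ℝ := fun b a =>
    ∑ c, ∑ d, K c i * K d j * curv cov ψ b c a d (trans φ ψ x) with hF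
  have hcurv : ∀ k, curv cov φ k i k j x = ∑ b, ∑ a, (K b k * K⁻¹ k a) * F b a := by
    intro k
    have h := congrArg (fun M => (K⁻¹ * M) k j) (curv_trans hcov hφ hψ hx k i)
    simp only [← hK] at h
    rw [← Matrix.mul_assoc, Matrix.nonsing_inv_mul _ hu, Matrix.one_mul] at h
    rw [curv_eq_curvForm, h]
    refine Eq.trans ?_ Finset.sum_comm
    simp only [hF, Matrix.mul_apply, Matrix.sum_apply, Matrix.smul_apply, smul_eq_mul,
      curv_eq_curvForm, Finset.sum_mul, Finset.mul_sum]
    exact Finset.sum_congr rfl fun a _ => Finset.sum_congr rfl fun b _ =>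
      Finset.sum_congr rfl fun c _ => Finset.sum_congr rfl fun d _ => by ring
  have hδ : ∀ b a, ∑ k, K b k * K⁻¹ k a = if b = a then 1 else 0 := by
    intro b a
    rw [← Matrix.mul_apply, Matrix.mul_nonsing_inv _ hu, Matrix.one_apply]
  have htr : ∑ k, curv cov φ k i k j x = ∑ b, F b b := by
    simp only [hcurv]
    rw [Finset.sum_comm]
    refine Finset.sum_congr rfl fun b _ => ?_
    rw [Finset.sum_comm]
    simp only [← Finset.sum_mul, hδ]
    simp
  simp only [schouten, htr, hF]
  rw [Finset.sum_comm, Finset.mul_sum]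
  refine Finset.sum_congr rfl fun c _ => ?_
  rw [Finset.sum_comm, Finset.mul_sum]
  refine Finset.sum_congr rfl fun d _ => ?_
  rw [← Finset.mul_sum]
  ring

end Smooth

theorem hess_trans (hφ : φ ∈ smoothCharts n N) (hψ : ψ ∈ smoothCharts n N)
    {f : N → ℝ} (hf : ContMDiff 𝓘(ℝ, Eu (n + 1)) 𝓘(ℝ) ∞ f)
    {x : Eu (n + 1)} (hx : x ∈ overlap φ ψ) (i j : Fin (n + 1)) :
    hess cov φ f i j x = ∑ c, ∑ d, jac (trans φ ψ) x c i * jac (trans φ ψ) x d j *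
      hess cov ψ f c d (trans φ ψ x) := by
  have hO := isOpen_overlap (φ := φ) (ψ := ψ)
  have hO' := isOpen_overlap (φ := ψ) (ψ := φ)
  have hΦ := trans_contDiffOn hφ hψ
  set K := jac (trans φ ψ) x with hK
  have hu : ∀ a, ContDiffOn ℝ ∞ (pd a (f ∘ ψ.symm)) (overlap ψ φ) := fun a =>
    (pd_contDiffOn ψ.open_target a (comp_symm_contDiffOn hψ hf)).mono Set.inter_subset_left
  set u : Fin (n + 1) → ℝ := fun a => pd a (f ∘ ψ.symm) (trans φ ψ x) with hudef
  have h2 : pd i (pd j (f ∘ φ.symm)) x =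
      ∑ a, (pd i (fun y => jac (trans φ ψ) y a j) x * u a +
        K a j * ∑ b, K b i * pd b (pd a (f ∘ ψ.symm)) (trans φ ψ x)) := by
    rw [pd_congr_of_eqOn hO (fun y hy => pd_comp_symm_trans hφ hψ hf hy j) hx]
    have hJd : ∀ c, DifferentiableAt ℝ (fun y => jac (trans φ ψ) y c j) x := fun c =>
      differentiableAt_of_smooth hO (jac_contDiffOn hO hΦ c j) hx
    have hud : ∀ a, DifferentiableAt ℝ (fun y => pd a (f ∘ ψ.symm) (trans φ ψ y)) x := fun a =>
      differentiableAt_of_smooth hO ((hu a).comp hΦ trans_mapsTo) hx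
    rw [pd_sum (u := fun a y => jac (trans φ ψ) y a j * pd a (f ∘ ψ.symm) (trans φ ψ y))
      fun a _ => (hJd a).mul (hud a)]
    refine Finset.sum_congr rfl fun a _ => ?_
    rw [pd_mul (hJd a) (hud a), pd_comp_jac hO hO' hΦ trans_mapsTo (hu a) hx i]
  have h1 : ∑ k, gam cov φ i j k x * pd k (f ∘ φ.symm) x =
      ∑ a, (pd i (fun y => jac (trans φ ψ) y a j) x +
        ∑ b, ∑ c, K b i * K c j * gam cov ψ b c a (trans φ ψ x)) * u a := by
    simp only [pd_comp_symm_trans hφ hψ hf hx, Finset.mul_sum]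
    rw [Finset.sum_comm]
    refine Finset.sum_congr rfl fun a _ => ?_
    rw [← gam_trans cov hφ hψ hx a i j, Finset.sum_mul]
    exact Finset.sum_congr rfl fun k _ => by ring
  have h3 : ∑ a, K a j * ∑ b, K b i * pd b (pd a (f ∘ ψ.symm)) (trans φ ψ x) =
      ∑ c, ∑ d, K c i * K d j * pd c (pd d (f ∘ ψ.symm)) (trans φ ψ x) := by
    simp only [Finset.mul_sum]
    rw [Finset.sum_comm]
    exact Finset.sum_congr rfl fun c _ => Finset.sum_congr rfl fun d _ => by ring
  have h4 : ∑ a, (∑ b, ∑ c, K b i * K c j * gam cov ψ b c a (trans φ ψ x)) * u a =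
      ∑ c, ∑ d, K c i * K d j * ∑ k, gam cov ψ c d k (trans φ ψ x) * u k := by
    simp only [Finset.mul_sum, Finset.sum_mul]
    rw [Finset.sum_comm]
    refine Finset.sum_congr rfl fun b _ => ?_
    rw [Finset.sum_comm]
    exact Finset.sum_congr rfl fun c _ => Finset.sum_congr rfl fun d _ => by ring
  rw [hess, h2, h1]
  simp only [hess, Finset.sum_add_distrib, add_mul, mul_sub, Finset.sum_sub_distrib, h3, h4]
  ring

section Symmetric

variable (htor : cov.torsion = 0)

include htor

theorem hess_symm (hφ : φ ∈ smoothCharts n N)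
    {f : N → ℝ} (hf : ContMDiff 𝓘(ℝ, Eu (n + 1)) 𝓘(ℝ) ∞ f) {x : Eu (n + 1)} (hx : x ∈ φ.target)
    (i j : Fin (n + 1)) : hess cov φ f i j x = hess cov φ f j i x := by
  simp only [hess, pd_comm φ.open_target (comp_symm_contDiffOn hφ hf) hx (A := i) (B := j),
    gam_symm cov htor hφ hx i j]

/-- The Ricci tensor of a torsion-free connection with a parallel volume form is symmetric. -/
theorem schouten_symm [T2Space N] (hcov : CovariantDerivative.ContMDiffCovariantDerivative cov ∞)
    (hη : IsProjectiveScale cov η) (hφ : φ ∈ smoothCharts n N) {x : Eu (n + 1)}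
    (hx : x ∈ φ.target) (i j : Fin (n + 1)) : schouten cov φ i j x = schouten cov φ j i x := by
  have hV := φ.open_target
  have hsm := fun i j k => gam_contDiffOn cov hcov hφ i j k
  have hs := fun {y} (hy : y ∈ φ.target) i j k => gam_symm cov htor hφ hy i j k
  -- the traces `Γ_{ki}^k` are the logarithmic derivatives of the coefficient of `η`, so that
  -- they form a closed one-form
  have htrace : ∀ i j, pd i (fun y => ∑ k, gam cov φ k j k y) x =
      pd j (fun y => ∑ k, gam cov φ k i k y) x := by
    set G : Fin (n + 1) → Eu (n + 1) → ℝ := fun j y => ∑ k, gam cov φ k j k y with hG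
    have hGsm : ∀ j, ContDiffOn ℝ ∞ (G j) φ.target := fun j =>
      ContDiffOn.sum fun k _ => hsm k j k
    have hGη : ∀ j, ∀ y ∈ φ.target, pd j (volCoef η φ) y = G j y * volCoef η φ y := by
      intro j y hy
      rw [hη.parallel φ hφ y hy j]
      congr 1
      exact Finset.sum_congr rfl fun k _ => hs hy j k k
    have h2 : ∀ i j, pd i (pd j (volCoef η φ)) x =
        pd i (G j) x * volCoef η φ x + G j x * (G i x * volCoef η φ x) := by
      intro i j
      rw [pd_congr_of_eqOn hV (hGη j) hx, pd_mul (differentiableAt_of_smooth hV (hGsm j) hx)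
        (differentiableAt_of_smooth hV (hη.smooth φ hφ) hx), hGη i x hx]
    intro i j
    have h3 := pd_comm hV (hη.smooth φ hφ) hx (A := i) (B := j)
    rw [h2, h2] at h3
    exact mul_right_cancel₀ (hη.volCoef_ne_zero hφ hx) (by linarith)
  have hpd : ∀ i j, ∑ k, pd i (gam cov φ k j k) x = pd i (fun y => ∑ k, gam cov φ k j k y) x :=
    fun i j => (pd_sum (u := fun k => gam cov φ k j k) fun k _ =>
      differentiableAt_of_smooth hV (hsm k j k) hx).symm
  have hexp : ∀ i j, ∑ k, curv cov φ k i k j x =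
      ∑ k, pd k (gam cov φ i j k) x - pd i (fun y => ∑ k, gam cov φ k j k y) x +
        (∑ k, ∑ s, gam cov φ k s k x * gam cov φ i j s x -
          ∑ k, ∑ s, gam cov φ i s k x * gam cov φ k j s x) := by
    intro i j
    simp only [curv, Finset.sum_add_distrib, Finset.sum_sub_distrib, hpd]
  have hpds : ∀ k, pd k (gam cov φ i j k) x = pd k (gam cov φ j i k) x := fun k =>
    pd_congr_of_eqOn hV (fun y hy => hs hy i j k) hx
  have hquad : ∑ k, ∑ s, gam cov φ i s k x * gam cov φ k j s x =
      ∑ k, ∑ s, gam cov φ j s k x * gam cov φ k i s x := by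
    rw [Finset.sum_comm]
    refine Finset.sum_congr rfl fun k _ => Finset.sum_congr rfl fun s _ => ?_
    rw [hs hx i k s, hs hx s j k, mul_comm]
  simp only [schouten, hexp, hpds, htrace i j, hquad, hs hx i j]

end Symmetric

/-! #### The ambient metric -/

/-- The ambient metric is a tensor on the bundle of tractors. -/
theorem tractorHess_trans [T2Space N]
    (hcov : CovariantDerivative.ContMDiffCovariantDerivative cov ∞) (hφ : φ ∈ smoothCharts n N)
    (hψ : ψ ∈ smoothCharts n N) {ρ : N → ℝ} (hρ : ContMDiff 𝓘(ℝ, Eu (n + 1)) 𝓘(ℝ) ∞ ρ)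
    {x : Eu (n + 1)} (hx : x ∈ overlap φ ψ) :
    tractorHess cov φ ρ x = (hat (jac (trans φ ψ) x)).transpose *
      tractorHess cov ψ ρ (trans φ ψ x) * hat (jac (trans φ ψ) x) := by
  have e00 : ∀ (χ : OpenPartialHomeomorph N (Eu (n + 1))) y,
    tractorHess cov χ ρ y 0 0 = 2 * ρ (χ.symm y) := fun _ _ => rfl
  have e0 : ∀ (χ : OpenPartialHomeomorph N (Eu (n + 1))) y (j : Fin (n + 1)),
    tractorHess cov χ ρ y 0 j.succ = pd j (ρ ∘ χ.symm) y := fun _ _ _ => rfl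
  have e1 : ∀ (χ : OpenPartialHomeomorph N (Eu (n + 1))) y (i : Fin (n + 1)),
    tractorHess cov χ ρ y i.succ 0 = pd i (ρ ∘ χ.symm) y := fun _ _ _ => rfl
  have e2 : ∀ (χ : OpenPartialHomeomorph N (Eu (n + 1))) y (i j : Fin (n + 1)),
    tractorHess cov χ ρ y i.succ j.succ =
      hess cov χ ρ i j y + 2 * ρ (χ.symm y) * schouten cov χ i j y := fun _ _ _ _ => rfl
  ext I J
  simp only [Matrix.mul_apply, Matrix.transpose_apply]
  rw [Fin.sum_univ_succ]
  refine Fin.cases ?_ (fun i => ?_) I <;> refine Fin.cases ?_ (fun j => ?_) J <;>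
    simp only [Fin.sum_univ_succ (n := n + 1), hat_zero_zero, hat_zero_succ, hat_succ_zero,
      hat_succ_succ, e00, e0, e1, e2, one_mul, zero_mul, mul_one, mul_zero, add_zero, zero_add,
      Finset.sum_const_zero, symm_trans hx]
  · rw [pd_comp_symm_trans hφ hψ hρ hx]
    exact Finset.sum_congr rfl fun a _ => mul_comm _ _
  · rw [pd_comp_symm_trans hφ hψ hρ hx]
  · rw [hess_trans hφ hψ hρ hx, schouten_trans hcov hφ hψ hx]
    simp only [Finset.mul_sum, Finset.sum_mul, ← Finset.sum_add_distrib]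
    rw [Finset.sum_comm]
    exact Finset.sum_congr rfl fun d _ => Finset.sum_congr rfl fun c _ => by ring

theorem tractorHess_isSymm [T2Space N] (htor : cov.torsion = 0)
    (hcov : CovariantDerivative.ContMDiffCovariantDerivative cov ∞)
    (hη : IsProjectiveScale cov η) (hφ : φ ∈ smoothCharts n N) {ρ : N → ℝ}
    (hρ : ContMDiff 𝓘(ℝ, Eu (n + 1)) 𝓘(ℝ) ∞ ρ) {x : Eu (n + 1)} (hx : x ∈ φ.target) :
    (tractorHess cov φ ρ x).IsSymm := by
  ext I J
  refine Fin.cases ?_ (fun i => ?_) I <;> refine Fin.cases ?_ (fun j => ?_) J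
  · rfl
  · rfl
  · rfl
  · change hess cov φ ρ j i x + 2 * ρ (φ.symm x) * schouten cov φ j i x =
      hess cov φ ρ i j x + 2 * ρ (φ.symm x) * schouten cov φ i j x
    rw [hess_symm htor hφ hρ hx, schouten_symm htor hcov hη hφ hx]

theorem mongeAmpere_eq [T2Space N] (hcov : CovariantDerivative.ContMDiffCovariantDerivative cov ∞)
    (hφ : φ ∈ smoothCharts n N) {ρ : N → ℝ} (hρ : ContMDiff 𝓘(ℝ, Eu (n + 1)) 𝓘(ℝ) ∞ ρ)
    {p : N} (hp : p ∈ φ.source) :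
    mongeAmpere cov η ρ p = (tractorHess cov φ ρ (φ p)).det / volCoef η φ (φ p) ^ 2 := by
  have hψ := chartAt_mem_smoothCharts (n := n) p
  have hx := mem_overlap (mem_chart_source (Eu (n + 1)) p) hp
  have hJ := det_jac_trans_ne_zero hψ hφ hx
  rw [mongeAmpere, tractorHess_trans hcov hψ hφ hρ hx, volCoef_trans hψ hφ hx, Matrix.det_mul,
    Matrix.det_mul, Matrix.det_transpose, det_hat]
  have ht : trans (chartAt (Eu (n + 1)) p) φ (chartAt (Eu (n + 1)) p p) = φ p := by
    rw [trans, (chartAt (Eu (n + 1)) p).left_inv (mem_chart_source _ p)]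
  rw [ht]
  field_simp

/-- The coordinates of the points of a chart at which the ambient metric is nondegenerate. -/
def regularSet (cov : Connection n N) (φ : OpenPartialHomeomorph N (Eu (n + 1))) (ρ : N → ℝ) :
    Set (Eu (n + 1)) :=
  {x ∈ φ.target | (tractorHess cov φ ρ x).det ≠ 0}

theorem isMetricOn_regularSet [T2Space N] (htor : cov.torsion = 0)
    (hcov : CovariantDerivative.ContMDiffCovariantDerivative cov ∞)
    (hη : IsProjectiveScale cov η) (hφ : φ ∈ smoothCharts n N) {ρ : N → ℝ}
    (hρ : ContMDiff 𝓘(ℝ, Eu (n + 1)) 𝓘(ℝ) ∞ ρ) :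
    IsMetricOn (regularSet cov φ ρ) (tractorHess cov φ ρ) where
  isOpen := (tractorHess_smooth hcov hφ hρ).det.continuousOn.isOpen_inter_preimage φ.open_target
    isOpen_compl_singleton
  smooth := fun A B => (tractorHess_smooth hcov hφ hρ A B).mono fun _ hx => hx.1
  det_ne_zero := fun _ hx => hx.2
  isSymm := fun _ hx => tractorHess_isSymm htor hcov hη hφ hρ hx.1

/-- The powers of the ambient Laplacian may be computed in any chart. -/
theorem ambientLapPow_eq_lapPow [T2Space N] (htor : cov.torsion = 0)
    (hcov : CovariantDerivative.ContMDiffCovariantDerivative cov ∞)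
    (hη : IsProjectiveScale cov η) (hφ : φ ∈ smoothCharts n N) {ρ : N → ℝ}
    (hρ : ContMDiff 𝓘(ℝ, Eu (n + 1)) 𝓘(ℝ) ∞ ρ) {p : N} (hp : p ∈ φ.source)
    (hdet : mongeAmpere cov η ρ p ≠ 0) (m : ℕ) (w : ℝ) {F : N → ℝ}
    (hF : ContMDiff 𝓘(ℝ, Eu (n + 1)) 𝓘(ℝ) ∞ F) :
    ambientLapPow cov ρ m w F p = lapPow (tractorHess cov φ ρ) m w (F ∘ φ.symm) (φ p) := by
  set ψ := chartAt (Eu (n + 1)) p with hψdef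
  have hψ : ψ ∈ smoothCharts n N := chartAt_mem_smoothCharts p
  have hψp : p ∈ ψ.source := mem_chart_source (Eu (n + 1)) p
  have hTψ := isMetricOn_regularSet htor hcov hη hψ hρ
  have hTφ := isMetricOn_regularSet htor hcov hη hφ hρ
  have hreg : ∀ {χ : OpenPartialHomeomorph N (Eu (n + 1))}, χ ∈ smoothCharts n N →
      p ∈ χ.source → χ p ∈ regularSet cov χ ρ := by
    intro χ hχ hpχ
    refine ⟨χ.map_source hpχ, fun h => hdet ?_⟩
    rw [mongeAmpere_eq hcov hχ hρ hpχ, h, zero_div]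
  have hx := hreg hψ hψp
  have hFψ := (comp_symm_contDiffOn hψ hF).mono (fun _ hx => hx.1 : regularSet cov ψ ρ ⊆ ψ.target)
  have hFφ := (comp_symm_contDiffOn hφ hF).mono (fun _ hx => hx.1 : regularSet cov φ ρ ⊆ φ.target)
  have h1 : ambientLapPow cov ρ m w F p =
      lapPow (tractorHess cov ψ ρ) m w (F ∘ ψ.symm) (ψ p) := by
    refine (iterate_laplacian_homog hTψ m w hFψ (ambPt 1 (ψ p)) ⟨?_, hx⟩).trans ?_
    · simp
    · simp only [homog, ambPt_zero, Real.one_rpow, one_mul]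
      rfl
  rw [h1]
  -- the part of the overlap on which the metric is nondegenerate
  set W : Set (Eu (n + 1)) := regularSet cov ψ ρ ∩ overlap ψ φ with hW
  have hWo : IsOpen W := hTψ.isOpen.inter isOpen_overlap
  have hmap : Set.MapsTo (trans ψ φ) W (regularSet cov φ ρ) := by
    rintro y ⟨hy, hyo⟩
    refine ⟨(trans_mapsTo hyo).1, fun h => hy.2 ?_⟩
    rw [tractorHess_trans hcov hψ hφ hρ hyo, Matrix.det_mul, Matrix.det_mul, h]
    simp
  have hxW : ψ p ∈ W := ⟨hx, mem_overlap hψp hp⟩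
  have h2 := lapPow_comp (hTψ.mono hWo Set.inter_subset_left) hTφ
    ((trans_contDiffOn hψ hφ).mono Set.inter_subset_right) hmap
    (fun y hy => tractorHess_trans hcov hψ hφ hρ hy.2) w m hFφ hxW
  have h3 := lapPow_congr (T := tractorHess cov ψ ρ) (w := w) (b := F ∘ ψ.symm)
    (b' := fun y => (F ∘ φ.symm) (trans ψ φ y)) hWo m
    (fun y hy => by simp only [Function.comp_apply, symm_trans hy.2]) hxW
  rw [h3, h2]
  simp only [trans, ψ.left_inv hψp]

end Tensors

/-! ### Charts adapted to a defining function -/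

section AdaptedCharts

variable {n : ℕ} {N : Type*} [TopologicalSpace N] {φ ψ : OpenPartialHomeomorph N (Eu (n + 1))}
  [ChartedSpace (Eu (n + 1)) N]

/-- Adapted charts: smooth charts with `ρ = x⁰`. -/
def adaptedCharts (n : ℕ) {N : Type*} [TopologicalSpace N] [ChartedSpace (Eu (n + 1)) N]
    (ρ : N → ℝ) : Set (OpenPartialHomeomorph N (Eu (n + 1))) :=
  {φ | φ ∈ smoothCharts n N ∧ ∀ x ∈ φ.target, ρ (φ.symm x) = x 0}

theorem exists_pd_ne_zero (hφ : φ ∈ smoothCharts n N) {ρ : N → ℝ}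
    (hρ : ContMDiff 𝓘(ℝ, Eu (n + 1)) 𝓘(ℝ) ∞ ρ) {p : N} (hp : p ∈ φ.source)
    (hd : mfderiv 𝓘(ℝ, Eu (n + 1)) 𝓘(ℝ) ρ p ≠ 0) : ∃ i, pd i (ρ ∘ φ.symm) (φ p) ≠ 0 := by
  by_contra! h
  apply hd
  have hu : DifferentiableAt ℝ (ρ ∘ φ.symm) (φ p) :=
    differentiableAt_of_smooth φ.open_target (comp_symm_contDiffOn hφ hρ) (φ.map_source hp)
  have h0 : fderiv ℝ (ρ ∘ φ.symm) (φ p) = 0 := by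
    ext v
    rw [fderiv_eq_sum_pd]
    simp [h]
  have he : ρ =ᶠ[𝓝 p] (ρ ∘ φ.symm) ∘ φ := by
    filter_upwards [φ.open_source.mem_nhds hp] with q hq
    simp [φ.left_inv hq]
  rw [he.mfderiv_eq, mfderiv_comp p hu.mdifferentiableAt
    ((chart_mdifferentiable hφ).mdifferentiableAt hp), mfderiv_eq_fderiv, h0]
  exact ContinuousLinearMap.zero_comp _

/-- The map that replaces the `i`-th coordinate by the function `u`, which becomes the coordinate
number `0`. -/
def straighten (u : Eu (n + 1) → ℝ) (i : Fin (n + 1)) (x : Eu (n + 1)) : Eu (n + 1) :=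
  WithLp.toLp 2 fun j => if j = 0 then u x else x (Equiv.swap 0 i j)

theorem straighten_contDiffOn {u : Eu (n + 1) → ℝ} {V : Set (Eu (n + 1))}
    (hu : ContDiffOn ℝ ∞ u V) (i : Fin (n + 1)) : ContDiffOn ℝ ∞ (straighten u i) V := by
  rw [contDiffOn_euclidean]
  intro j
  by_cases hj : j = 0
  · simpa [straighten, hj] using hu
  · simpa [straighten, hj] using (contDiff_coord (Equiv.swap 0 i j)).contDiffOn

theorem exists_hasFDerivAt_straighten {u : Eu (n + 1) → ℝ} {V : Set (Eu (n + 1))} (hV : IsOpen V)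
    (hu : ContDiffOn ℝ ∞ u V) {i : Fin (n + 1)} {x : Eu (n + 1)} (hx : x ∈ V)
    (hi : pd i u x ≠ 0) :
    ∃ L : Eu (n + 1) ≃L[ℝ] Eu (n + 1),
      HasFDerivAt (straighten u i) (L : Eu (n + 1) →L[ℝ] Eu (n + 1)) x := by
  have hd : DifferentiableAt ℝ (straighten u i) x :=
    ((straighten_contDiffOn hu i).contDiffAt (hV.mem_nhds hx)).differentiableAt (by simp)
  have hinj : Function.Injective (fderiv ℝ (straighten u i) x : Eu (n + 1) →ₗ[ℝ] Eu (n + 1)) := by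
    refine (injective_iff_map_eq_zero _).2 fun v hv => ?_
    have hc : ∀ j, fderiv ℝ (fun y => straighten u i y j) x v = 0 := fun j => by
      rw [← fderiv_apply_coord hd]
      exact congrArg (fun w : Eu (n + 1) => w j) hv
    have hne : ∀ k, k ≠ i → v k = 0 := by
      intro k hk
      have hj : Equiv.swap 0 i k ≠ 0 := by
        rw [Ne, Equiv.swap_apply_eq_iff, Equiv.swap_apply_left]
        exact hk
      have h := hc (Equiv.swap 0 i k)
      simp only [straighten, hj, if_false, Equiv.swap_apply_self, fderiv_eq_sum_pd, pd_coord] at h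
      simpa using h
    have h0 := hc 0
    simp only [straighten, if_true, fderiv_eq_sum_pd] at h0
    rw [Finset.sum_eq_single i (fun k _ hk => by rw [hne k hk, zero_mul]) (by simp)] at h0
    ext k
    by_cases hk : k = i
    · subst hk
      simpa [hi] using h0
    · exact hne k hk
  exact ⟨(LinearEquiv.ofInjectiveEndo _ hinj).toContinuousLinearEquiv, hd.hasFDerivAt⟩

/-- At a point where `dρ ≠ 0`, the function `ρ` is the coordinate `x⁰` of some chart, by the inverse
function theorem. -/
theorem exists_adaptedChart [IsManifold 𝓘(ℝ, Eu (n + 1)) ∞ N] {ρ : N → ℝ}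
    (hρ : ContMDiff 𝓘(ℝ, Eu (n + 1)) 𝓘(ℝ) ∞ ρ) {p : N}
    (hd : mfderiv 𝓘(ℝ, Eu (n + 1)) 𝓘(ℝ) ρ p ≠ 0) : ∃ φ ∈ adaptedCharts n ρ, p ∈ φ.source := by
  set ψ := chartAt (Eu (n + 1)) p
  have hψ : ψ ∈ smoothCharts n N := chartAt_mem_smoothCharts p
  have hp : p ∈ ψ.source := mem_chart_source _ p
  obtain ⟨i, hi⟩ := exists_pd_ne_zero hψ hρ hp hd
  set u := ρ ∘ ψ.symm with hu
  have husm : ContDiffOn ℝ ∞ u ψ.target := comp_symm_contDiffOn hψ hρ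
  set Θ := straighten u i with hΘ
  have hΘsm := straighten_contDiffOn husm i
  set W : Set (Eu (n + 1)) := ψ.target ∩ pd i u ⁻¹' {0}ᶜ with hW
  have hWo : IsOpen W := (pd_contDiffOn ψ.open_target i husm).continuousOn.isOpen_inter_preimage
    ψ.open_target isOpen_compl_singleton
  have hΘat : ∀ x ∈ W, ContDiffAt ℝ ∞ Θ x := fun x hx =>
    hΘsm.contDiffAt (ψ.open_target.mem_nhds hx.1)
  have hL : ∀ x ∈ W, ∃ L : Eu (n + 1) ≃L[ℝ] Eu (n + 1),
      HasFDerivAt Θ (L : Eu (n + 1) →L[ℝ] Eu (n + 1)) x := fun x hx =>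
    exists_hasFDerivAt_straighten ψ.open_target husm hx.1 hx.2
  have hpW : ψ p ∈ W := ⟨ψ.map_source hp, hi⟩
  obtain ⟨L, hLp⟩ := hL _ hpW
  set e := ((hΘat _ hpW).toOpenPartialHomeomorph Θ hLp (by simp)).restrOpen W hWo with he
  have hes : e.source ⊆ W := fun x hx => hx.2
  have hcoe : ∀ x, e x = Θ x := fun x => rfl
  have hesm : ContDiffOn ℝ ∞ e e.source := fun x hx =>
    (hΘat x (hes hx)).contDiffWithinAt
  have hesymm : ContDiffOn ℝ ∞ e.symm e.target := by
    intro y hy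
    obtain ⟨L', hL'⟩ := hL _ (hes (e.map_target hy))
    exact (e.contDiffAt_symm hy hL' (hΘat _ (hes (e.map_target hy)))).contDiffWithinAt
  refine ⟨ψ.trans e, ⟨?_, ?_⟩, ?_⟩
  · refine OpenPartialHomeomorph.mem_maximalAtlas_of_contMDiffOn _ ?_ ?_
    · rw [OpenPartialHomeomorph.coe_trans, OpenPartialHomeomorph.trans_source]
      exact (contMDiffOn_iff_contDiffOn.2 hesm).comp
        ((contMDiffOn_of_mem_maximalAtlas hψ).mono Set.inter_subset_left) fun q hq => hq.2
    · rw [OpenPartialHomeomorph.trans_target, OpenPartialHomeomorph.coe_trans_symm]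
      exact (contMDiffOn_symm_of_mem_maximalAtlas hψ).comp
        ((contMDiffOn_iff_contDiffOn.2 hesymm).mono Set.inter_subset_left) fun q hq => hq.2
  · intro x hx
    rw [OpenPartialHomeomorph.trans_target] at hx
    have h := congrArg (fun v : Eu (n + 1) => v 0) (e.right_inv hx.1)
    simpa [hcoe, hΘ, straighten, hu] using h
  · rw [OpenPartialHomeomorph.trans_source]
    exact ⟨hp, (hΘat _ hpW).mem_toOpenPartialHomeomorph_source hLp (by simp), hpW⟩

theorem IsDefining.eq_zero_of_mem_frontier (hρ : IsDefining (n := n) Ω ρ) {p : N}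
    (hp : p ∈ frontier Ω) : ρ p = 0 := by
  rw [hρ.neg] at hp
  exact frontier_lt_subset_eq hρ.smooth.continuous continuous_const hp

end AdaptedCharts

/-! ### The affine metric in boundary charts -/

theorem det_of_border {k : ℕ}
    (T : Matrix (Fin (k + 2)) (Fin (k + 2)) ℝ) (r : ℝ) (h00 : T 0 0 = 0)
    (h01 : T 0 (Fin.succ 0) = r) (h0 : ∀ α : Fin k, T 0 α.succ.succ = 0)
    (h10 : T (Fin.succ 0) 0 = r) (h1 : ∀ α : Fin k, T α.succ.succ 0 = 0) :
    T.det = -(r ^ 2 * (T.submatrix (fun α : Fin k => α.succ.succ)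
      (fun α : Fin k => α.succ.succ)).det) := by
  rw [Matrix.det_succ_row_zero, Fin.sum_univ_succ, h00, Fin.sum_univ_succ]
  simp only [h0, h01]
  set S := T.submatrix Fin.succ (Fin.succ (0 : Fin (k + 1))).succAbove with hS
  have e0 : S 0 0 = r := h10
  have e1 : ∀ α : Fin k, S α.succ 0 = 0 := h1
  have e2 : S.submatrix (Fin.succAbove 0) Fin.succ =
      T.submatrix (fun α : Fin k => α.succ.succ) (fun α : Fin k => α.succ.succ) := by
    ext α β
    rfl
  have e3 : S.det = r * (T.submatrix (fun α : Fin k => α.succ.succ)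
      (fun α : Fin k => α.succ.succ)).det := by
    rw [Matrix.det_succ_column_zero, Fin.sum_univ_succ, e0, e2]
    simp [e1]
  rw [e3]
  simp
  ring

section Boundary

variable {n : ℕ} {N : Type*} [TopologicalSpace N] {φ ψ : OpenPartialHomeomorph N (Eu (n + 1))}
  [ChartedSpace (Eu (n + 1)) N] [IsManifold 𝓘(ℝ, Eu (n + 1)) ∞ N]

/-- The setting of the argument: `∇` is a smooth torsion-free connection with the parallel volume
form `η`, and `τ² ρ` is a defining density of the open set `Ω` with `𝒥[ρ] = -1` on `M = ∂Ω`. -/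
structure IsNormalized (cov : Connection n N) (η : VolumeForm n N) (Ω : Set N) (ρ : N → ℝ) :
    Prop where
  smooth : CovariantDerivative.ContMDiffCovariantDerivative cov ∞
  torsion : cov.torsion = 0
  scale : IsProjectiveScale cov η
  isOpen : IsOpen Ω
  defining : IsDefining (n := n) Ω ρ
  mongeAmpere : ∀ p ∈ frontier Ω, mongeAmpere cov η ρ p = -1

variable {cov : Connection n N} {η : VolumeForm n N} {Ω : Set N} {ρ : N → ℝ}

namespace IsNormalized

theorem mem_iff (H : IsNormalized cov η Ω ρ) {p : N} : p ∈ Ω ↔ ρ p < 0 := by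
  conv_lhs => rw [H.defining.neg]
  rfl

theorem eq_zero_of_mem_frontier (H : IsNormalized cov η Ω ρ) {p : N} (hp : p ∈ frontier Ω) :
    ρ p = 0 :=
  H.defining.eq_zero_of_mem_frontier hp

theorem adaptedChart_mem_boundaryCharts (H : IsNormalized cov η Ω ρ)
    (hφ : φ ∈ adaptedCharts n ρ) : φ ∈ boundaryCharts (n := n) Ω := by
  refine ⟨hφ.1, fun x hx => ⟨by rw [H.mem_iff, hφ.2 x hx], ?_⟩⟩
  refine ⟨fun h => by rw [← hφ.2 x hx]; exact H.eq_zero_of_mem_frontier h, fun h => ?_⟩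
  rw [H.isOpen.frontier_eq]
  refine ⟨?_, fun hΩ => by rw [H.mem_iff, hφ.2 x hx, h] at hΩ; exact lt_irrefl _ hΩ⟩
  -- the points `x + t e₀` with `t < 0` lie in `Ω`
  have hcl : x ∈ closure (φ.target ∩ {y | y 0 < 0}) := by
    refine φ.open_target.inter_closure ⟨hx, ?_⟩
    have hlim : Filter.Tendsto
        (fun t : ℝ => x + t • (EuclideanSpace.single 0 (1 : ℝ) : Eu (n + 1))) (𝓝[<] 0) (𝓝 x) := by
      have : Continuous fun t : ℝ => x + t • (EuclideanSpace.single 0 (1 : ℝ) : Eu (n + 1)) := by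
        fun_prop
      simpa using (this.tendsto 0).mono_left nhdsWithin_le_nhds
    refine mem_closure_of_tendsto hlim ?_
    filter_upwards [self_mem_nhdsWithin] with t ht
    simpa [h] using ht
  have himg := (φ.continuousAt_symm hx).continuousWithinAt.mem_closure_image hcl
  refine closure_mono ?_ himg
  rintro _ ⟨y, ⟨hy, hy0⟩, rfl⟩
  rw [H.mem_iff, hφ.2 y hy]
  exact hy0

theorem isAdapted [T2Space N] (H : IsNormalized cov η Ω ρ) (hφ : φ ∈ adaptedCharts n ρ) :
    IsAdapted (regularSet cov φ ρ) (tractorHess cov φ ρ) where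
  toIsMetricOn := isMetricOn_regularSet H.torsion H.smooth H.scale hφ.1 H.defining.smooth
  row_zero := by
    intro x hx A
    refine Fin.cases ?_ (fun i => ?_) A
    · exact congrArg (2 * ·) (hφ.2 x hx.1)
    · exact pd_congr_of_eqOn φ.open_target hφ.2 hx.1

theorem mem_regularSet [T2Space N] (H : IsNormalized cov η Ω ρ) (hφ : φ ∈ smoothCharts n N)
    {x : Eu (n + 1)} (hx : x ∈ φ.target) (hM : φ.symm x ∈ frontier Ω) :
    x ∈ regularSet cov φ ρ := by
  refine ⟨hx, fun h => ?_⟩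
  have h2 := mongeAmpere_eq (η := η) H.smooth hφ H.defining.smooth (φ.map_target hx)
  rw [φ.right_inv hx, h, H.mongeAmpere _ hM] at h2
  norm_num at h2

/-- On the boundary, the tangential derivatives of `ρ` vanish and the normal derivative is
positive. -/
theorem pd_rho (H : IsNormalized cov η Ω ρ) (hφ : φ ∈ boundaryCharts (n := n) Ω) {y : Eu n}
    (hy : y ∈ slice φ.target) :
    (∀ α : Fin n, pd α.succ (ρ ∘ φ.symm) (ambPt 0 y) = 0) ∧
      0 < pd 0 (ρ ∘ φ.symm) (ambPt 0 y) := by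
  have hu := comp_symm_contDiffOn hφ.1 H.defining.smooth
  have hud := differentiableAt_of_smooth φ.open_target hu hy
  have htan : ∀ α : Fin n, pd α.succ (ρ ∘ φ.symm) (ambPt 0 y) = 0 := by
    intro α
    rw [← pd_ambPt 0 α hud, pd_congr_of_eqOn (u := fun z => (ρ ∘ φ.symm) (ambPt 0 z))
      (v := fun _ => 0) (isOpen_slice φ.open_target)
      (fun z hz => H.eq_zero_of_mem_frontier (((hφ.2 _ hz).2).2 (ambPt_zero 0 z))) hy]
    simp
  refine ⟨htan, lt_of_le_of_ne ?_ fun h0 => ?_⟩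
  · -- `ρ` is negative on one side
    have hline : HasDerivAt (fun t : ℝ =>
        ambPt 0 y + t • (EuclideanSpace.single 0 (1 : ℝ) : Eu (n + 1)))
        (EuclideanSpace.single 0 (1 : ℝ) : Eu (n + 1)) 0 := by
      simpa using ((hasDerivAt_id (0 : ℝ)).smul_const
        (EuclideanSpace.single 0 (1 : ℝ) : Eu (n + 1))).const_add (ambPt 0 y)
    have hud' : HasFDerivAt (ρ ∘ φ.symm) (fderiv ℝ (ρ ∘ φ.symm) (ambPt 0 y))
        (ambPt 0 y + (0 : ℝ) • (EuclideanSpace.single 0 (1 : ℝ) : Eu (n + 1))) := by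
      simpa using hud.hasFDerivAt
    have hder := hud'.comp_hasDerivAt (0 : ℝ) hline
    have hslope := (hasDerivAt_iff_tendsto_slope.1 hder).mono_left
      (nhdsWithin_mono _ (fun t (ht : t < 0) => ht.ne) : 𝓝[<] (0 : ℝ) ≤ 𝓝[≠] 0)
    refine ge_of_tendsto hslope ?_
    have hnear : ∀ᶠ t : ℝ in 𝓝[<] 0,
        ambPt 0 y + t • (EuclideanSpace.single 0 (1 : ℝ) : Eu (n + 1)) ∈ φ.target := by
      refine nhdsWithin_le_nhds (hline.continuousAt.eventually_mem ?_)
      simpa using φ.open_target.mem_nhds hy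
    filter_upwards [hnear, self_mem_nhdsWithin] with t ht ht0
    have ht0' : t < 0 := ht0
    have hneg : ρ (φ.symm (ambPt 0 y + t • (EuclideanSpace.single 0 (1 : ℝ) : Eu (n + 1)))) < 0 :=
      H.mem_iff.1 (((hφ.2 _ ht).1).2 (by simpa using ht0'))
    have hz : ρ (φ.symm (ambPt 0 y)) = 0 :=
      H.eq_zero_of_mem_frontier (((hφ.2 _ hy).2).2 (ambPt_zero 0 y))
    simp only [slope_def_field, Function.comp_apply, zero_smul, add_zero, hz, sub_zero]
    exact (div_pos_of_neg_of_neg hneg ht0').le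
  · obtain ⟨i, hi⟩ := exists_pd_ne_zero hφ.1 H.defining.smooth (φ.map_target hy)
      (H.defining.regular _ (((hφ.2 _ hy).2).2 (ambPt_zero 0 y)))
    rw [φ.right_inv hy] at hi
    revert hi
    refine Fin.cases (fun hi => hi h0.symm) (fun α hi => hi (htan α)) i

/-- On the boundary, the restriction of the Hessian of `ρ` to the tangent space is `∂₀ρ` times the
second fundamental form. -/
theorem det_tractorHess (H : IsNormalized cov η Ω ρ) (hφ : φ ∈ boundaryCharts (n := n) Ω)
    {y : Eu n} (hy : y ∈ slice φ.target) :
    (tractorHess cov φ ρ (ambPt 0 y)).det =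
      -(pd 0 (ρ ∘ φ.symm) (ambPt 0 y) ^ (n + 2) * (secondFund cov φ (ambPt 0 y)).det) := by
  have hu := comp_symm_contDiffOn hφ.1 H.defining.smooth
  obtain ⟨htan, -⟩ := H.pd_rho hφ hy
  have hρ0 : ρ (φ.symm (ambPt 0 y)) = 0 :=
    H.eq_zero_of_mem_frontier (((hφ.2 _ hy).2).2 (ambPt_zero 0 y))
  set T := tractorHess cov φ ρ (ambPt 0 y) with hT
  set r := pd 0 (ρ ∘ φ.symm) (ambPt 0 y) with hr
  have h00 : T 0 0 = 0 := by
    change 2 * ρ (φ.symm (ambPt 0 y)) = 0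
    rw [hρ0, mul_zero]
  have h2 : T.submatrix (fun α : Fin n => α.succ.succ) (fun α : Fin n => α.succ.succ) =
      r • secondFund cov φ (ambPt 0 y) := by
    ext α β
    change hess cov φ ρ α.succ β.succ (ambPt 0 y) +
      2 * ρ (φ.symm (ambPt 0 y)) * schouten cov φ α.succ β.succ (ambPt 0 y) = _
    have hpp : pd α.succ (pd β.succ (ρ ∘ φ.symm)) (ambPt 0 y) = 0 := by
      rw [← pd_ambPt 0 α (differentiableAt_of_smooth φ.open_target
        (pd_contDiffOn φ.open_target β.succ hu) hy),
        pd_congr_of_eqOn (v := fun _ => 0) (isOpen_slice φ.open_target)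
          (fun z hz => (H.pd_rho hφ hz).1 β) hy]
      simp
    rw [hess, hpp, Fin.sum_univ_succ]
    simp only [htan, hρ0, secondFund, Matrix.smul_apply, Matrix.of_apply, smul_eq_mul]
    simp only [← hr]
    simp
    ring
  rw [det_of_border T r h00 rfl htan rfl htan, h2, Matrix.det_smul, Fintype.card_fin]
  ring

/-- The volume density of the affine metric: `√(det h) = |η| / ∂₀ρ`.  The normalization
`𝒥[ρ] = -1` reads `det b = η² / (∂₀ρ)^{n+2}` for the second fundamental form `b`, so that the
affine normal field satisfies `dρ(ξ) = 1`. -/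
theorem sqrt_det_affineMetric [T2Space N] (H : IsNormalized cov η Ω ρ)
    (hφ : φ ∈ boundaryCharts (n := n) Ω) {y : Eu n} (hy : y ∈ slice φ.target) :
    √(affineMetric cov η φ (ambPt 0 y)).det =
      |volCoef η φ (ambPt 0 y)| / pd 0 (ρ ∘ φ.symm) (ambPt 0 y) := by
  have hr := (H.pd_rho hφ hy).2
  have hη := H.scale.volCoef_ne_zero hφ.1 hy
  have hJ := mongeAmpere_eq (η := η) H.smooth hφ.1 H.defining.smooth (φ.map_target hy)
  rw [φ.right_inv hy, H.mongeAmpere _ (((hφ.2 _ hy).2).2 (ambPt_zero 0 y)),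
    H.det_tractorHess hφ hy] at hJ
  set r := pd 0 (ρ ∘ φ.symm) (ambPt 0 y)
  set b := secondFund cov φ (ambPt 0 y) with hb
  have hη2 : volCoef η φ (ambPt 0 y) ^ 2 ≠ 0 := pow_ne_zero _ hη
  have hdet : b.det / volCoef η φ (ambPt 0 y) ^ 2 = r⁻¹ ^ (n + 2) := by
    rw [eq_div_iff hη2] at hJ
    rw [inv_pow, div_eq_iff hη2, inv_mul_eq_div, eq_div_iff (by positivity)]
    linarith
  have hc : affineNormalComp cov η φ (ambPt 0 y) = r⁻¹ := by
    rw [affineNormalComp, ← hb, hdet, one_div]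
    have := Real.pow_rpow_inv_natCast (inv_nonneg.2 hr.le) (show n + 2 ≠ 0 by omega)
    push_cast at this
    exact this
  have hdetb : b.det = r⁻¹ ^ (n + 2) * volCoef η φ (ambPt 0 y) ^ 2 := by
    rw [← hdet, div_mul_cancel₀ _ hη2]
  rw [affineMetric, hc, ← hb, Matrix.det_smul, Fintype.card_fin, inv_inv, hdetb]
  have hsq : r ^ n * (r⁻¹ ^ (n + 2) * volCoef η φ (ambPt 0 y) ^ 2) =
      (|volCoef η φ (ambPt 0 y)| / r) ^ 2 := by
    rw [div_pow, sq_abs, pow_add, inv_pow]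
    field_simp
  rw [hsq, Real.sqrt_sq (by positivity)]

/-- In an adapted chart, the affine volume density is the volume density of the ambient metric; here
`𝒥[ρ] = -1` gives `|det T| = η²`. -/
theorem sqrt_det_affineMetric_eq_density [T2Space N] (H : IsNormalized cov η Ω ρ)
    (hφ : φ ∈ adaptedCharts n ρ) {y : Eu n} (hy : y ∈ slice φ.target) :
    √(affineMetric cov η φ (ambPt 0 y)).det = density (tractorHess cov φ ρ) (ambPt 0 y) := by
  have hφb := H.adaptedChart_mem_boundaryCharts hφ
  have hr : pd 0 (ρ ∘ φ.symm) (ambPt 0 y) = 1 := by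
    rw [pd_congr_of_eqOn (u := ρ ∘ φ.symm) (v := fun x => x 0) φ.open_target hφ.2 hy,
      pd_coord, if_pos rfl]
  have hη := H.scale.volCoef_ne_zero hφ.1 hy
  have hJ := mongeAmpere_eq (η := η) H.smooth hφ.1 H.defining.smooth (φ.map_target hy)
  rw [φ.right_inv hy, H.mongeAmpere _ (((hφb.2 _ hy).2).2 (ambPt_zero 0 y)),
    eq_div_iff (pow_ne_zero _ hη)] at hJ
  rw [H.sqrt_det_affineMetric hφb hy, hr, div_one, density, ← hJ, neg_one_mul, Real.log_neg_eq_log,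
    ← sq_abs, Real.log_pow]
  push_cast
  rw [← mul_assoc, one_div, inv_mul_cancel₀ two_ne_zero, one_mul, Real.exp_log (abs_pos.2 hη)]

end IsNormalized

end Boundary

/-! ### The affine volume measure -/

section Volume

open MeasureTheory

variable {n : ℕ} {N : Type*} [TopologicalSpace N] {φ ψ : OpenPartialHomeomorph N (Eu (n + 1))}

/-- The parametrization of the boundary by the hyperplane `x⁰ = 0` of a boundary chart. -/
def bdryParam (φ : OpenPartialHomeomorph N (Eu (n + 1))) (y : Eu n) : N := φ.symm (ambPt 0 y)

theorem continuousOn_bdryParam : ContinuousOn (bdryParam φ) (slice φ.target) :=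
  φ.continuousOn_symm.comp (contDiff_ambPt 0).continuous.continuousOn fun _ hy => hy

/-- The coordinates of a point other than `x⁰`. -/
def dropFirst {d : ℕ} (x : Eu (d + 1)) : Eu d := WithLp.toLp 2 fun i => x i.succ

theorem ambPt_dropFirst {d : ℕ} {x : Eu (d + 1)} (hx : x 0 = 0) : ambPt 0 (dropFirst x) = x := by
  ext i
  refine Fin.cases ?_ (fun j => ?_) i
  · simpa using hx.symm
  · rfl

theorem contDiff_dropFirst {d : ℕ} : ContDiff ℝ ∞ (dropFirst : Eu (d + 1) → Eu d) :=
  contDiff_euclidean.2 fun i => contDiff_coord i.succ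

/-- The transition map between the parametrizations of the boundary by two boundary charts. -/
def bdryTrans (φ ψ : OpenPartialHomeomorph N (Eu (n + 1))) (y : Eu n) : Eu n :=
  dropFirst (trans φ ψ (ambPt 0 y))

theorem fderiv_det_eq {d : ℕ} {θ : Eu d → Eu d} {y : Eu d} (hθ : DifferentiableAt ℝ θ y) :
    (fderiv ℝ θ y).det = (jac θ y).det := by
  rw [ContinuousLinearMap.det, ← LinearMap.det_toMatrix (EuclideanSpace.basisFun (Fin d) ℝ).toBasis]
  congr 1
  ext a i
  rw [LinearMap.toMatrix_apply]
  simp only [OrthonormalBasis.coe_toBasis, EuclideanSpace.basisFun_apply,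
    OrthonormalBasis.coe_toBasis_repr_apply, EuclideanSpace.basisFun_repr,
    ContinuousLinearMap.coe_coe]
  exact fderiv_apply_coord hθ _ a

variable [ChartedSpace (Eu (n + 1)) N] {Ω : Set N}

section Transition

variable (hφ : φ ∈ boundaryCharts (n := n) Ω) (hψ : ψ ∈ boundaryCharts (n := n) Ω)

include hφ hψ

theorem trans_ambPt_zero {y : Eu n} (hy : y ∈ slice (overlap φ ψ)) :
    trans φ ψ (ambPt 0 y) 0 = 0 := by
  rw [← (hψ.2 _ (trans_mapsTo hy).1).2, symm_trans hy, (hφ.2 _ hy.1).2, ambPt_zero]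

theorem ambPt_bdryTrans {y : Eu n} (hy : y ∈ slice (overlap φ ψ)) :
    ambPt 0 (bdryTrans φ ψ y) = trans φ ψ (ambPt 0 y) :=
  ambPt_dropFirst (trans_ambPt_zero hφ hψ hy)

theorem bdryTrans_mapsTo :
    Set.MapsTo (bdryTrans φ ψ) (slice (overlap φ ψ)) (slice (overlap ψ φ)) := fun y hy => by
  change ambPt 0 (bdryTrans φ ψ y) ∈ overlap ψ φ
  rw [ambPt_bdryTrans hφ hψ hy]
  exact trans_mapsTo hy

theorem bdryParam_bdryTrans {y : Eu n} (hy : y ∈ slice (overlap φ ψ)) :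
    bdryParam ψ (bdryTrans φ ψ y) = bdryParam φ y := by
  rw [bdryParam, ambPt_bdryTrans hφ hψ hy, symm_trans hy]
  rfl

theorem bdryTrans_bdryTrans {y : Eu n} (hy : y ∈ slice (overlap φ ψ)) :
    bdryTrans ψ φ (bdryTrans φ ψ y) = y := by
  rw [bdryTrans, ambPt_bdryTrans hφ hψ hy, trans, symm_trans hy, φ.right_inv hy.1]
  rfl

theorem bdryTrans_contDiffOn : ContDiffOn ℝ ∞ (bdryTrans φ ψ) (slice (overlap φ ψ)) :=
  contDiff_dropFirst.comp_contDiffOn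
    ((trans_contDiffOn hφ.1 hψ.1).comp (contDiff_ambPt 0).contDiffOn fun _ hy => hy)

/-- On the boundary, the Jacobian matrix of a transition map between boundary charts is block
triangular. -/
theorem det_jac_trans_boundary {y : Eu n} (hy : y ∈ slice (overlap φ ψ)) :
    (∀ α : Fin n, jac (trans φ ψ) (ambPt 0 y) 0 α.succ = 0) ∧
    (jac (trans φ ψ) (ambPt 0 y)).det =
      jac (trans φ ψ) (ambPt 0 y) 0 0 * (jac (bdryTrans φ ψ) y).det := by
  have hO := isOpen_overlap (φ := φ) (ψ := ψ)
  have hd : ∀ a, DifferentiableAt ℝ (fun x => trans φ ψ x a) (ambPt 0 y) := fun a =>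
    differentiableAt_of_smooth hO
      ((contDiff_coord a).comp_contDiffOn (trans_contDiffOn hφ.1 hψ.1)) hy
  have h0 : ∀ α : Fin n, jac (trans φ ψ) (ambPt 0 y) 0 α.succ = 0 := by
    intro α
    change pd α.succ (fun x => trans φ ψ x 0) (ambPt 0 y) = 0
    rw [← pd_ambPt 0 α (hd 0), pd_congr_of_eqOn (v := fun _ => 0) (isOpen_slice hO)
      (fun z hz => trans_ambPt_zero hφ hψ hz) hy]
    simp
  have h1 : (jac (trans φ ψ) (ambPt 0 y)).submatrix Fin.succ (Fin.succAbove 0) =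
      jac (bdryTrans φ ψ) y := by
    ext α β
    exact (pd_ambPt 0 β (hd α.succ)).symm
  refine ⟨h0, ?_⟩
  rw [Matrix.det_succ_row_zero, Fin.sum_univ_succ, h1]
  simp [h0]

end Transition

variable [IsManifold 𝓘(ℝ, Eu (n + 1)) ∞ N]
  {cov : Connection n N} {η : VolumeForm n N} {ρ : N → ℝ}

/-- The volume densities of two boundary charts are related by the Jacobian determinant. -/
theorem IsNormalized.sqrt_det_affineMetric_trans [T2Space N] (H : IsNormalized cov η Ω ρ)
    (hφ : φ ∈ boundaryCharts (n := n) Ω) (hψ : ψ ∈ boundaryCharts (n := n) Ω)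
    {y : Eu n} (hy : y ∈ slice (overlap φ ψ)) :
    √(affineMetric cov η φ (ambPt 0 y)).det = |(jac (bdryTrans φ ψ) y).det| *
      √(affineMetric cov η ψ (ambPt 0 (bdryTrans φ ψ y))).det := by
  have hy' := bdryTrans_mapsTo hφ hψ hy
  rw [H.sqrt_det_affineMetric hφ hy.1, H.sqrt_det_affineMetric hψ hy'.1,
    volCoef_trans hφ.1 hψ.1 hy, (det_jac_trans_boundary hφ hψ hy).2, ambPt_bdryTrans hφ hψ hy]
  have hr := (H.pd_rho hφ hy.1).2
  obtain ⟨htan, hr'⟩ := H.pd_rho hψ hy'.1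
  rw [ambPt_bdryTrans hφ hψ hy] at htan hr'
  have hrr := pd_comp_symm_trans hφ.1 hψ.1 H.defining.smooth hy 0
  rw [Fin.sum_univ_succ] at hrr
  simp only [htan, mul_zero, Finset.sum_const_zero, add_zero] at hrr
  rw [hrr] at hr ⊢
  have hK : 0 < jac (trans φ ψ) (ambPt 0 y) 0 0 := pos_of_mul_pos_left hr hr'.le
  rw [abs_mul, abs_mul, abs_of_pos hK]
  field_simp

theorem IsNormalized.continuousOn_sqrt_det_affineMetric [T2Space N] (H : IsNormalized cov η Ω ρ)
    (hφ : φ ∈ adaptedCharts n ρ) :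
    ContinuousOn (fun y => √(affineMetric cov η φ (ambPt 0 y)).det) (slice φ.target) := by
  refine ContinuousOn.congr (fun y hy => ?_) fun y hy => H.sqrt_det_affineMetric_eq_density hφ hy
  have hreg := H.mem_regularSet hφ.1 hy
    ((((H.adaptedChart_mem_boundaryCharts hφ).2 _ hy).2).2 (ambPt_zero 0 y))
  have hA := (H.isAdapted hφ).toIsMetricOn
  exact ((contDiffOn_slice (density_contDiffOn hA)).contDiffAt
    ((isOpen_slice hA.isOpen).mem_nhds hreg)).continuousAt.continuousWithinAt

variable [MeasurableSpace N]

/-- The measure `√(det h) dy` on the part of the boundary in the domain of a boundary chart. -/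
def chartVolume (cov : Connection n N) (η : VolumeForm n N)
    (φ : OpenPartialHomeomorph N (Eu (n + 1))) : Measure N :=
  (((volume : Measure (Eu n)).restrict (slice φ.target)).withDensity
    (fun y => ENNReal.ofReal √(affineMetric cov η φ (ambPt 0 y)).det)).map (bdryParam φ)

theorem affineVolume_eq_iSup :
    affineVolume cov η Ω = ⨆ φ ∈ boundaryCharts (n := n) Ω, chartVolume cov η φ := rfl

variable [BorelSpace N]

theorem aemeasurable_bdryParam : AEMeasurable (bdryParam φ)
    (((volume : Measure (Eu n)).restrict (slice φ.target)).withDensity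
      (fun y => ENNReal.ofReal √(affineMetric cov η φ (ambPt 0 y)).det)) :=
  (continuousOn_bdryParam.aemeasurable (isOpen_slice φ.open_target).measurableSet).mono_ac
    (withDensity_absolutelyContinuous _ _)

theorem chartVolume_apply {A : Set N} (hA : MeasurableSet A) : chartVolume cov η φ A =
    ∫⁻ y in bdryParam φ ⁻¹' A ∩ slice φ.target,
      ENNReal.ofReal √(affineMetric cov η φ (ambPt 0 y)).det := by
  rw [chartVolume, Measure.map_apply_of_aemeasurable aemeasurable_bdryParam hA, withDensity_apply',
    Measure.restrict_restrict' (isOpen_slice φ.open_target).measurableSet]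

theorem chartVolume_inter_source {A : Set N} (hA : MeasurableSet A) :
    chartVolume cov η φ (A ∩ φ.source) = chartVolume cov η φ A := by
  rw [chartVolume_apply hA, chartVolume_apply (hA.inter φ.open_source.measurableSet)]
  congr 2
  ext y
  exact ⟨fun h => ⟨h.1.1, h.2⟩, fun h => ⟨⟨h.1, φ.map_target h.2⟩, h.2⟩⟩

/-- The measures of two boundary charts agree on the overlap of their domains, by the change of
variables formula. -/
theorem IsNormalized.chartVolume_eq [T2Space N] (H : IsNormalized cov η Ω ρ)
    (hφ : φ ∈ boundaryCharts (n := n) Ω) (hψ : ψ ∈ boundaryCharts (n := n) Ω) {A : Set N}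
    (hA : MeasurableSet A) (hAφ : A ⊆ φ.source) (hAψ : A ⊆ ψ.source) :
    chartVolume cov η φ A = chartVolume cov η ψ A := by
  rw [chartVolume_apply hA, chartVolume_apply hA]
  set E := bdryParam φ ⁻¹' A ∩ slice φ.target with hE
  set E' := bdryParam ψ ⁻¹' A ∩ slice ψ.target with hE'
  have hEo : E ⊆ slice (overlap φ ψ) := fun y hy => ⟨hy.2, hAψ hy.1⟩
  have hEo' : E' ⊆ slice (overlap ψ φ) := fun y hy => ⟨hy.2, hAφ hy.1⟩
  have himg : bdryTrans φ ψ '' E = E' := by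
    apply Set.Subset.antisymm
    · rintro _ ⟨y, hy, rfl⟩
      refine ⟨?_, (bdryTrans_mapsTo hφ hψ (hEo hy)).1⟩
      rw [Set.mem_preimage, bdryParam_bdryTrans hφ hψ (hEo hy)]
      exact hy.1
    · intro y hy
      refine ⟨bdryTrans ψ φ y, ⟨?_, (bdryTrans_mapsTo hψ hφ (hEo' hy)).1⟩,
        bdryTrans_bdryTrans hψ hφ (hEo' hy)⟩
      rw [Set.mem_preimage, bdryParam_bdryTrans hψ hφ (hEo' hy)]
      exact hy.1
  have hEm : MeasurableSet E := by
    have hS := (isOpen_slice φ.open_target).measurableSet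
    have hr : Measurable ((slice φ.target).domRestrict (bdryParam φ)) :=
      (continuousOn_iff_continuous_domRestrict.1 continuousOn_bdryParam).measurable
    have h := hS.subtype_image (hr hA)
    convert h using 1
    ext y
    simp only [hE, Set.mem_inter_iff, Set.mem_preimage, Set.mem_image, Subtype.exists,
      exists_and_right, exists_eq_right]
    tauto
  have hd : ∀ y ∈ E, DifferentiableAt ℝ (bdryTrans φ ψ) y := fun y hy =>
    ((bdryTrans_contDiffOn hφ hψ).contDiffAt ((isOpen_slice isOpen_overlap).mem_nhds
      (hEo hy))).differentiableAt (by simp)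
  rw [← himg, lintegral_image_eq_lintegral_abs_det_fderiv_mul volume hEm
    (fun y hy => (hd y hy).hasFDerivAt.hasFDerivWithinAt)
    (fun y hy z hz h => by
      rw [← bdryTrans_bdryTrans hφ hψ (hEo hy), h, bdryTrans_bdryTrans hφ hψ (hEo hz)])]
  refine setLIntegral_congr_fun hEm fun y hy => ?_
  rw [fderiv_det_eq (hd y hy), ← ENNReal.ofReal_mul (abs_nonneg _),
    H.sqrt_det_affineMetric_trans hφ hψ (hEo hy)]

/-- The affine volume measure restricts, on the domain of a boundary chart, to the measure given
by that chart. -/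
theorem IsNormalized.affineVolume_restrict [T2Space N] (H : IsNormalized cov η Ω ρ)
    (hφ : φ ∈ boundaryCharts (n := n) Ω) :
    (affineVolume cov η Ω).restrict φ.source = chartVolume cov η φ := by
  have hs := φ.open_source.measurableSet
  -- all chart measures are bounded by this measure, hence so is their supremum
  set ν := chartVolume cov η φ + (affineVolume cov η Ω).restrict φ.sourceᶜ with hν
  have hle : affineVolume cov η Ω ≤ ν := by
    rw [affineVolume_eq_iSup]
    refine iSup₂_le fun ψ hψ => Measure.le_iff.2 fun A hA => ?_
    rw [← measure_inter_add_sdiff A hs, hν, Measure.add_apply, Measure.restrict_apply hA]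
    refine add_le_add ?_ ?_
    · rw [← chartVolume_inter_source (hA.inter hs), H.chartVolume_eq hψ hφ
        ((hA.inter hs).inter ψ.open_source.measurableSet) Set.inter_subset_right
        (fun p hp => hp.1.2)]
      exact measure_mono fun p hp => hp.1.1
    · exact (le_iSup₂ (f := fun φ (_ : φ ∈ boundaryCharts (n := n) Ω) => chartVolume cov η φ)
        ψ hψ : chartVolume cov η ψ ≤ _) _
  refine le_antisymm (Measure.le_iff.2 fun A hA => ?_) (Measure.le_iff.2 fun A hA => ?_)
  · rw [Measure.restrict_apply hA]
    refine (hle _).trans ?_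
    rw [hν, Measure.add_apply, Measure.restrict_apply (hA.inter hs), Set.inter_assoc,
      Set.inter_compl_self, Set.inter_empty, measure_empty, add_zero]
    exact measure_mono Set.inter_subset_left
  · rw [Measure.restrict_apply hA, ← chartVolume_inter_source hA]
    exact (le_iSup₂ (f := fun φ (_ : φ ∈ boundaryCharts (n := n) Ω) => chartVolume cov η φ)
      φ hφ : chartVolume cov η φ ≤ _) _

theorem chartVolume_restrict_frontier (hφ : φ ∈ boundaryCharts (n := n) Ω) :
    (chartVolume cov η φ).restrict (frontier Ω) = chartVolume cov η φ := by
  have hM : MeasurableSet (frontier Ω) := isClosed_frontier.measurableSet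
  ext A hA
  rw [Measure.restrict_apply hA, chartVolume_apply hA, chartVolume_apply (hA.inter hM)]
  congr 2
  ext y
  exact ⟨fun h => ⟨h.1.1, h.2⟩, fun h =>
    ⟨⟨h.1, ((hφ.2 _ h.2).2).2 (ambPt_zero 0 y)⟩, h.2⟩⟩

/-- The integral over the boundary of a function that vanishes outside an adapted chart. -/
theorem IsNormalized.integral_affineVolume [T2Space N] (H : IsNormalized cov η Ω ρ)
    (hφ : φ ∈ adaptedCharts n ρ) {g : N → ℝ} (hg : ContinuousOn g (frontier Ω))
    (h0 : ∀ p ∈ frontier Ω, p ∉ φ.source → g p = 0) :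
    ∫ p : frontier Ω, g p ∂((affineVolume cov η Ω).comap Subtype.val) =
      ∫ y in slice φ.target, density (tractorHess cov φ ρ) (ambPt 0 y) * g (bdryParam φ y) := by
  have hφb := H.adaptedChart_mem_boundaryCharts hφ
  have hM : MeasurableSet (frontier Ω) := isClosed_frontier.measurableSet
  have hS := (isOpen_slice φ.open_target).measurableSet
  have hwc := H.continuousOn_sqrt_det_affineMetric hφ
  have hgm : AEStronglyMeasurable g (chartVolume cov η φ) := by
    rw [← chartVolume_restrict_frontier hφb]
    exact hg.aestronglyMeasurable hM
  rw [integral_subtype_comap hM, setIntegral_eq_of_subset_of_forall_sdiff_eq_zero hM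
    (Set.inter_subset_left : frontier Ω ∩ φ.source ⊆ frontier Ω)
    (fun p hp => h0 p hp.1 fun h => hp.2 ⟨hp.1, h⟩), ← Measure.restrict_restrict hM,
    H.affineVolume_restrict hφb, chartVolume_restrict_frontier hφb, chartVolume,
    integral_map aemeasurable_bdryParam hgm, integral_withDensity_eq_integral_toReal_smul₀
      (hwc.aemeasurable hS).ennreal_ofReal (by simp)]
  refine setIntegral_congr_fun hS fun y hy => ?_
  simp only [ENNReal.toReal_ofReal (Real.sqrt_nonneg _), smul_eq_mul]
  exact congrArg (· * g (bdryParam φ y)) (H.sqrt_det_affineMetric_eq_density hφ hy)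

/-- The boundary has finite affine volume. -/
theorem IsNormalized.affineVolume_frontier_lt_top [T2Space N] (H : IsNormalized cov η Ω ρ)
    (hc : IsCompact (closure Ω)) : affineVolume cov η Ω (frontier Ω) < ⊤ := by
  have hcM : IsCompact (frontier Ω) := hc.of_isClosed_subset isClosed_frontier
    frontier_subset_closure
  refine hcM.measure_lt_top_of_nhdsWithin fun p hp => ?_
  obtain ⟨φ, hφ, hpφ⟩ := exists_adaptedChart H.defining.smooth (H.defining.regular p hp)
  have hφb := H.adaptedChart_mem_boundaryCharts hφ
  have hp0 : φ p 0 = 0 := by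
    rw [← hφ.2 _ (φ.map_source hpφ), φ.left_inv hpφ, H.eq_zero_of_mem_frontier hp]
  have hy : dropFirst (φ p) ∈ slice φ.target := by
    change ambPt 0 (dropFirst (φ p)) ∈ φ.target
    rw [ambPt_dropFirst hp0]
    exact φ.map_source hpφ
  obtain ⟨K, hK, hyK, hKs⟩ := exists_compact_subset (isOpen_slice φ.open_target) hy
  have hUo : IsOpen (φ.source ∩ φ ⁻¹' (dropFirst ⁻¹' interior K)) :=
    φ.isOpen_inter_preimage (isOpen_interior.preimage contDiff_dropFirst.continuous)
  refine ⟨_, mem_nhdsWithin_of_mem_nhds (hUo.mem_nhds ⟨hpφ, hyK⟩), ?_⟩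
  rw [← Measure.restrict_eq_self _ Set.inter_subset_left, H.affineVolume_restrict hφb,
    chartVolume_apply hUo.measurableSet]
  refine (lintegral_mono_set fun y hy => ?_).trans_lt
    (((H.continuousOn_sqrt_det_affineMetric hφ).mono hKs).integrableOn_compact
      hK).setLIntegral_lt_top
  have hyK' : dropFirst (φ (φ.symm (ambPt 0 y))) ∈ interior K := hy.1.2
  rw [φ.right_inv hy.2] at hyK'
  exact interior_subset hyK'

end Volume

/-! ### Formal self-adjointness -/

section SelfAdjoint

open MeasureTheory

variable {n : ℕ} {N : Type*} [TopologicalSpace N] {φ : OpenPartialHomeomorph N (Eu (n + 1))}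
  [ChartedSpace (Eu (n + 1)) N] [IsManifold 𝓘(ℝ, Eu (n + 1)) ∞ N]
  {cov : Connection n N} {η : VolumeForm n N} {Ω : Set N} {ρ : N → ℝ}

theorem IsAdapted.mono {T : Eu (n + 1) → Matrix (Fin (n + 2)) (Fin (n + 2)) ℝ}
    {V W : Set (Eu (n + 1))} (hT : IsAdapted V T) (hW : IsOpen W) (hWV : W ⊆ V) :
    IsAdapted W T :=
  ⟨hT.toIsMetricOn.mono hW hWV, fun x hx => hT.row_zero x (hWV hx)⟩

namespace IsNormalized

theorem exists_adaptedChart (H : IsNormalized cov η Ω ρ) {p : N} (hM : p ∈ frontier Ω) :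
    ∃ φ ∈ adaptedCharts n ρ, p ∈ φ.source :=
  ConformalCodazzi.exists_adaptedChart H.defining.smooth (H.defining.regular p hM)

theorem contDiffOn_comp_symm (hφ : φ ∈ smoothCharts n N) {F : N → ℝ}
    (hF : ContMDiff 𝓘(ℝ, Eu (n + 1)) 𝓘(ℝ) ∞ F) :
    ContDiffOn ℝ ∞ (F ∘ φ.symm) (regularSet cov φ ρ) :=
  (comp_symm_contDiffOn hφ hF).mono fun _ hx => hx.1

variable [T2Space N]

theorem ambientLapPow_eq (H : IsNormalized cov η Ω ρ) (hφ : φ ∈ smoothCharts n N) (m : ℕ) (w : ℝ)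
    {F : N → ℝ} (hF : ContMDiff 𝓘(ℝ, Eu (n + 1)) 𝓘(ℝ) ∞ F) {p : N} (hp : p ∈ φ.source)
    (hM : p ∈ frontier Ω) :
    ambientLapPow cov ρ m w F p = lapPow (tractorHess cov φ ρ) m w (F ∘ φ.symm) (φ p) :=
  ambientLapPow_eq_lapPow H.torsion H.smooth H.scale hφ H.defining.smooth hp
    (by rw [H.mongeAmpere p hM]; norm_num) m w hF

theorem map_mem_regularSet (H : IsNormalized cov η Ω ρ) (hφ : φ ∈ smoothCharts n N) {p : N}
    (hp : p ∈ φ.source) (hM : p ∈ frontier Ω) : φ p ∈ regularSet cov φ ρ :=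
  H.mem_regularSet hφ (φ.map_source hp) (by rwa [φ.left_inv hp])

theorem ambientLapPow_add (H : IsNormalized cov η Ω ρ) (m : ℕ) (w : ℝ) {F G : N → ℝ}
    (hF : ContMDiff 𝓘(ℝ, Eu (n + 1)) 𝓘(ℝ) ∞ F) (hG : ContMDiff 𝓘(ℝ, Eu (n + 1)) 𝓘(ℝ) ∞ G)
    {p : N} (hM : p ∈ frontier Ω) :
    ambientLapPow cov ρ m w (fun q => F q + G q) p =
      ambientLapPow cov ρ m w F p + ambientLapPow cov ρ m w G p := by
  obtain ⟨φ, hφ, hp⟩ := H.exists_adaptedChart hM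
  have hFG : ContMDiff 𝓘(ℝ, Eu (n + 1)) 𝓘(ℝ) ∞ fun q => F q + G q := hF.add hG
  rw [H.ambientLapPow_eq hφ.1 m w hF hp hM, H.ambientLapPow_eq hφ.1 m w hG hp hM,
    H.ambientLapPow_eq hφ.1 m w hFG hp hM]
  exact lapPow_add (H.isAdapted hφ).toIsMetricOn m (contDiffOn_comp_symm hφ.1 hF)
    (contDiffOn_comp_symm hφ.1 hG) (H.map_mem_regularSet hφ.1 hp hM)

theorem ambientLapPow_zero (H : IsNormalized cov η Ω ρ) (m : ℕ) (w : ℝ) {p : N}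
    (hM : p ∈ frontier Ω) : ambientLapPow cov ρ m w (fun _ => 0) p = 0 := by
  obtain ⟨φ, hφ, hp⟩ := H.exists_adaptedChart hM
  rw [H.ambientLapPow_eq hφ.1 m w contMDiff_const hp hM]
  exact lapPow_eq_zero (H.isAdapted hφ).toIsMetricOn m contDiffOn_const (fun _ _ => rfl) _
    (H.map_mem_regularSet hφ.1 hp hM)

theorem ambientLapPow_sum (H : IsNormalized cov η Ω ρ) (m : ℕ) (w : ℝ) {ι : Type*}
    (s : Finset ι) {F : ι → N → ℝ} (hF : ∀ i, ContMDiff 𝓘(ℝ, Eu (n + 1)) 𝓘(ℝ) ∞ (F i))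
    {p : N} (hM : p ∈ frontier Ω) :
    ambientLapPow cov ρ m w (fun q => ∑ i ∈ s, F i q) p =
      ∑ i ∈ s, ambientLapPow cov ρ m w (F i) p := by
  classical
  induction s using Finset.induction_on with
  | empty => simpa using H.ambientLapPow_zero m w hM
  | insert i s his ih =>
    simp only [Finset.sum_insert his]
    rw [H.ambientLapPow_add m w (hF i) (contMDiff_finsetSum fun j _ => hF j) hM, ih]

/-- On `M`, the value of `Δ̃^m f̃` for `f̃` of weight `m - n/2` depends only on `f̃|_M`, and this
locally: two extensions differ by a function that vanishes on `M`. -/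
theorem ambientLapPow_congr (H : IsNormalized cov η Ω ρ) {m : ℕ} (hm : 1 ≤ m) {F G : N → ℝ}
    (hF : ContMDiff 𝓘(ℝ, Eu (n + 1)) 𝓘(ℝ) ∞ F) (hG : ContMDiff 𝓘(ℝ, Eu (n + 1)) 𝓘(ℝ) ∞ G)
    {p : N} (hM : p ∈ frontier Ω) {W : Set N} (hW : IsOpen W) (hpW : p ∈ W)
    (h : ∀ q ∈ W, q ∈ frontier Ω → F q = G q) :
    ambientLapPow cov ρ m ((m : ℝ) - n / 2) F p = ambientLapPow cov ρ m ((m : ℝ) - n / 2) G p := by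
  obtain ⟨φ, hφ, hp⟩ := H.exists_adaptedChart hM
  have hE : ContMDiff 𝓘(ℝ, Eu (n + 1)) 𝓘(ℝ) ∞ fun q => F q - G q := hF.sub hG
  have hFE : F = fun q => G q + (F q - G q) := by
    funext q
    ring
  rw [hFE, H.ambientLapPow_add m _ hG hE hM, add_eq_left, H.ambientLapPow_eq hφ.1 m _ hE hp hM]
  have hA := H.isAdapted hφ
  have hVo : IsOpen (regularSet cov φ ρ ∩ (φ.target ∩ φ.symm ⁻¹' W)) :=
    hA.isOpen.inter (φ.isOpen_inter_preimage_symm hW)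
  have hφb := H.adaptedChart_mem_boundaryCharts hφ
  refine (hA.mono hVo Set.inter_subset_left).lapPow_eq_zero_of_boundary hm
    ((contDiffOn_comp_symm hφ.1 hE).mono Set.inter_subset_left) (fun x hx hx0 => ?_)
    ⟨H.map_mem_regularSet hφ.1 hp hM, φ.map_source hp, ?_⟩ ?_
  · exact sub_eq_zero.2 (h _ hx.2.2 (((hφb.2 _ hx.2.1).2).2 hx0))
  · rwa [Set.mem_preimage, φ.left_inv hp]
  · rw [← (hφb.2 _ (φ.map_source hp)).2, φ.left_inv hp]
    exact hM

theorem continuousOn_ambientLapPow (H : IsNormalized cov η Ω ρ) (m : ℕ) (w : ℝ) {F : N → ℝ}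
    (hF : ContMDiff 𝓘(ℝ, Eu (n + 1)) 𝓘(ℝ) ∞ F) :
    ContinuousOn (ambientLapPow cov ρ m w F) (frontier Ω) := by
  intro p hM
  obtain ⟨φ, hφ, hp⟩ := H.exists_adaptedChart hM
  have hA := (H.isAdapted hφ).toIsMetricOn
  have hc : ContinuousAt (lapPow (tractorHess cov φ ρ) m w (F ∘ φ.symm)) (φ p) :=
    ((lapPow_contDiffOn hA m w (contDiffOn_comp_symm hφ.1 hF)).contDiffAt
      (hA.isOpen.mem_nhds (H.map_mem_regularSet hφ.1 hp hM))).continuousAt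
  refine (hc.comp (φ.continuousAt hp)).continuousWithinAt.congr_of_eventuallyEq ?_
    (H.ambientLapPow_eq hφ.1 m w hF hp hM)
  filter_upwards [self_mem_nhdsWithin, mem_nhdsWithin_of_mem_nhds (φ.open_source.mem_nhds hp)]
    with q hqM hq
  exact H.ambientLapPow_eq hφ.1 m w hF hq hqM

/-- The operator `Δ̃^m|_M` is symmetric on functions with support in an adapted chart. -/
theorem integral_antisymm_of_support (H : IsNormalized cov η Ω ρ) [MeasurableSpace N]
    [BorelSpace N] (hφ : φ ∈ adaptedCharts n ρ) {m : ℕ} (hm : 1 ≤ m) {K : Set N}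
    (hK : IsCompact K) (hKφ : K ⊆ φ.source) (hKr : Set.MapsTo φ K (regularSet cov φ ρ))
    {F G : N → ℝ} (hF : ContMDiff 𝓘(ℝ, Eu (n + 1)) 𝓘(ℝ) ∞ F)
    (hG : ContMDiff 𝓘(ℝ, Eu (n + 1)) 𝓘(ℝ) ∞ G) (hFK : ∀ q ∉ K, F q = 0) :
    ∫ p : frontier Ω, (F p * ambientLapPow cov ρ m ((m : ℝ) - n / 2) G p -
      G p * ambientLapPow cov ρ m ((m : ℝ) - n / 2) F p)
        ∂((affineVolume cov η Ω).comap Subtype.val) = 0 := by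
  have hφb := H.adaptedChart_mem_boundaryCharts hφ
  rw [H.integral_affineVolume hφ (g := fun p => F p * ambientLapPow cov ρ m ((m : ℝ) - n / 2) G p -
    G p * ambientLapPow cov ρ m ((m : ℝ) - n / 2) F p)
    ((hF.continuous.continuousOn.mul (H.continuousOn_ambientLapPow m _ hG)).sub
      (hG.continuous.continuousOn.mul (H.continuousOn_ambientLapPow m _ hF))) ?_]
  · have hsl : slice φ.target = slice (regularSet cov φ ρ) :=
      Set.Subset.antisymm (fun y hy => H.mem_regularSet hφ.1 hy
        (((hφb.2 _ hy).2).2 (ambPt_zero 0 y))) fun y hy => hy.1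
    rw [hsl]
    refine Eq.trans ?_ ((H.isAdapted hφ).integral_lapPow_antisymm hm (K := φ '' K)
      (hK.image_of_continuousOn (φ.continuousOn.mono hKφ)) hKr.image_subset
      (contDiffOn_comp_symm hφ.1 hF) (contDiffOn_comp_symm hφ.1 hG)
      fun x hx => hFK _ fun h => hx.2 ⟨_, h, φ.right_inv hx.1.1⟩)
    refine setIntegral_congr_fun (isOpen_slice (H.isAdapted hφ).isOpen).measurableSet
      fun y hy => ?_
    have hs : bdryParam φ y ∈ φ.source := φ.map_target hy.1
    have hM : bdryParam φ y ∈ frontier Ω := ((hφb.2 _ hy.1).2).2 (ambPt_zero 0 y)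
    have hy' : φ (bdryParam φ y) = ambPt 0 y := φ.right_inv hy.1
    simp only [H.ambientLapPow_eq hφ.1 m _ hF hs hM, H.ambientLapPow_eq hφ.1 m _ hG hs hM, hy']
    rfl
  · intro p hM hp
    have hpK : p ∈ Kᶜ := fun h => hp (hKφ h)
    rw [H.ambientLapPow_congr hm hF contMDiff_const hM hK.isClosed.isOpen_compl hpK
      fun q hq _ => hFK q hq, H.ambientLapPow_zero m _ hM, hFK p hpK]
    simp

/-- A finite smooth partition of unity on the boundary whose members have compact support in the
regular part of adapted charts. -/
theorem exists_partition (H : IsNormalized cov η Ω ρ) [SecondCountableTopology N]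
    (hc : IsCompact (closure Ω)) : ∃ (t : Finset (frontier Ω)) (χ : t → N → ℝ),
      (∀ i, ContMDiff 𝓘(ℝ, Eu (n + 1)) 𝓘(ℝ) ∞ (χ i)) ∧
      (∀ p ∈ frontier Ω, ∑ i, χ i p = 1) ∧
      ∀ i, ∃ φ ∈ adaptedCharts n ρ, ∃ K ⊆ φ.source, IsCompact K ∧
        Set.MapsTo φ K (regularSet cov φ ρ) ∧ ∀ q ∉ K, χ i q = 0 := by
  have hcM : IsCompact (frontier Ω) := hc.of_isClosed_subset isClosed_frontier
    frontier_subset_closure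
  have := ChartedSpace.locallyCompactSpace (Eu (n + 1)) N
  have hex : ∀ p ∈ frontier Ω, ∃ K : Set N, p ∈ interior K ∧ IsCompact K ∧
      ∃ φ ∈ adaptedCharts n ρ, K ⊆ φ.source ∧ Set.MapsTo φ K (regularSet cov φ ρ) := by
    intro p hM
    obtain ⟨φ, hφ, hp⟩ := H.exists_adaptedChart hM
    obtain ⟨K, hK, hpK, hKs⟩ := exists_compact_subset
      (φ.isOpen_inter_preimage (H.isAdapted hφ).isOpen) ⟨hp, H.map_mem_regularSet hφ.1 hp hM⟩
    exact ⟨K, hpK, hK, φ, hφ, fun q hq => (hKs hq).1, fun q hq => (hKs hq).2⟩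
  choose K hpK hK φ hφ hKφ hKr using hex
  obtain ⟨t, ht⟩ := hcM.elim_nhds_subcover' (fun p hp => interior (K p hp))
    fun p hp => isOpen_interior.mem_nhds (hpK p hp)
  obtain ⟨χ, hχ⟩ := SmoothPartitionOfUnity.exists_isSubordinate 𝓘(ℝ, Eu (n + 1))
    (isClosed_frontier (s := Ω)) (fun p : t => interior (K p.1 p.1.2)) (fun _ => isOpen_interior)
    (by simpa [Set.iUnion_subtype] using ht)
  refine ⟨t, fun i => χ i, fun i => (χ i).contMDiff, fun p hp => ?_, fun i =>
    ⟨φ i.1 i.1.2, hφ _ _, K i.1 i.1.2, hKφ _ _, hK _ _, hKr _ _, fun q hq => ?_⟩⟩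
  · rw [← finsum_eq_sum_of_fintype]
    exact χ.sum_eq_one hp
  · exact image_eq_zero_of_notMem_tsupport fun h => hq (interior_subset (hχ i h))

theorem integrable_of_continuousOn (H : IsNormalized cov η Ω ρ) [MeasurableSpace N]
    [BorelSpace N] (hc : IsCompact (closure Ω)) {g : N → ℝ} (hg : ContinuousOn g (frontier Ω)) :
    Integrable (fun p : frontier Ω => g p) ((affineVolume cov η Ω).comap Subtype.val) := by
  have hcM : IsCompact (frontier Ω) := hc.of_isClosed_subset isClosed_frontier
    frontier_subset_closure
  have := isCompact_iff_compactSpace.1 hcM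
  have : IsFiniteMeasure ((affineVolume cov η Ω).comap (Subtype.val : frontier Ω → N)) := by
    refine ⟨?_⟩
    rw [comap_subtype_coe_apply isClosed_frontier.measurableSet]
    simpa using H.affineVolume_frontier_lt_top hc
  exact (continuousOn_iff_continuous_domRestrict.1 hg).integrable_of_hasCompactSupport
    (HasCompactSupport.of_compactSpace _)

/-- The operator `Δ̃^m|_M` is symmetric, by a partition of unity. -/
theorem integral_antisymm (H : IsNormalized cov η Ω ρ) [SecondCountableTopology N]
    [MeasurableSpace N] [BorelSpace N] (hc : IsCompact (closure Ω)) {m : ℕ} (hm : 1 ≤ m)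
    {F G : N → ℝ} (hF : ContMDiff 𝓘(ℝ, Eu (n + 1)) 𝓘(ℝ) ∞ F)
    (hG : ContMDiff 𝓘(ℝ, Eu (n + 1)) 𝓘(ℝ) ∞ G) :
    ∫ p : frontier Ω, (F p * ambientLapPow cov ρ m ((m : ℝ) - n / 2) G p -
      G p * ambientLapPow cov ρ m ((m : ℝ) - n / 2) F p)
        ∂((affineVolume cov η Ω).comap Subtype.val) = 0 := by
  obtain ⟨t, χ, hχ, hsum, hsupp⟩ := H.exists_partition hc
  have hχF : ∀ i, ContMDiff 𝓘(ℝ, Eu (n + 1)) 𝓘(ℝ) ∞ fun q => χ i q * F q := fun i =>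
    (hχ i).mul hF
  have hdec : ∀ p ∈ frontier Ω, ∑ i, χ i p * F p = F p := fun p hp => by
    rw [← Finset.sum_mul, hsum p hp, one_mul]
  have hop : ∀ p ∈ frontier Ω, ambientLapPow cov ρ m ((m : ℝ) - n / 2) F p =
      ∑ i, ambientLapPow cov ρ m ((m : ℝ) - n / 2) (fun q => χ i q * F q) p := fun p hp => by
    rw [← H.ambientLapPow_sum m _ Finset.univ hχF hp]
    exact H.ambientLapPow_congr hm hF (contMDiff_finsetSum fun i _ => hχF i) hp isOpen_univ
      trivial fun q _ hq => (hdec q hq).symm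
  have hint : ∀ p : frontier Ω, F p * ambientLapPow cov ρ m ((m : ℝ) - n / 2) G p -
      G p * ambientLapPow cov ρ m ((m : ℝ) - n / 2) F p =
      ∑ i, (χ i p * F p * ambientLapPow cov ρ m ((m : ℝ) - n / 2) G p -
        G p * ambientLapPow cov ρ m ((m : ℝ) - n / 2) (fun q => χ i q * F q) p) := fun p => by
    rw [Finset.sum_sub_distrib, ← Finset.sum_mul, ← Finset.mul_sum, hdec p p.2, hop p p.2]
  simp only [hint]
  rw [integral_finsetSum]
  · refine Finset.sum_eq_zero fun i _ => ?_
    obtain ⟨φ, hφ, K, hKφ, hK, hKr, h0⟩ := hsupp i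
    exact H.integral_antisymm_of_support hφ hm hK hKφ hKr (hχF i) hG
      fun q hq => by rw [h0 q hq, zero_mul]
  · intro i _
    exact H.integrable_of_continuousOn hc
      (((hχF i).continuous.continuousOn.mul (H.continuousOn_ambientLapPow m _ hG)).sub
        (hG.continuous.continuousOn.mul (H.continuousOn_ambientLapPow m _ (hχF i))))

/-- The operator `P_m` may be computed from any extension. -/
theorem gjms_eq (H : IsNormalized cov η Ω ρ) {m : ℕ} (hm : 1 ≤ m) {f : frontier Ω → ℝ}
    {F : N → ℝ} (hF : ContMDiff 𝓘(ℝ, Eu (n + 1)) 𝓘(ℝ) ∞ F) (hf : ∀ p : frontier Ω, F p = f p)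
    (p : frontier Ω) :
    gjms cov Ω ρ m f p = ambientLapPow cov ρ m ((m : ℝ) - (n : ℝ) / 2) F p := by
  have hb : BdrySmooth (n := n) f := ⟨F, hF, hf⟩
  rw [gjms, dif_pos hb]
  exact H.ambientLapPow_congr hm hb.choose_spec.1 hF p.2 isOpen_univ trivial fun q _ hq =>
    (hb.choose_spec.2 ⟨q, hq⟩).trans (hf ⟨q, hq⟩).symm

theorem isFormallySelfAdjoint (H : IsNormalized cov η Ω ρ) [SecondCountableTopology N]
    [MeasurableSpace N] [BorelSpace N] (hc : IsCompact (closure Ω)) {m : ℕ} (hm : 1 ≤ m) :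
    IsFormallySelfAdjoint cov η Ω ρ m := by
  have hint : ∀ f₁ f₂ : frontier Ω → ℝ, BdrySmooth (n := n) f₁ → BdrySmooth (n := n) f₂ →
      Integrable (fun p => f₁ p * gjms cov Ω ρ m f₂ p)
        ((affineVolume cov η Ω).comap Subtype.val) := by
    rintro f₁ f₂ ⟨F, hF, hf₁⟩ ⟨G, hG, hf₂⟩
    simp only [← hf₁, H.gjms_eq hm hG hf₂]
    exact H.integrable_of_continuousOn hc
      (hF.continuous.continuousOn.mul (H.continuousOn_ambientLapPow m _ hG))
  refine ⟨fun F hF p => H.gjms_eq hm hF (fun _ => rfl) p, hint, fun f₁ f₂ h₁ h₂ => ?_⟩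
  rw [← sub_eq_zero, ← integral_sub (hint f₁ f₂ h₁ h₂) (hint f₂ f₁ h₂ h₁)]
  obtain ⟨F, hF, hf₁⟩ := h₁
  obtain ⟨G, hG, hf₂⟩ := h₂
  simp only [← hf₁, ← hf₂, H.gjms_eq hm hG hf₂, H.gjms_eq hm hF hf₁]
  exact H.integral_antisymm hc hm hF hG

end IsNormalized

/-- The Monge–Ampère equation `𝒥[ρ] = -1 + 𝒪 ρ^k` with `k ≥ 1` gives `𝒥[ρ] = -1` on `M`. -/
theorem MongeAmpereMod.mongeAmpere_eq {k : ℕ} (hk : k ≠ 0) {O : N → ℝ}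
    (h : MongeAmpereMod cov η Ω ρ k O) {p : N} (hp : p ∈ frontier Ω) (hρ : ρ p = 0) :
    mongeAmpere cov η ρ p = -1 := by
  obtain ⟨U, -, hMU, -, hU⟩ := h
  rw [hU p (hMU hp), hρ, zero_pow hk, mul_zero, add_zero]

theorem IsFefferman.mongeAmpere_eq (hF : IsFefferman cov η Ω ρ) {p : N} (hp : p ∈ frontier Ω)
    (hρ : ρ p = 0) : mongeAmpere cov η ρ p = -1 := by
  rcases Nat.even_or_odd n with hn | hn
  · obtain ⟨O, hO⟩ := hF.2 hn
    exact hO.mongeAmpere_eq (Nat.succ_ne_zero _) hp hρ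
  · obtain ⟨O, hO⟩ := hF.1 hn 1
    exact hO.mongeAmpere_eq one_ne_zero hp hρ

end SelfAdjoint

end ConformalCodazzi

end

theorem mainTheorem5 (n : ℕ) (hn : 1 ≤ n) {N : Type*} [TopologicalSpace N]
    [ChartedSpace (EuclideanSpace ℝ (Fin (n + 1))) N]
    [IsManifold 𝓘(ℝ, EuclideanSpace ℝ (Fin (n + 1))) ∞ N]
    [T2Space N] [SecondCountableTopology N] [MeasurableSpace N] [BorelSpace N]
    (cov : ConformalCodazzi.Connection n N) (hcov : CovariantDerivative.ContMDiffCovariantDerivative cov ∞)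
    (htor : cov.torsion = 0)
    (η : ConformalCodazzi.VolumeForm n N) (hη : ConformalCodazzi.IsProjectiveScale cov η)
    (hflat : ConformalCodazzi.IsProjectivelyFlat cov)
    (Ω : Set N) (hΩopen : IsOpen Ω) (hΩconn : IsConnected Ω) (hΩcomp : IsCompact (closure Ω))
    (ρ : N → ℝ) (hρ : ConformalCodazzi.IsDefining (n := n) Ω ρ)
    (hconv : ConformalCodazzi.IsStrictlyConvex cov Ω ρ)
    (hF : ConformalCodazzi.IsFefferman cov η Ω ρ) :
    (Odd n → ∀ m : ℕ, 1 ≤ m → ConformalCodazzi.IsFormallySelfAdjoint cov η Ω ρ m) ∧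
    (Even n → ∀ m : ℕ, 1 ≤ m → m ≤ n / 2 →
      ConformalCodazzi.IsFormallySelfAdjoint cov η Ω ρ m) ∧
    (Even n → ConformalCodazzi.IsStrictFefferman cov η Ω ρ →
      ConformalCodazzi.IsFormallySelfAdjoint cov η Ω ρ (n / 2 + 2)) := by
  have H : ConformalCodazzi.IsNormalized cov η Ω ρ :=
    ⟨hcov, htor, hη, hΩopen, hρ, fun p hp => hF.mongeAmpere_eq hp (hρ.eq_zero_of_mem_frontier hp)⟩
  exact ⟨fun _ m hm => H.isFormallySelfAdjoint hΩcomp hm,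
    fun _ m hm _ => H.isFormallySelfAdjoint hΩcomp hm,
    fun _ _ => H.isFormallySelfAdjoint hΩcomp (by omega)⟩
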